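/- Let $\alpha=(\alpha_1,\dots,\alpha_n)$ be positive real numbers that are generic, i.e. $\sum_{i\in T}\alpha_i\neq\sum_{j\in T^c}\alpha_j$ for every $T\subseteq\{1,\dots,n\}$. Write points of $T^*\mathbb{C}^{2n}$ as $(p,q)$, with $p=(p_1,\dots,p_n)$ an $n$-tuple of row vectors and $q=(q_1,\dots,q_n)$ an $n$-tuple of column vectors in $\mathbb{C}^2$. The group $G=(SL(2,\mathbb{C})\times(\mathbb{C}^*)^n)/\mathbb{Z}_2$, where $\mathbb{Z}_2$ is generated by $(-1;-1,\dots,-1)$, acts on the right by $$(p,q)[A;e_1,\dots,e_n]=\big((e_i^{-1}p_iA)_i,(A^{-1}q_ie_i)_i\big),$$ and $K=(SU(2)\times U(1)^n)/\mathbb{Z}_2\subseteq G$. With $(\cdot)_0$ denoting the traceless part of a $2\times2$ matrix, put $$\mu_{\mathbb{R}}(p,q)=\frac{\sqrt{-1}}{2}\sum_{i}(q_iq_i^*-p_i^*p_i)_0\oplus\Big(\tfrac12(|q_i|^2-|p_i|^2)\Big)_i,\qquad \mu_{\mathbb{C}}(p,q)=-\sum_i(q_ip_i)_0\oplus(\sqrt{-1}\,p_iq_i)_i,$$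 and let the hyperpolygon space be the topological quotient $$X=\big(\mu_{\mathbb{R}}^{-1}(0\oplus\alpha)\cap\mu_{\mathbb{C}}^{-1}(0)\big)/K .$$ Let $\lambda\in\mathbb{C}^*$ act on $X$ by $\lambda\cdot[p,q]=[\lambda p,q]$; that is, $\lambda\cdot[p,q]$ is the class of a point of $\mu_{\mathbb{R}}^{-1}(0\oplus\alpha)\cap\mu_{\mathbb{C}}^{-1}(0)$ lying in the $G$-orbit of $(\lambda p,q)$. A subset $T\subseteq\{1,\dots,n\}$ is straight in $(p,q)$ if $q_i$ is proportional to $q_j$ for all $i,j\in T$. Let $S\subseteq\{1,\dots,n\}$ satisfy $|S|\ge2$ and be short, i.e. $\sum_{i\in S}\alpha_i<\sum_{j\in S^c}\alpha_j$. Let $$X_S=\{[p,q]\in X \mid S \text{ and } S^c \text{ are each straight, and } p_j=0 \text{ for all } j\in S^c\},$$ and let the core component $U_S$ be the closure in $X$ of $\{x\in X\mid \lim_{\lambda\to\infty}\lambda\cdot x \text{ exists and lies in } X_S\}$. Then $U_S$, with the subspace topology, is homeomorphic to the moduli space of $n+1$ vectors $u_i$ $(i\in S)$, $v_j$ $(j\in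 S^c)$ and $w$ in $\mathbb{R}^3$ satisfying 1. $w+\sum_{j\in S^c}v_j=0$, 2. $\sum_{i\in S}u_i=0$, 3. $u_i\cdot w=0$ for all $i\in S$, 4. $\|v_j\|=\alpha_j$ for all $j\in S^c$, 5. $\|w\|=\sum_{i\in S}\sqrt{\alpha_i^2+\|u_i\|^2}$, taken up to simultaneous rotation by $SO(3)$, with the quotient topology. -/

import Mathlib

namespace Hyperpolygon

open scoped Matrix

/-- The vector space `T*ℂ²ⁿ`: pairs `(p, q)` of `n`-tuples, where each `p i` is a row vector in `ℂ²`
and each `q i` is a column vector in `ℂ²`. -/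
abbrev Cot (n : ℕ) : Type := (Fin n → Fin 2 → ℂ) × (Fin n → Fin 2 → ℂ)

/-- The right action of `(A; e₁, …, eₙ) ∈ SL(2,ℂ) × (ℂˣ)ⁿ`, namely
`(p, q) ↦ ((eᵢ⁻¹ pᵢ A)ᵢ, (A⁻¹ qᵢ eᵢ)ᵢ)`. The subgroup `ℤ/2` generated by `(-1; -1, …, -1)` acts
trivially, so the orbits are those of `G = (SL(2,ℂ) × (ℂˣ)ⁿ) / (ℤ/2)`. -/
def act {n : ℕ} (A : Matrix.SpecialLinearGroup (Fin 2) ℂ) (e : Fin n → ℂˣ) (z : Cot n) : Cot n :=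
  (fun i => (((e i)⁻¹ : ℂˣ) : ℂ) • (z.1 i ᵥ* (A : Matrix (Fin 2) (Fin 2) ℂ)),
   fun i => ((e i : ℂˣ) : ℂ) • (((A⁻¹ : Matrix.SpecialLinearGroup (Fin 2) ℂ) :
      Matrix (Fin 2) (Fin 2) ℂ) *ᵥ z.2 i))

theorem act_one {n : ℕ} (z : Cot n) : act 1 1 z = z := by
  simp [act]

theorem act_act {n : ℕ} (A B : Matrix.SpecialLinearGroup (Fin 2) ℂ) (e f : Fin n → ℂˣ) (z : Cot n) :
    act B f (act A e z) = act (A * B) (e * f) z := by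
  refine Prod.ext ?_ ?_ <;> funext i
  · simp [act, Matrix.smul_vecMul, smul_smul, Matrix.vecMul_vecMul, mul_comm]
  · have h : (((A * B)⁻¹ : Matrix.SpecialLinearGroup (Fin 2) ℂ) : Matrix (Fin 2) (Fin 2) ℂ)
        = ((B⁻¹ : Matrix.SpecialLinearGroup (Fin 2) ℂ) : Matrix (Fin 2) (Fin 2) ℂ)
          * ((A⁻¹ : Matrix.SpecialLinearGroup (Fin 2) ℂ) : Matrix (Fin 2) (Fin 2) ℂ) :=
      (congrArg Subtype.val (mul_inv_rev A B)).trans (Matrix.SpecialLinearGroup.coe_mul B⁻¹ A⁻¹)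
    simp only [act, Pi.mul_apply, Units.val_mul, Matrix.mulVec_smul, smul_smul,
      Matrix.mulVec_mulVec, mul_comm, h]

/-- Membership of `(A; e₁, …, eₙ)` in the maximal compact subgroup `SU(2) × U(1)ⁿ`. -/
def IsCompactElt {n : ℕ} (A : Matrix.SpecialLinearGroup (Fin 2) ℂ) (e : Fin n → ℂˣ) : Prop :=
  (A : Matrix (Fin 2) (Fin 2) ℂ) ∈ Matrix.unitaryGroup (Fin 2) ℂ ∧ ∀ i, ‖((e i : ℂˣ) : ℂ)‖ = 1

/-- The traceless part of a `2 × 2` matrix. -/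
noncomputable def traceless (M : Matrix (Fin 2) (Fin 2) ℂ) : Matrix (Fin 2) (Fin 2) ℂ :=
  M - (M.trace / 2) • (1 : Matrix (Fin 2) (Fin 2) ℂ)

/-- The squared Hermitian norm of a vector in `ℂ²`. -/
noncomputable def sqNorm (x : Fin 2 → ℂ) : ℝ := ∑ k, ‖x k‖ ^ 2

/-- The real moment map
`μ_ℝ(p, q) = (√-1/2) ∑ (qᵢ qᵢ* - pᵢ* pᵢ)₀ ⊕ (½(|q₁|² - |p₁|²), …, ½(|qₙ|² - |pₙ|²))`. -/
noncomputable def muR {n : ℕ} (z : Cot n) : Matrix (Fin 2) (Fin 2) ℂ × (Fin n → ℝ) :=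
  ((Complex.I / 2) • ∑ i, traceless
      (Matrix.vecMulVec (z.2 i) (star (z.2 i)) - Matrix.vecMulVec (star (z.1 i)) (z.1 i)),
   fun i => (1 / 2) * (sqNorm (z.2 i) - sqNorm (z.1 i)))

/-- The complex moment map `μ_ℂ(p, q) = -∑ (qᵢ pᵢ)₀ ⊕ (√-1 p₁ q₁, …, √-1 pₙ qₙ)`. -/
noncomputable def muC {n : ℕ} (z : Cot n) : Matrix (Fin 2) (Fin 2) ℂ × (Fin n → ℂ) :=
  (-∑ i, traceless (Matrix.vecMulVec (z.2 i) (z.1 i)), fun i => Complex.I * (z.1 i ⬝ᵥ z.2 i))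

/-- The level set `μ_ℝ⁻¹(0 ⊕ α) ∩ μ_ℂ⁻¹(0)`. -/
abbrev Level {n : ℕ} (α : Fin n → ℝ) : Type := {z : Cot n // muR z = (0, α) ∧ muC z = 0}

/-- Two points of the level set are equivalent when they lie in one orbit of the compact group
`K = (SU(2) × U(1)ⁿ) / (ℤ/2)`. -/
def levelSetoid {n : ℕ} (α : Fin n → ℝ) : Setoid (Level α) where
  r z z' := ∃ (A : Matrix.SpecialLinearGroup (Fin 2) ℂ) (e : Fin n → ℂˣ),
    IsCompactElt A e ∧ z'.1 = act A e z.1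
  iseqv :=
    { refl := fun z => ⟨1, 1, ⟨by simp [one_mem], by simp⟩, (act_one z.1).symm⟩
      symm := by
        rintro z z' ⟨A, e, ⟨hA, he⟩, h⟩
        refine ⟨A⁻¹, e⁻¹, ⟨?_, fun i => by simp [he i]⟩, ?_⟩
        · have h1 : ((A⁻¹ : Matrix.SpecialLinearGroup (Fin 2) ℂ) : Matrix (Fin 2) (Fin 2) ℂ)
              = star (A : Matrix (Fin 2) (Fin 2) ℂ) := by
            have h2 := (Matrix.mem_unitaryGroup_iff).1 hA
            have h3 : ((A⁻¹ : Matrix.SpecialLinearGroup (Fin 2) ℂ) : Matrix (Fin 2) (Fin 2) ℂ)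
                * (A : Matrix (Fin 2) (Fin 2) ℂ) = 1 :=
              (Matrix.SpecialLinearGroup.coe_mul A⁻¹ A).symm.trans (congrArg Subtype.val (inv_mul_cancel A))
            exact left_inv_eq_right_inv h3 h2
          rw [h1]
          exact Unitary.star_mem hA
        · rw [h, act_act, mul_inv_cancel, mul_inv_cancel, act_one]
      trans := by
        rintro z z' z'' ⟨A, e, ⟨hA, he⟩, h⟩ ⟨B, f, ⟨hB, hf⟩, h'⟩
        refine ⟨A * B, e * f, ⟨?_, fun i => by simp [he i, hf i]⟩, ?_⟩
        · exact (mul_mem hA hB :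
            (A : Matrix (Fin 2) (Fin 2) ℂ) * (B : Matrix (Fin 2) (Fin 2) ℂ) ∈ Matrix.unitaryGroup (Fin 2) ℂ)
        · rw [h', h, act_act] }

/-- The hyperpolygon space `X(α) = (μ_ℝ⁻¹(α) ∩ μ_ℂ⁻¹(0)) / K`, with the quotient topology. -/
abbrev X {n : ℕ} (α : Fin n → ℝ) : Type := Quotient (levelSetoid α)

/-- The class `[p, q]_ℝ` of a point of the level set. -/
def X.mk {n : ℕ} {α : Fin n → ℝ} (z : Level α) : X α := Quotient.mk (levelSetoid α) z

/-- `α` is generic: no subset has the same total length as its complement. -/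
def IsGeneric {n : ℕ} (α : Fin n → ℝ) : Prop :=
  ∀ T : Finset (Fin n), ∑ i ∈ T, α i ≠ ∑ j ∈ Tᶜ, α j

/-- `S` is short: `∑_{i ∈ S} αᵢ < ∑_{j ∉ S} αⱼ`. -/
def IsShort {n : ℕ} (α : Fin n → ℝ) (S : Finset (Fin n)) : Prop :=
  ∑ i ∈ S, α i < ∑ j ∈ Sᶜ, α j

/-- `S` is straight in `(p, q)`: `q i` is proportional to `q j` for all `i, j ∈ S`. -/
def IsStraight {n : ℕ} (S : Finset (Fin n)) (z : Cot n) : Prop :=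
  ∀ i ∈ S, ∀ j ∈ S, ∃ c : ℂ, z.2 i = c • z.2 j

/-- `IsScaled t x y` says `y = t · x` for the action of `t ∈ ℂˣ` on `X(α)` that is given, on
`G`-orbits, by `t · [p, q] = [t p, q]`: the point `y` is the class of a point of the level set that
lies in the orbit of `(t p, q)` under `G`, where `[p, q]_ℝ = x`. -/
def IsScaled {n : ℕ} {α : Fin n → ℝ} (t : ℂ) (x y : X α) : Prop :=
  ∃ z z' : Level α, X.mk z = x ∧ X.mk z' = y ∧
    ∃ (A : Matrix.SpecialLinearGroup (Fin 2) ℂ) (e : Fin n → ℂˣ), z'.1 = act A e (t • z.1.1, z.1.2)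

/-- `lim_{t → ∞} t · x = y` in `X(α)`, for the action of `t ∈ ℂˣ`. -/
def FlowsUpTo {n : ℕ} {α : Fin n → ℝ} (x y : X α) : Prop :=
  ∃ f : ℂ → X α, (∀ t : ℂ, t ≠ 0 → IsScaled t x (f t)) ∧
    Filter.Tendsto f (Bornology.cobounded ℂ) (nhds y)

/-- The fixed point component `X_S`: classes `[p, q]` for which `S` and its complement are each
straight and `p j = 0` for all `j ∉ S`. -/
def fixedComponent {n : ℕ} (α : Fin n → ℝ) (S : Finset (Fin n)) : Set (X α) :=
  {x | ∃ z : Level α, X.mk z = x ∧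
    IsStraight S z.1 ∧ IsStraight Sᶜ z.1 ∧ ∀ j ∈ Sᶜ, z.1.1 j = 0}

/-- The core component `U_S`: the closure in `X(α)` of the set of points that flow up to `X_S`. -/
def coreComponent {n : ℕ} (α : Fin n → ℝ) (S : Finset (Fin n)) : Set (X α) :=
  closure {x | ∃ y ∈ fixedComponent α S, FlowsUpTo x y}

/-- Euclidean three-space. -/
abbrev E3 : Type := EuclideanSpace ℝ (Fin 3)

/-- Collections of `n + 1` vectors `uᵢ` (`i ∈ S`), `vⱼ` (`j ∉ S`) and `w` in `ℝ³`. -/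
structure VectorData {n : ℕ} (S : Finset (Fin n)) where
  u : S → E3
  v : (Sᶜ : Finset (Fin n)) → E3
  w : E3

/-- The topology of the finite product of copies of `ℝ³`. -/
instance {n : ℕ} (S : Finset (Fin n)) : TopologicalSpace (VectorData S) :=
  TopologicalSpace.induced (fun d => (d.u, d.v, d.w)) inferInstance

/-- The five conditions on a spatial polygon with a distinguished edge `w` and a planar polygon in
the plane perpendicular to `w`. -/
structure IsPolygonPair {n : ℕ} (α : Fin n → ℝ) (S : Finset (Fin n)) (d : VectorData S) :
    Prop where
  closed_spatial : d.w + ∑ j : (Sᶜ : Finset (Fin n)), d.v j = 0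
  closed_planar : ∑ i : S, d.u i = 0
  perp : ∀ i : S, inner ℝ (d.u i) d.w = 0
  length_v : ∀ j : (Sᶜ : Finset (Fin n)), ‖d.v j‖ = α j
  length_w : ‖d.w‖ = ∑ i : S, Real.sqrt (α i ^ 2 + ‖d.u i‖ ^ 2)

/-- The space of all vectors satisfying the five conditions, as a subspace. -/
abbrev PolygonPair {n : ℕ} (α : Fin n → ℝ) (S : Finset (Fin n)) : Type :=
  {d : VectorData S // IsPolygonPair α S d}

/-- A rotation of `ℝ³`: a linear isometry of determinant one. -/
def IsRotation (R : E3 ≃ₗᵢ[ℝ] E3) : Prop :=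
  LinearMap.det (R.toLinearEquiv : E3 →ₗ[ℝ] E3) = 1

/-- Simultaneous rotation of all the vectors. -/
noncomputable def VectorData.rotate {n : ℕ} {S : Finset (Fin n)} (R : E3 ≃ₗᵢ[ℝ] E3) (d : VectorData S) :
    VectorData S :=
  ⟨fun i => R (d.u i), fun j => R (d.v j), R d.w⟩

/-- Two polygon pairs are equivalent when some rotation in `SO(3)` takes one to the other. -/
def rotationSetoid {n : ℕ} (α : Fin n → ℝ) (S : Finset (Fin n)) : Setoid (PolygonPair α S) where
  r d d' := ∃ R : E3 ≃ₗᵢ[ℝ] E3, IsRotation R ∧ d'.1 = d.1.rotate R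
  iseqv :=
    { refl := fun d => ⟨LinearIsometryEquiv.refl ℝ E3, LinearMap.det_id, rfl⟩
      symm := by
        rintro d d' ⟨R, hR, h⟩
        refine ⟨R.symm, ?_, ?_⟩
        · have h1 := LinearEquiv.det_mul_det_symm R.toLinearEquiv
          unfold IsRotation at hR ⊢
          rw [hR, one_mul] at h1
          exact h1
        · rw [h]
          simp [VectorData.rotate]
      trans := by
        rintro d d' d'' ⟨R, hR, h⟩ ⟨Q, hQ, h'⟩
        refine ⟨R.trans Q, ?_, ?_⟩
        · unfold IsRotation at hR hQ ⊢
          have h1 : (((R.trans Q).toLinearEquiv : E3 ≃ₗ[ℝ] E3) : E3 →ₗ[ℝ] E3)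
              = (Q.toLinearEquiv : E3 →ₗ[ℝ] E3).comp (R.toLinearEquiv : E3 →ₗ[ℝ] E3) := rfl
          rw [h1, LinearMap.det_comp, hR, hQ, one_mul]
        · rw [h', h]
          simp [VectorData.rotate] }

/-- The moduli space of polygon pairs up to rotation, with the quotient topology. -/
abbrev PolygonPairModuli {n : ℕ} (α : Fin n → ℝ) (S : Finset (Fin n)) : Type :=
  Quotient (rotationSetoid α S)

end Hyperpolygon

/-! The component `U_S` equals `coreSet`, the set of classes for which `S` is straight and `p_j = 0`
off `S`, and such classes can be read off from polygons. Conjugation by `SU(2)` rotates the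
traceless Hermitian part of a matrix, viewed in `ℝ³`. Hence the matrices `2 q_i p_i`, the Hopf
images of the `q_j` and the partial real moment over `S` give vectors `u`, `v`, `w` on which `K`
acts by rotations (`poly`). Once the common line of the `q_i`, `i ∈ S`, is horizontal, `p_i q_i = 0`
makes `p_i` vertical, `w` points up, and `u_i` is the complex number `q_i p_i` in the horizontal
plane. The moment equations become the five polygon conditions, and `|q_i|² - |p_i|² = 2 α_i` with
`|q_i| |p_i| = ‖u_i‖` recovers the lengths; this is the origin of the square roots. The polygons
determine the configuration up to `K`, so the polygon map induces a continuous bijection from a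
compact space to a Hausdorff one (`exists_homeomorph_coreSet`).

For `U_S ⊆ coreSet`: the functions `|q_i ∧ q_j|` and `|p_i q_j|` descend to `X`, and scaling by `t`
multiplies them by `r_i r_j` and `r_i⁻¹ r_j |t|` with unknown positive weights. Combinations in
which the weights cancel blow up unless they vanish. If the limit lies in `X_S`, where genericity
forces some `p_i ≠ 0`, this yields the equations of `coreSet` (`mem_coreSet_of_flowsUpTo`), which
are closed.

For the converse, put `w` on the vertical axis and give each `v_j` its stereographic coordinate
`ζ_j`, finite unless `v_j` points along `w`. Upper triangular elements of `G` act by `ζ ↦ r ζ + c`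
and, combined with scaling, by `u ↦ t r u`. The `r`, `c` that bring the scaled point back to the
level set come from a minimum of a Kempf–Ness type function, which is coercive because `S` is short
(`exists_isBalanced`). The moment equation bounds `t r`, so `r` and `c` tend to zero as `|t| → ∞`:
all `v_j` turn opposite to `w` and the limit lies in `X_S` (`exists_flowsUpTo_affine`). This covers
all pairs with `u ≠ 0` and no `v_j` along `w`. Tilting edges shows that these are dense
(`IsPolygonPair.mem_closure_isNondegenerate`); when `u = 0`, the assumption `|S| ≥ 2` supplies a
planar polygon to open up. -/

/-! ### The Hermitian part, the moment maps and the group action -/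

namespace Hyperpolygon

open scoped Matrix
open Matrix (vecMulVec)
open Complex (normSq)

/-- The traceless Hermitian part of a complex `2 × 2` matrix, as a vector in `ℝ³`. -/
noncomputable def hermVec : Matrix (Fin 2) (Fin 2) ℂ →ₗ[ℝ] E3 where
  toFun M := !₂[((M 0 1).re + (M 1 0).re) / 2, ((M 0 1).im - (M 1 0).im) / 2,
    ((M 0 0).re - (M 1 1).re) / 2]
  map_add' M N := by
    ext k; fin_cases k <;> simp <;> ring
  map_smul' c M := by
    ext k; fin_cases k <;> simp <;> ring

@[simp] theorem hermVec_zero' (M : Matrix (Fin 2) (Fin 2) ℂ) :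
    hermVec M 0 = ((M 0 1).re + (M 1 0).re) / 2 := rfl

@[simp] theorem hermVec_one' (M : Matrix (Fin 2) (Fin 2) ℂ) :
    hermVec M 1 = ((M 0 1).im - (M 1 0).im) / 2 := rfl

@[simp] theorem hermVec_two' (M : Matrix (Fin 2) (Fin 2) ℂ) :
    hermVec M 2 = ((M 0 0).re - (M 1 1).re) / 2 := rfl

theorem E3.ext {x y : E3} (h0 : x 0 = y 0) (h1 : x 1 = y 1) (h2 : x 2 = y 2) : x = y := by
  ext k; fin_cases k <;> assumption

theorem E3.norm_sq (x : E3) : ‖x‖ ^ 2 = x 0 ^ 2 + x 1 ^ 2 + x 2 ^ 2 := by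
  rw [EuclideanSpace.norm_sq_eq, Fin.sum_univ_three]
  simp

/-- The matrix of the rotation of `ℝ³` that corresponds to an element of `SU(2)`. -/
noncomputable def rotMatrix (a b : ℂ) : Matrix (Fin 3) (Fin 3) ℝ :=
  !![a.re ^ 2 - a.im ^ 2 - (b.re ^ 2 - b.im ^ 2), 2 * a.re * a.im - 2 * b.re * b.im,
      2 * (a.re * b.re + a.im * b.im);
    -(2 * a.re * a.im) - 2 * b.re * b.im, a.re ^ 2 - a.im ^ 2 + (b.re ^ 2 - b.im ^ 2),
      2 * (a.re * b.im - a.im * b.re);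
    -2 * (a.re * b.re - a.im * b.im), -2 * (a.re * b.im + a.im * b.re),
      a.re ^ 2 + a.im ^ 2 - b.re ^ 2 - b.im ^ 2]

theorem det_rotMatrix (a b : ℂ) : (rotMatrix a b).det = (normSq a + normSq b) ^ 3 := by
  simp only [rotMatrix, Matrix.det_fin_three, Complex.normSq_apply, Matrix.of_apply,
    Matrix.cons_val]
  ring

theorem exists_rotation_of_linearMap (f : E3 →ₗ[ℝ] E3) (hf : ∀ x, ‖f x‖ = ‖x‖)
    (hdet : LinearMap.det f = 1) : ∃ R : E3 ≃ₗᵢ[ℝ] E3, IsRotation R ∧ ∀ x, R x = f x :=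
  ⟨LinearIsometry.toLinearIsometryEquiv ⟨f, hf⟩ rfl, hdet, fun _ => rfl⟩

theorem exists_rotation_rotMatrix (a b : ℂ) (h : normSq a + normSq b = 1) :
    ∃ R : E3 ≃ₗᵢ[ℝ] E3, IsRotation R ∧ ∀ x : E3, (R x).ofLp = rotMatrix a b *ᵥ x.ofLp := by
  obtain ⟨R, hR, hR'⟩ := exists_rotation_of_linearMap
    (Matrix.toEuclideanLin (rotMatrix a b)) (fun x => by
      -- `rotMatrix a b` is a similarity of ratio `|a|² + |b|²` for all `a` and `b`.
      have h2 : ‖Matrix.toEuclideanLin (rotMatrix a b) x‖ ^ 2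
          = (normSq a + normSq b) ^ 2 * ‖x‖ ^ 2 := by
        rw [E3.norm_sq, E3.norm_sq]
        simp only [Matrix.toEuclideanLin, Matrix.toLpLin_apply, Matrix.mulVec, dotProduct,
          Fin.sum_univ_three, rotMatrix, Matrix.of_apply, Matrix.cons_val,
          Complex.normSq_apply]
        ring
      rw [h] at h2
      have := norm_nonneg x
      have := norm_nonneg (Matrix.toEuclideanLin (rotMatrix a b) x)
      nlinarith)
    (by
      rw [Matrix.toEuclideanLin_eq_toLin_orthonormal, LinearMap.det_toLin, det_rotMatrix, h,
        one_pow])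
  exact ⟨R, hR, fun x => by rw [hR']; rfl⟩

/-! ### Conjugation by `SU(2)` as a rotation of `ℝ³`. -/

section SU2

variable {A : Matrix.SpecialLinearGroup (Fin 2) ℂ}

theorem SL2_inv_coe (A : Matrix.SpecialLinearGroup (Fin 2) ℂ) :
    ((A⁻¹ : Matrix.SpecialLinearGroup (Fin 2) ℂ) : Matrix (Fin 2) (Fin 2) ℂ)
      = !![A.1 1 1, -A.1 0 1; -A.1 1 0, A.1 0 0] := by
  rw [Matrix.SpecialLinearGroup.coe_inv, Matrix.adjugate_fin_two]

theorem SL2_det (A : Matrix.SpecialLinearGroup (Fin 2) ℂ) :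
    A.1 0 0 * A.1 1 1 - A.1 0 1 * A.1 1 0 = 1 := by
  rw [← Matrix.det_fin_two]; exact A.2

theorem inv_coe_of_unitary
    (hA : (A : Matrix (Fin 2) (Fin 2) ℂ) ∈ Matrix.unitaryGroup (Fin 2) ℂ) :
    ((A⁻¹ : Matrix.SpecialLinearGroup (Fin 2) ℂ) : Matrix (Fin 2) (Fin 2) ℂ) = (A.1)ᴴ := by
  have h3 : ((A⁻¹ : Matrix.SpecialLinearGroup (Fin 2) ℂ) : Matrix (Fin 2) (Fin 2) ℂ)
      * (A : Matrix (Fin 2) (Fin 2) ℂ) = 1 :=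
    (Matrix.SpecialLinearGroup.coe_mul A⁻¹ A).symm.trans (congrArg Subtype.val (inv_mul_cancel A))
  exact left_inv_eq_right_inv h3 ((Matrix.mem_unitaryGroup_iff).1 hA)

theorem unitary_entries
    (hA : (A : Matrix (Fin 2) (Fin 2) ℂ) ∈ Matrix.unitaryGroup (Fin 2) ℂ) :
    A.1 1 1 = star (A.1 0 0) ∧ A.1 1 0 = -star (A.1 0 1) := by
  have h := inv_coe_of_unitary hA
  rw [SL2_inv_coe] at h
  have h0 := congrFun (congrFun h 0) 0
  have h1 := congrFun (congrFun h 1) 0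
  simp at h0 h1
  exact ⟨h0, neg_eq_iff_eq_neg.mp h1⟩

theorem unitary_normSq
    (hA : (A : Matrix (Fin 2) (Fin 2) ℂ) ∈ Matrix.unitaryGroup (Fin 2) ℂ) :
    normSq (A.1 0 0) + normSq (A.1 0 1) = 1 := by
  obtain ⟨h1, h2⟩ := unitary_entries hA
  have h := SL2_det A
  rw [h1, h2] at h
  have := congrArg Complex.re h
  simp [Complex.normSq_apply] at this ⊢
  linarith

/-- Taking Hermitian parts commutes with unitary conjugation, so `M` need not be Hermitian. This
lets the planar vectors, built from the matrices `q_i p_i`, rotate together with the spatial ones.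
-/
theorem exists_rotation_of_unitary
    (hA : (A : Matrix (Fin 2) (Fin 2) ℂ) ∈ Matrix.unitaryGroup (Fin 2) ℂ) :
    ∃ R : E3 ≃ₗᵢ[ℝ] E3, IsRotation R ∧ ∀ M, R (hermVec M)
      = hermVec (((A⁻¹ : Matrix.SpecialLinearGroup (Fin 2) ℂ) : Matrix (Fin 2) (Fin 2) ℂ)
          * M * A.1) := by
  obtain ⟨R, hR, hR'⟩ := exists_rotation_rotMatrix _ _ (unitary_normSq hA)
  refine ⟨R, hR, fun M => ?_⟩
  have h := hR' (hermVec M)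
  obtain ⟨h1, h2⟩ := unitary_entries hA
  rw [SL2_inv_coe]
  apply E3.ext <;> rw [h] <;>
  · simp only [Matrix.mulVec, dotProduct, Fin.sum_univ_three, rotMatrix, Matrix.mul_apply,
      Fin.sum_univ_two, h1, h2, hermVec_zero', hermVec_one', hermVec_two', Matrix.of_apply,
      Matrix.cons_val]
    simp
    ring

end SU2

/-! ### The action on coordinates, rank-one matrices and norms. -/

section act

variable {n : ℕ} {A : Matrix.SpecialLinearGroup (Fin 2) ℂ} {e : Fin n → ℂˣ} {z : Cot n}

theorem act_fst_apply (A : Matrix.SpecialLinearGroup (Fin 2) ℂ) (e : Fin n → ℂˣ) (z : Cot n)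
    (i : Fin n) (k : Fin 2) : (act A e z).1 i k
      = ((e i)⁻¹ : ℂˣ) * (z.1 i 0 * A.1 0 k + z.1 i 1 * A.1 1 k) := by
  simp [act, Matrix.vecMul, dotProduct, Fin.sum_univ_two]

theorem act_snd_zero (A : Matrix.SpecialLinearGroup (Fin 2) ℂ) (e : Fin n → ℂˣ) (z : Cot n)
    (i : Fin n) : (act A e z).2 i 0 = (e i) * (A.1 1 1 * z.2 i 0 - A.1 0 1 * z.2 i 1) := by
  simp only [act, SL2_inv_coe]
  simp [dotProduct, Fin.sum_univ_two]
  ring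

theorem act_snd_one (A : Matrix.SpecialLinearGroup (Fin 2) ℂ) (e : Fin n → ℂˣ) (z : Cot n)
    (i : Fin n) : (act A e z).2 i 1 = (e i) * (A.1 0 0 * z.2 i 1 - A.1 1 0 * z.2 i 0) := by
  simp only [act, SL2_inv_coe]
  simp [dotProduct, Fin.sum_univ_two]
  ring

theorem vecMulVec_act (A : Matrix.SpecialLinearGroup (Fin 2) ℂ) (e : Fin n → ℂˣ) (z : Cot n)
    (i : Fin n) : vecMulVec ((act A e z).2 i) ((act A e z).1 i)
      = ((A⁻¹ : Matrix.SpecialLinearGroup (Fin 2) ℂ) : Matrix (Fin 2) (Fin 2) ℂ)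
        * vecMulVec (z.2 i) (z.1 i) * A.1 := by
  simp only [act]
  rw [Matrix.vecMulVec_smul, Matrix.smul_vecMulVec, smul_smul, ← Matrix.mul_vecMulVec,
    ← Matrix.vecMulVec_mul]
  simp [Matrix.mul_assoc]

theorem dotProduct_act (A : Matrix.SpecialLinearGroup (Fin 2) ℂ) (e : Fin n → ℂˣ) (z : Cot n)
    (i : Fin n) : (act A e z).1 i ⬝ᵥ (act A e z).2 i = z.1 i ⬝ᵥ z.2 i := by
  have he : ((e i)⁻¹ : ℂˣ) * (e i : ℂ) = 1 := by simp
  have hd := SL2_det A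
  simp only [dotProduct, Fin.sum_univ_two, act_fst_apply, act_snd_zero, act_snd_one]
  linear_combination (z.1 i 0 * z.2 i 0 + z.1 i 1 * z.2 i 1) * hd
    + (z.1 i 0 * z.2 i 0 + z.1 i 1 * z.2 i 1) * (A.1 0 0 * A.1 1 1 - A.1 0 1 * A.1 1 0) * he

theorem star_units_mul {c : ℂˣ} (hc : ‖(c : ℂ)‖ = 1) : star (c : ℂ) = ((c⁻¹ : ℂˣ) : ℂ) := by
  rw [Units.val_inv_eq_inv_val, Complex.inv_eq_conj hc]; rfl

theorem vecMulVec_snd_act (h : IsCompactElt A e) (z : Cot n) (i : Fin n) :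
    vecMulVec ((act A e z).2 i) (star ((act A e z).2 i))
      = ((A⁻¹ : Matrix.SpecialLinearGroup (Fin 2) ℂ) : Matrix (Fin 2) (Fin 2) ℂ)
        * vecMulVec (z.2 i) (star (z.2 i)) * A.1 := by
  simp only [act]
  rw [star_smul, star_units_mul (h.2 i), Matrix.star_mulVec, inv_coe_of_unitary h.1,
    Matrix.conjTranspose_conjTranspose, Matrix.vecMulVec_smul, Matrix.smul_vecMulVec, smul_smul,
    ← Matrix.mul_vecMulVec, ← Matrix.vecMulVec_mul]
  simp [Matrix.mul_assoc]

theorem vecMulVec_fst_act (h : IsCompactElt A e) (z : Cot n) (i : Fin n) :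
    vecMulVec (star ((act A e z).1 i)) ((act A e z).1 i)
      = ((A⁻¹ : Matrix.SpecialLinearGroup (Fin 2) ℂ) : Matrix (Fin 2) (Fin 2) ℂ)
        * vecMulVec (star (z.1 i)) (z.1 i) * A.1 := by
  simp only [act]
  rw [star_smul, ← star_units_mul (h.2 i), star_star, Matrix.star_vecMul,
    inv_coe_of_unitary h.1, star_units_mul (h.2 i), Matrix.vecMulVec_smul, Matrix.smul_vecMulVec,
    smul_smul, ← Matrix.mul_vecMulVec, ← Matrix.vecMulVec_mul]
  simp [Matrix.mul_assoc]

theorem ofReal_sqNorm (x : Fin 2 → ℂ) : (sqNorm x : ℂ) = star x ⬝ᵥ x := by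
  simp [sqNorm, dotProduct, Complex.conj_mul']

theorem sqNorm_eq (x : Fin 2 → ℂ) : sqNorm x = ‖x 0‖ ^ 2 + ‖x 1‖ ^ 2 := by
  simp [sqNorm]

theorem sqNorm_smul (c : ℂ) (x : Fin 2 → ℂ) : sqNorm (c • x) = ‖c‖ ^ 2 * sqNorm x := by
  simp [sqNorm_eq]; ring

theorem sqNorm_nonneg (x : Fin 2 → ℂ) : 0 ≤ sqNorm x := by
  rw [sqNorm_eq]; positivity

theorem sqNorm_snd_act (h : IsCompactElt A e) (z : Cot n) (i : Fin n) :
    sqNorm ((act A e z).2 i) = sqNorm (z.2 i) := by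
  simp only [act]
  rw [sqNorm_smul, h.2 i, one_pow, one_mul]
  apply Complex.ofReal_injective
  rw [ofReal_sqNorm, ofReal_sqNorm, Matrix.star_mulVec, ← Matrix.dotProduct_mulVec,
    Matrix.mulVec_mulVec, inv_coe_of_unitary h.1, Matrix.conjTranspose_conjTranspose,
    show A.1 * A.1ᴴ = 1 from (Matrix.mem_unitaryGroup_iff).1 h.1, Matrix.one_mulVec]

theorem sqNorm_fst_act (h : IsCompactElt A e) (z : Cot n) (i : Fin n) :
    sqNorm ((act A e z).1 i) = sqNorm (z.1 i) := by
  simp only [act]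
  rw [sqNorm_smul, Units.val_inv_eq_inv_val, norm_inv, h.2 i, inv_one, one_pow, one_mul]
  apply Complex.ofReal_injective
  rw [ofReal_sqNorm, ofReal_sqNorm, dotProduct_comm, Matrix.star_vecMul,
    ← Matrix.dotProduct_mulVec, Matrix.mulVec_mulVec,
    show A.1 * A.1ᴴ = 1 from (Matrix.mem_unitaryGroup_iff).1 h.1, Matrix.one_mulVec,
    dotProduct_comm]

end act

/-! ### The equations of the level set. -/

section level

variable {n : ℕ}

/-- Membership in the level set `μ_ℝ⁻¹(0 ⊕ α) ∩ μ_ℂ⁻¹(0)`. -/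
def IsLevel (α : Fin n → ℝ) (z : Cot n) : Prop := muR z = (0, α) ∧ muC z = 0

/-- The summand of the real moment map, as a vector in `ℝ³`. -/
noncomputable def momentVec (z : Cot n) (i : Fin n) : E3 :=
  hermVec (vecMulVec (z.2 i) (star (z.2 i)) - vecMulVec (star (z.1 i)) (z.1 i))

theorem traceless_sum {ι : Type*} (s : Finset ι) (M : ι → Matrix (Fin 2) (Fin 2) ℂ) :
    ∑ i ∈ s, traceless (M i) = traceless (∑ i ∈ s, M i) := by
  simp only [traceless, Finset.sum_sub_distrib, ← Finset.sum_smul, Matrix.trace_sum,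
    Finset.sum_div]

/-- The three coordinates of `hermVec` are exactly the real parameters of a traceless Hermitian
matrix. -/
theorem traceless_eq_zero_iff {M : Matrix (Fin 2) (Fin 2) ℂ} (hM : M.IsHermitian) :
    traceless M = 0 ↔ hermVec M = 0 := by
  have h10 : M 1 0 = star (M 0 1) := (hM.apply 1 0).symm
  have h00 : (M 0 0).im = 0 := by
    have := congrArg Complex.im (hM.apply 0 0); simp at this; linarith
  have h11 : (M 1 1).im = 0 := by
    have := congrArg Complex.im (hM.apply 1 1); simp at this; linarith
  constructor
  · intro h
    have h1 := congrFun (congrFun h 0) 1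
    have h2 := congrFun (congrFun h 0) 0
    simp [traceless, Matrix.trace_fin_two] at h1 h2
    have h3 := congrArg Complex.re h2
    simp at h3
    apply E3.ext
    · simp [h10, h1]
    · simp [h10, h1]
    · simp; linarith
  · intro h
    have h1 := congrArg (fun x : E3 => x 0) h
    have h2 := congrArg (fun x : E3 => x 1) h
    have h3 := congrArg (fun x : E3 => x 2) h
    simp [h10] at h1 h2 h3
    ext i j
    fin_cases i <;> fin_cases j <;> apply Complex.ext <;>
      simp [traceless, Matrix.trace_fin_two, h10] <;> linarith

theorem isHermitian_vecMulVec_star (x : Fin 2 → ℂ) : (vecMulVec x (star x)).IsHermitian := by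
  ext i j; simp [Matrix.vecMulVec_apply, mul_comm]

/-- The equations `p_i q_i = 0` say that every `q_i p_i` has trace zero, so the traceless part in
the complex moment map may be dropped. The matrix in the real moment map is Hermitian, so its
equation says that a polygon in `ℝ³` closes. -/
theorem isLevel_iff {α : Fin n → ℝ} {z : Cot n} : IsLevel α z ↔
    (∀ i, sqNorm (z.2 i) - sqNorm (z.1 i) = 2 * α i) ∧ ∑ i, momentVec z i = 0 ∧
      (∀ i, z.1 i ⬝ᵥ z.2 i = 0) ∧ ∑ i, vecMulVec (z.2 i) (z.1 i) = 0 := by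
  have hH : (∑ i, (vecMulVec (z.2 i) (star (z.2 i)) - vecMulVec (star (z.1 i)) (z.1 i))).IsHermitian := by
    rw [Matrix.IsHermitian, Matrix.conjTranspose_sum]
    refine Finset.sum_congr rfl fun i _ => ?_
    have h1 := isHermitian_vecMulVec_star (z.2 i)
    have h2 := isHermitian_vecMulVec_star (star (z.1 i))
    rw [star_star] at h2
    exact h1.sub h2
  have e1 : muR z = (0, α) ↔ ∑ i, momentVec z i = 0 ∧
      (∀ i, sqNorm (z.2 i) - sqNorm (z.1 i) = 2 * α i) := by
    simp only [muR, Prod.mk.injEq, traceless_sum, momentVec, ← map_sum]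
    rw [smul_eq_zero_iff_right (by simp), traceless_eq_zero_iff hH, funext_iff]
    refine and_congr Iff.rfl (forall_congr' fun i => ?_)
    constructor <;> intro h <;> linarith
  have e2 : muC z = 0 ↔ (∀ i, z.1 i ⬝ᵥ z.2 i = 0) ∧ ∑ i, vecMulVec (z.2 i) (z.1 i) = 0 := by
    have e3 : muC z = 0 ↔ ∑ i, traceless (vecMulVec (z.2 i) (z.1 i)) = 0 ∧
        (∀ i, z.1 i ⬝ᵥ z.2 i = 0) := by
      rw [muC, ← Prod.mk_zero_zero, Prod.mk.injEq, neg_eq_zero, funext_iff]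
      simp
    rw [e3, and_comm]
    refine and_congr_right fun h => ?_
    have : ∀ i, traceless (vecMulVec (z.2 i) (z.1 i)) = vecMulVec (z.2 i) (z.1 i) := fun i => by
      rw [traceless, Matrix.trace_vecMulVec, dotProduct_comm, h i]; simp
    simp only [this]
  rw [IsLevel, e1, e2]
  tauto

theorem momentVec_act {A : Matrix.SpecialLinearGroup (Fin 2) ℂ} {e : Fin n → ℂˣ}
    (h : IsCompactElt A e) (z : Cot n) (i : Fin n) : momentVec (act A e z) i
      = hermVec (((A⁻¹ : Matrix.SpecialLinearGroup (Fin 2) ℂ) : Matrix (Fin 2) (Fin 2) ℂ)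
        * (vecMulVec (z.2 i) (star (z.2 i)) - vecMulVec (star (z.1 i)) (z.1 i)) * A.1) := by
  rw [momentVec, vecMulVec_snd_act h, vecMulVec_fst_act h, mul_sub, sub_mul]

theorem IsLevel.act {α : Fin n → ℝ} {z : Cot n} (hz : IsLevel α z)
    {A : Matrix.SpecialLinearGroup (Fin 2) ℂ} {e : Fin n → ℂˣ}
    (h : IsCompactElt A e) : IsLevel α (act A e z) := by
  rw [isLevel_iff] at hz ⊢
  obtain ⟨h1, h2, h3, h4⟩ := hz
  obtain ⟨R, -, hR⟩ := exists_rotation_of_unitary h.1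
  refine ⟨fun i => ?_, ?_, fun i => ?_, ?_⟩
  · rw [sqNorm_snd_act h, sqNorm_fst_act h, h1]
  · simp only [momentVec_act h, ← hR, ← map_sum]
    simp only [momentVec, ← map_sum] at h2
    rw [h2, map_zero]
  · rw [dotProduct_act, h3]
  · simp only [vecMulVec_act, ← Finset.mul_sum, ← Finset.sum_mul, h4]
    simp

end level

end Hyperpolygon

/-! ### The Hopf map and rotations -/

namespace Hyperpolygon

open scoped Matrix
open Matrix (vecMulVec)
open Complex (normSq)

theorem IsRotation.one : IsRotation (LinearIsometryEquiv.refl ℝ E3) := LinearMap.det_id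

theorem hermVec_vecMulVec (q p : Fin 2 → ℂ) : hermVec (vecMulVec q p)
    = !₂[((q 0 * p 1).re + (q 1 * p 0).re) / 2, ((q 0 * p 1).im - (q 1 * p 0).im) / 2,
      ((q 0 * p 0).re - (q 1 * p 1).re) / 2] := rfl

/-- The Hopf map `ℂ² → ℝ³`. -/
noncomputable def hopf (q : Fin 2 → ℂ) : E3 := hermVec (vecMulVec q (star q))

theorem hopf_zero' (q : Fin 2 → ℂ) : hopf q 0 = (q 0 * star (q 1)).re := by
  simp [hopf, hermVec_vecMulVec]; ring

theorem hopf_one' (q : Fin 2 → ℂ) : hopf q 1 = (q 0 * star (q 1)).im := by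
  simp [hopf, hermVec_vecMulVec]; ring

theorem hopf_two' (q : Fin 2 → ℂ) : hopf q 2 = (‖q 0‖ ^ 2 - ‖q 1‖ ^ 2) / 2 := by
  simp [hopf, hermVec_vecMulVec, Complex.sq_norm, Complex.normSq_apply]

theorem norm_hopf (q : Fin 2 → ℂ) : ‖hopf q‖ = sqNorm q / 2 := by
  have h : ‖hopf q‖ ^ 2 = (sqNorm q / 2) ^ 2 := by
    rw [E3.norm_sq, hopf_zero', hopf_one', hopf_two', sqNorm_eq]
    simp [Complex.sq_norm, Complex.normSq_apply]
    ring
  have h1 := sqNorm_nonneg q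
  exact (pow_left_inj₀ (norm_nonneg _) (by positivity) two_ne_zero).1 h

/-- The section with real first coordinate `√(‖v‖ + v₂)` degenerates only on the downward vertical
axis, which gets its own witness. -/
theorem exists_hopf_eq (v : E3) : ∃ q : Fin 2 → ℂ, hopf q = v := by
  have hv := E3.norm_sq v
  have hn := norm_nonneg v
  have h2 : v 2 ^ 2 ≤ ‖v‖ ^ 2 := by nlinarith [sq_nonneg (v 0), sq_nonneg (v 1)]
  have h3 : 0 ≤ ‖v‖ + v 2 := by have := abs_le.1 (abs_le_of_sq_le_sq h2 hn); linarith
  rcases h3.eq_or_lt with h | h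
  · have h4 : v 2 = -‖v‖ := by linarith
    have h5 : v 0 ^ 2 + v 1 ^ 2 = 0 := by rw [h4] at hv; linarith
    have h6 : v 0 = 0 := by nlinarith [sq_nonneg (v 0), sq_nonneg (v 1)]
    have h7 : v 1 = 0 := by nlinarith [sq_nonneg (v 0), sq_nonneg (v 1)]
    refine ⟨![0, (Real.sqrt (2 * ‖v‖) : ℝ)], E3.ext ?_ ?_ ?_⟩
    · simp [hopf_zero', h6]
    · simp [hopf_one', h7]
    · rw [hopf_two']
      simp only [Matrix.cons_val, norm_zero, Complex.norm_real, Real.norm_eq_abs, sq_abs, h4]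
      rw [Real.sq_sqrt (by positivity)]
      ring
  · set r := Real.sqrt (‖v‖ + v 2) with hr
    have hr0 : 0 < r := Real.sqrt_pos.2 h
    have hr2 : r ^ 2 = ‖v‖ + v 2 := Real.sq_sqrt h3
    refine ⟨![(r : ℂ), star ((⟨v 0, v 1⟩ : ℂ) / r)], E3.ext ?_ ?_ ?_⟩
    · rw [hopf_zero']
      simp only [Matrix.cons_val, star_star]
      rw [mul_div_cancel₀ _ (by exact_mod_cast hr0.ne')]
    · rw [hopf_one']
      simp only [Matrix.cons_val, star_star]
      rw [mul_div_cancel₀ _ (by exact_mod_cast hr0.ne')]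
    · rw [hopf_two']
      simp only [Matrix.cons_val, norm_star, norm_div, div_pow, Complex.norm_real,
        Real.norm_of_nonneg hr0.le, Complex.sq_norm, Complex.normSq_apply]
      rw [hr2]
      field_simp
      linear_combination hv

/-- Vectors in `ℂ²` with the same image under the Hopf map differ by a phase. -/
theorem exists_phase_of_hopf_eq {q q' : Fin 2 → ℂ} (h : hopf q = hopf q') :
    ∃ e : ℂˣ, ‖(e : ℂ)‖ = 1 ∧ q' = (e : ℂ) • q := by
  have hs : sqNorm q = sqNorm q' := by
    have := congrArg norm h; rw [norm_hopf, norm_hopf] at this; linarith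
  have h2 : (‖q 0‖ ^ 2 - ‖q 1‖ ^ 2) / 2 = (‖q' 0‖ ^ 2 - ‖q' 1‖ ^ 2) / 2 := by
    rw [← hopf_two', ← hopf_two', h]
  rw [sqNorm_eq, sqNorm_eq] at hs
  have n0 : ‖q 0‖ = ‖q' 0‖ :=
    (pow_left_inj₀ (norm_nonneg _) (norm_nonneg _) two_ne_zero).1 (by linarith)
  have n1 : ‖q 1‖ = ‖q' 1‖ :=
    (pow_left_inj₀ (norm_nonneg _) (norm_nonneg _) two_ne_zero).1 (by linarith)
  -- The moduli of the two coordinates together with `q₀ q̄₁` determine `q` up to a phase; the phase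
  -- is read off at a nonzero coordinate.
  have hm : q 0 * star (q 1) = q' 0 * star (q' 1) := by
    apply Complex.ext
    · rw [← hopf_zero', ← hopf_zero', h]
    · rw [← hopf_one', ← hopf_one', h]
  by_cases h0 : q 0 = 0
  · have h0' : q' 0 = 0 := by rw [h0, norm_zero] at n0; exact norm_eq_zero.1 n0.symm
    by_cases h1 : q 1 = 0
    · have h1' : q' 1 = 0 := by rw [h1, norm_zero] at n1; exact norm_eq_zero.1 n1.symm
      refine ⟨1, by simp, ?_⟩
      ext k; fin_cases k <;> simp [h0, h1, h0', h1']
    · have h1' : q' 1 ≠ 0 := fun h => h1 (norm_eq_zero.1 (by rw [n1, h, norm_zero]))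
      refine ⟨Units.mk0 (q' 1 / q 1) (div_ne_zero h1' h1), ?_, ?_⟩
      · simp [n1, h1']
      · ext k; fin_cases k <;> simp [h0, h1, h0']
  · have h0' : q' 0 ≠ 0 := fun h => h0 (norm_eq_zero.1 (by rw [n0, h, norm_zero]))
    refine ⟨Units.mk0 (q' 0 / q 0) (div_ne_zero h0' h0), ?_, ?_⟩
    · simp [n0, h0']
    · have hc : q' 0 * star (q' 0) = q 0 * star (q 0) := by
        simp only [Complex.star_def, Complex.mul_conj', n0]
      have hs0 : star (q' 0) ≠ 0 := by simpa using h0'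
      have hm' := congrArg star hm
      simp only [star_mul, star_star] at hm'
      have key : q' 1 = q' 0 / q 0 * q 1 := by
        field_simp
        apply mul_right_cancel₀ hs0
        linear_combination (-q 0) * hm' - q 1 * hc
      ext k; fin_cases k
      · simp [h0]
      · simpa using key

/-- The expression that vanishes is the second coordinate of `A⁻¹ q`; the witness has first column
`q / |q|`. -/
theorem exists_unitary_snd_eq_zero (q : Fin 2 → ℂ) (hq : q ≠ 0) :
    ∃ A : Matrix.SpecialLinearGroup (Fin 2) ℂ,
      (A : Matrix (Fin 2) (Fin 2) ℂ) ∈ Matrix.unitaryGroup (Fin 2) ℂ ∧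
        A.1 0 0 * q 1 - A.1 1 0 * q 0 = 0 := by
  set N : ℝ := Real.sqrt (sqNorm q) with hN
  have hpos : 0 < sqNorm q := by
    rcases (sqNorm_nonneg q).eq_or_lt with h | h
    · exfalso; apply hq
      rw [sqNorm_eq] at h
      have h0 : ‖q 0‖ ^ 2 = 0 := by nlinarith [sq_nonneg ‖q 0‖, sq_nonneg ‖q 1‖]
      have h1 : ‖q 1‖ ^ 2 = 0 := by nlinarith [sq_nonneg ‖q 0‖, sq_nonneg ‖q 1‖]
      simp at h0 h1
      ext k; fin_cases k <;> simp [h0, h1]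
    · exact h
  have hN2 : (N : ℂ) ^ 2 = star (q 0) * q 0 + star (q 1) * q 1 := by
    have : N ^ 2 = sqNorm q := Real.sq_sqrt hpos.le
    rw [← Complex.ofReal_pow, this, ofReal_sqNorm]
    simp [dotProduct, Fin.sum_univ_two]
  have hN0 : (N : ℂ) ≠ 0 := by exact_mod_cast (Real.sqrt_pos.2 hpos).ne'
  refine ⟨⟨!![q 0 / N, -star (q 1) / N; q 1 / N, star (q 0) / N], ?_⟩, ?_, ?_⟩
  · rw [Matrix.det_fin_two]
    simp only [Matrix.of_apply, Matrix.cons_val]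
    field_simp
    linear_combination -hN2
  · rw [Matrix.mem_unitaryGroup_iff]
    simp only [Complex.star_def] at hN2
    ext i j
    fin_cases i <;> fin_cases j <;>
      simp only [Matrix.mul_apply, Fin.sum_univ_two, Matrix.star_apply] <;> simp <;>
      field_simp <;> first | ring1 | linear_combination -hN2
  · simp only [Matrix.of_apply, Matrix.cons_val]
    ring

theorem isCompactElt_const {n : ℕ} {A : Matrix.SpecialLinearGroup (Fin 2) ℂ}
    (hA : (A : Matrix (Fin 2) (Fin 2) ℂ) ∈ Matrix.unitaryGroup (Fin 2) ℂ) :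
    IsCompactElt A (1 : Fin n → ℂˣ) := ⟨hA, by simp⟩

/-- Every vector can be rotated to the upward vertical axis. -/
theorem exists_rotation_vertical (w : E3) : ∃ R : E3 ≃ₗᵢ[ℝ] E3, IsRotation R ∧
    R w 0 = 0 ∧ R w 1 = 0 ∧ R w 2 = ‖w‖ := by
  by_cases hw : w = 0
  · exact ⟨LinearIsometryEquiv.refl ℝ E3, IsRotation.one, by simp [hw]⟩
  obtain ⟨q, hq⟩ := exists_hopf_eq w
  have hq0 : q ≠ 0 := by
    rintro rfl
    have h := norm_hopf 0
    rw [hq] at h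
    simp [sqNorm] at h
    exact hw h
  obtain ⟨A, hA, hA0⟩ := exists_unitary_snd_eq_zero q hq0
  obtain ⟨R, hR, hR'⟩ := exists_rotation_of_unitary hA
  let z : Cot 1 := (0, fun _ => q)
  have hz1 : (act A 1 z).2 0 1 = 0 := by rw [act_snd_one]; simp [z, hA0]
  have h : R w = hopf ((act A 1 z).2 0) := by
    rw [← hq, hopf, hopf, hR', vecMulVec_snd_act (isCompactElt_const hA)]
  refine ⟨R, hR, ?_, ?_, ?_⟩
  · rw [h, hopf_zero', hz1]; simp
  · rw [h, hopf_one', hz1]; simp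
  · rw [← R.norm_map w, h, hopf_two', norm_hopf, sqNorm_eq, hz1]; simp

/-- A rotation that fixes the vertical axis comes from a diagonal element of `SU(2)`. -/
theorem exists_eq_rotMatrix_of_fix {R : E3 ≃ₗᵢ[ℝ] E3} (hR : IsRotation R)
    (hfix : R (EuclideanSpace.single 2 1) = EuclideanSpace.single 2 1) :
    ∃ s : ℂ, normSq s = 1 ∧ ∀ x : E3, (R x).ofLp = rotMatrix s 0 *ᵥ x.ofLp := by
  let e : Fin 3 → E3 := fun k => EuclideanSpace.single k 1
  have hin : ∀ i j, inner ℝ (R (e i)) (R (e j)) = if i = j then (1 : ℝ) else 0 := by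
    intro i j
    rw [R.inner_map_map, EuclideanSpace.inner_single_left]
    by_cases h : i = j <;> simp [e, h]
  have hfix' : R (e 2) = e 2 := hfix
  have hin' : ∀ i j, R (e i) 0 * R (e j) 0 + R (e i) 1 * R (e j) 1 + R (e i) 2 * R (e j) 2
      = if i = j then (1 : ℝ) else 0 := by
    intro i j
    rw [← hin, PiLp.inner_apply, Fin.sum_univ_three]
    simp [mul_comm]
  have e20 : R (e 2) 0 = 0 := by rw [hfix']; simp [e]
  have e21 : R (e 2) 1 = 0 := by rw [hfix']; simp [e]
  have e22 : R (e 2) 2 = 1 := by rw [hfix']; simp [e]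
  have e02 : R (e 0) 2 = 0 := by have := hin' 0 2; simp [e20, e21, e22] at this; exact this
  have e12 : R (e 1) 2 = 0 := by have := hin' 1 2; simp [e20, e21, e22] at this; exact this
  have h00 := hin' 0 0
  have h01 := hin' 0 1
  have h11 := hin' 1 1
  simp [e02, e12] at h00 h01 h11
  have hsum : ∀ x : E3, x = x 0 • e 0 + x 1 • e 1 + x 2 • e 2 := fun x => by
    apply E3.ext <;> simp [e]
  have hdet : R (e 0) 0 * R (e 1) 1 - R (e 0) 1 * R (e 1) 0 = 1 := by
    have h : LinearMap.det (R.toLinearEquiv : E3 →ₗ[ℝ] E3) = 1 := hR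
    rw [← LinearMap.det_toMatrix (EuclideanSpace.basisFun (Fin 3) ℝ).toBasis,
      Matrix.det_fin_three] at h
    simp [LinearMap.toMatrix_apply] at h
    change R (e 0) 0 * R (e 1) 1 * R (e 2) 2 - R (e 0) 0 * R (e 2) 1 * R (e 1) 2
      - R (e 1) 0 * R (e 0) 1 * R (e 2) 2 + R (e 1) 0 * R (e 2) 1 * R (e 0) 2
      + R (e 2) 0 * R (e 0) 1 * R (e 1) 2 - R (e 2) 0 * R (e 1) 1 * R (e 0) 2 = 1 at h
    rw [e20, e21, e22, e02, e12] at h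
    linarith
  -- Orthonormality and determinant one make the image of `e 1` the image of `e 0` turned by a right
  -- angle.
  have h3 : R (e 1) 0 = -R (e 0) 1 := by
    linear_combination (-R (e 0) 1) * hdet + R (e 0) 0 * h01 - R (e 1) 0 * h00
  have h4 : R (e 1) 1 = R (e 0) 0 := by
    linear_combination (R (e 0) 0) * hdet + R (e 0) 1 * h01 - R (e 1) 1 * h00
  -- The half angle: the first column of `rotMatrix s 0` is `(Re s², -Im s², 0)`.
  obtain ⟨s, hs⟩ := IsAlgClosed.exists_pow_nat_eq (⟨R (e 0) 0, -R (e 0) 1⟩ : ℂ) two_pos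
  have hre := congrArg Complex.re hs
  have him := congrArg Complex.im hs
  simp [pow_two] at hre him
  refine ⟨s, ?_, fun x => ?_⟩
  · have : normSq s ^ 2 = 1 := by
      rw [← map_pow, hs, Complex.normSq_apply]; linarith
    exact (pow_eq_one_iff_of_nonneg (Complex.normSq_nonneg _) two_ne_zero).1 this
  · have hx := congrArg (fun y => (R y).ofLp) (hsum x)
    have hN : s.re * s.re + s.im * s.im = 1 := by
      have : normSq s ^ 2 = 1 := by
        rw [← map_pow, hs, Complex.normSq_apply]; linarith
      rw [← Complex.normSq_apply]
      exact (pow_eq_one_iff_of_nonneg (Complex.normSq_nonneg _) two_ne_zero).1 this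
    rw [hx]
    ext k
    fin_cases k <;>
      simp [rotMatrix, Matrix.mulVec, dotProduct, Fin.sum_univ_three, e20, e21, e22, e02, e12, h3,
        h4]
    · linear_combination (-x 0) * hre - x 1 * him
    · linear_combination (-x 1) * hre + x 0 * him
    · linear_combination (-x 2) * hN

end Hyperpolygon

/-! ### The polygons of a point of the level set -/

namespace Hyperpolygon

open scoped Matrix
open Matrix (vecMulVec)
open Complex (normSq)

variable {n : ℕ} {α : Fin n → ℝ} {S : Finset (Fin n)}

/-- A point of the level set for which `S` is straight and `p j = 0` for all `j ∉ S`. -/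
structure IsCore (α : Fin n → ℝ) (S : Finset (Fin n)) (z : Cot n) : Prop where
  level : IsLevel α z
  straight : IsStraight S z
  fst_eq_zero : ∀ j ∈ Sᶜ, z.1 j = 0

/-- `q i` is horizontal and `p i` is vertical for all `i ∈ S`. -/
def IsNormal (S : Finset (Fin n)) (z : Cot n) : Prop := ∀ i ∈ S, z.2 i 1 = 0 ∧ z.1 i 0 = 0

/-- The spatial and the planar polygon of a point of `T*ℂ²ⁿ`. -/
noncomputable def poly (S : Finset (Fin n)) (z : Cot n) : VectorData S :=
  ⟨fun i => (2 : ℝ) • hermVec (vecMulVec (z.2 i) (z.1 i)), fun j => hopf (z.2 j),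
    ∑ i : S, momentVec z i⟩

theorem VectorData.ext' {d d' : VectorData S} (hu : ∀ i, d.u i = d'.u i)
    (hv : ∀ i, d.v i = d'.v i) (hw : d.w = d'.w) : d = d' := by
  cases d; cases d'
  simp only [VectorData.mk.injEq]
  exact ⟨funext hu, funext hv, hw⟩

theorem poly_act {A : Matrix.SpecialLinearGroup (Fin 2) ℂ} {e : Fin n → ℂˣ}
    (h : IsCompactElt A e) {R : E3 ≃ₗᵢ[ℝ] E3} (hR : ∀ M, R (hermVec M)
      = hermVec (((A⁻¹ : Matrix.SpecialLinearGroup (Fin 2) ℂ) : Matrix (Fin 2) (Fin 2) ℂ)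
          * M * A.1)) (z : Cot n) : poly S (act A e z) = (poly S z).rotate R := by
  refine VectorData.ext' (fun i => ?_) (fun j => ?_) ?_
  · simp only [poly, VectorData.rotate, map_smul, hR, vecMulVec_act]
  · simp only [poly, VectorData.rotate, hopf, hR, vecMulVec_snd_act h]
  · simp only [poly, VectorData.rotate, map_sum, momentVec_act h, ← hR]
    rfl

theorem IsLevel.sqNorm_snd_pos (hpos : ∀ i, 0 < α i) {z : Cot n} (hz : IsLevel α z) (i : Fin n) :
    0 < sqNorm (z.2 i) := by
  have h := (isLevel_iff.1 hz).1 i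
  have := sqNorm_nonneg (z.1 i)
  have := hpos i
  linarith

theorem IsLevel.snd_ne_zero (hpos : ∀ i, 0 < α i) {z : Cot n} (hz : IsLevel α z) (i : Fin n) :
    z.2 i ≠ 0 := fun h => by
  have := hz.sqNorm_snd_pos hpos i
  rw [h] at this
  simp [sqNorm] at this

theorem IsCore.act {z : Cot n} (hz : IsCore α S z) {A : Matrix.SpecialLinearGroup (Fin 2) ℂ}
    {e : Fin n → ℂˣ} (h : IsCompactElt A e) : IsCore α S (act A e z) where
  level := hz.level.act h
  straight i hi j hj := by
    obtain ⟨c, hc⟩ := hz.straight i hi j hj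
    refine ⟨(e i) * c * ((e j)⁻¹ : ℂˣ), ?_⟩
    simp only [Hyperpolygon.act, hc, Matrix.mulVec_smul, smul_smul]
    congr 1
    simp [mul_assoc]
  fst_eq_zero j hj := by
    simp [Hyperpolygon.act, hz.fst_eq_zero j hj]

/-- The `q_i` with `i ∈ S` share a line, so one element of `SU(2)` makes them all horizontal; then
`p_i q_i = 0` with `q_i ≠ 0` forces `p_i` to be vertical. -/
theorem IsCore.exists_isNormal (hpos : ∀ i, 0 < α i) (hS : S.Nonempty) {z : Cot n}
    (hz : IsCore α S z) : ∃ (A : Matrix.SpecialLinearGroup (Fin 2) ℂ) (e : Fin n → ℂˣ),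
      IsCompactElt A e ∧ IsNormal S (Hyperpolygon.act A e z) := by
  obtain ⟨i₀, hi₀⟩ := hS
  obtain ⟨A, hA, hA0⟩ := exists_unitary_snd_eq_zero _ (hz.level.snd_ne_zero hpos i₀)
  refine ⟨A, 1, isCompactElt_const hA, fun i hi => ?_⟩
  have h1 : (Hyperpolygon.act A 1 z).2 i 1 = 0 := by
    obtain ⟨c, hc⟩ := hz.straight i hi i₀ hi₀
    rw [act_snd_one, hc]
    simp
    linear_combination c * hA0
  have hc := hz.act (isCompactElt_const hA)
  refine ⟨h1, ?_⟩
  have h2 := (isLevel_iff.1 hc.level).2.2.1 i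
  have h3 := hc.level.sqNorm_snd_pos hpos i
  simp only [dotProduct, Fin.sum_univ_two, h1, mul_zero, add_zero] at h2
  rw [sqNorm_eq, h1] at h3
  exact (mul_eq_zero.1 h2).resolve_right fun h => by simp [h] at h3

/-! ### Polygons of a configuration in normal position. -/

section normal

variable {z : Cot n}

/-- The matrix `q_i p_i` has a single, off-diagonal entry, which taking the Hermitian part halves.
The factor two in `poly` compensates, so that `‖u_i‖ = |q_i| |p_i|`. -/
theorem IsNormal.poly_u (h : IsNormal S z) (i : S) :
    (poly S z).u i = !₂[(z.2 i 0 * z.1 i 1).re, (z.2 i 0 * z.1 i 1).im, 0] := by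
  obtain ⟨h1, h2⟩ := h i i.2
  simp only [poly, hermVec_vecMulVec, h1, h2]
  apply E3.ext <;> simp <;> ring

theorem IsNormal.momentVec (h : IsNormal S z) {i : Fin n} (hi : i ∈ S) :
    momentVec z i = !₂[0, 0, (sqNorm (z.2 i) + sqNorm (z.1 i)) / 2] := by
  obtain ⟨h1, h2⟩ := h i hi
  simp only [Hyperpolygon.momentVec, map_sub, hermVec_vecMulVec, h1, h2]
  apply E3.ext <;> simp [sqNorm_eq, h1, h2, Complex.sq_norm, Complex.normSq_apply]
  ring

theorem IsNormal.norm_poly_u (h : IsNormal S z) (i : S) :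
    ‖(poly S z).u i‖ ^ 2 = sqNorm (z.2 i) * sqNorm (z.1 i) := by
  obtain ⟨h1, h2⟩ := h i i.2
  rw [E3.norm_sq, h.poly_u]
  simp [sqNorm_eq, h1, h2, Complex.sq_norm, Complex.normSq_apply]
  ring

/-- Applied to `x = |q_i|²` and `y = |p_i|²`, this turns the contribution of `i` to `w` into the
square root in the length condition. -/
theorem sqrt_sq_add_mul {a x y : ℝ} (hx : 0 ≤ x) (hy : 0 ≤ y) (h : x - y = 2 * a) :
    Real.sqrt (a ^ 2 + x * y) = (x + y) / 2 := by
  rw [show a ^ 2 + x * y = ((x + y) / 2) ^ 2 by rw [show a = (x - y) / 2 by linarith]; ring,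
    Real.sqrt_sq (by linarith)]

theorem IsNormal.sqrt_eq (h : IsNormal S z) (hz : ∀ i, sqNorm (z.2 i) - sqNorm (z.1 i) = 2 * α i)
    (i : S) : Real.sqrt (α i ^ 2 + ‖(poly S z).u i‖ ^ 2)
      = (sqNorm (z.2 i) + sqNorm (z.1 i)) / 2 := by
  rw [h.norm_poly_u, sqrt_sq_add_mul (sqNorm_nonneg _) (sqNorm_nonneg _) (hz i)]

theorem IsNormal.poly_w (h : IsNormal S z) :
    (poly S z).w = !₂[0, 0, ∑ i : S, (sqNorm (z.2 i) + sqNorm (z.1 i)) / 2] := by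
  have : ∀ i : S, Hyperpolygon.momentVec z i
      = ((sqNorm (z.2 i) + sqNorm (z.1 i)) / 2) • EuclideanSpace.single 2 1 := fun i => by
    rw [h.momentVec i.2]
    apply E3.ext <;> simp
  simp only [poly, this, ← Finset.sum_smul]
  apply E3.ext <;> simp

theorem IsNormal.norm_poly_w (h : IsNormal S z) :
    ‖(poly S z).w‖ = ∑ i : S, (sqNorm (z.2 i) + sqNorm (z.1 i)) / 2 := by
  have h0 : 0 ≤ ∑ i : S, (sqNorm (z.2 i) + sqNorm (z.1 i)) / 2 :=
    Finset.sum_nonneg fun i _ => by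
      have := sqNorm_nonneg (z.2 i); have := sqNorm_nonneg (z.1 i); positivity
  have h1 := E3.norm_sq (poly S z).w
  rw [h.poly_w] at h1 ⊢
  simp at h1
  exact (pow_left_inj₀ (norm_nonneg _) h0 two_ne_zero).1 h1

theorem momentVec_of_fst_eq_zero {i : Fin n} (h : z.1 i = 0) :
    momentVec z i = hopf (z.2 i) := by
  simp [momentVec, h, hopf]

theorem sum_momentVec (h : ∀ j ∈ Sᶜ, z.1 j = 0) :
    ∑ i, momentVec z i = (poly S z).w + ∑ j, (poly S z).v j := by
  rw [← Finset.sum_add_sum_compl S, ← Finset.sum_coe_sort S, ← Finset.sum_coe_sort Sᶜ]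
  congr 1
  exact Finset.sum_congr rfl fun j _ => momentVec_of_fst_eq_zero (h j j.2)

theorem sum_vecMulVec (h : ∀ j ∈ Sᶜ, z.1 j = 0) :
    ∑ i, vecMulVec (z.2 i) (z.1 i) = ∑ i : S, vecMulVec (z.2 i) (z.1 i) := by
  rw [← Finset.sum_add_sum_compl S, ← Finset.sum_coe_sort S]
  simp only [add_eq_left]
  exact Finset.sum_eq_zero fun j hj => by rw [h j hj]; simp

theorem IsNormal.isPolygonPair (h : IsNormal S z) (hz : IsCore α S z) :
    IsPolygonPair α S (poly S z) := by
  obtain ⟨h1, h2, h3, h4⟩ := isLevel_iff.1 hz.level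
  refine ⟨?_, ?_, fun i => ?_, fun j => ?_, ?_⟩
  · rw [← sum_momentVec hz.fst_eq_zero, h2]
  · simp only [poly, ← Finset.smul_sum, ← map_sum]
    rw [← sum_vecMulVec hz.fst_eq_zero, h4, map_zero, smul_zero]
  · rw [h.poly_w, h.poly_u, PiLp.inner_apply, Fin.sum_univ_three]
    simp
  · have := h1 j
    rw [hz.fst_eq_zero j j.2] at this
    simp only [poly, norm_hopf]
    simp [sqNorm] at this ⊢
    linarith
  · simp only [h.sqrt_eq h1, h.norm_poly_w]

/-- A normal configuration whose polygons close up is a point of the level set. -/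
theorem IsNormal.isCore (h : IsNormal S z) (hpos : ∀ i, 0 < α i)
    (hα : ∀ i, sqNorm (z.2 i) - sqNorm (z.1 i) = 2 * α i) (hp : ∀ j ∈ Sᶜ, z.1 j = 0)
    (hw : (poly S z).w + ∑ j, (poly S z).v j = 0) (hu : ∑ i, (poly S z).u i = 0) :
    IsCore α S z where
  level := by
    refine isLevel_iff.2 ⟨hα, ?_, fun i => ?_, ?_⟩
    · rw [sum_momentVec hp, hw]
    · by_cases hi : i ∈ S
      · simp [dotProduct, Fin.sum_univ_two, h i hi]
      · simp [hp i (Finset.mem_compl.2 hi)]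
    · rw [sum_vecMulVec hp]
      have hs : ∑ i : S, z.2 i 0 * z.1 i 1 = 0 := by
        simp only [h.poly_u] at hu
        have h0 := congrArg (fun x : E3 => x 0) hu
        have h1 := congrArg (fun x : E3 => x 1) hu
        simp only [WithLp.ofLp_sum, Finset.sum_apply, Matrix.cons_val,
          PiLp.zero_apply] at h0 h1
        apply Complex.ext
        · rw [Complex.re_sum, h0]; rfl
        · rw [Complex.im_sum, h1]; rfl
      ext k l
      rw [Matrix.sum_apply]
      have hk : ∀ i : S, z.2 i 1 = 0 ∧ z.1 i 0 = 0 := fun i => h i i.2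
      fin_cases k <;> fin_cases l <;> simp [Matrix.vecMulVec_apply, hk]
      simpa using hs
  straight i hi j hj := by
    have h1 : z.2 j 0 ≠ 0 := fun h0 => by
      have h2 := hα j
      have h3 := sqNorm_nonneg (z.1 j)
      have h4 := hpos j
      rw [sqNorm_eq, h0, (h j hj).1] at h2
      simp at h2
      linarith
    refine ⟨z.2 i 0 / z.2 j 0, ?_⟩
    ext k; fin_cases k
    · simp [h1]
    · simp [(h i hi).1, (h j hj).1]
  fst_eq_zero := hp

end normal

theorem VectorData.rotate_rotate_symm (d : VectorData S) (R : E3 ≃ₗᵢ[ℝ] E3) :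
    (d.rotate R).rotate R.symm = d := by
  simp [VectorData.rotate]

theorem IsPolygonPair.rotate {d : VectorData S} (h : IsPolygonPair α S d) (R : E3 ≃ₗᵢ[ℝ] E3) :
    IsPolygonPair α S (d.rotate R) where
  closed_spatial := by
    have := congrArg R h.closed_spatial
    simpa [VectorData.rotate] using this
  closed_planar := by
    have := congrArg R h.closed_planar
    simpa [VectorData.rotate] using this
  perp i := by simpa [VectorData.rotate] using h.perp i
  length_v j := by simpa [VectorData.rotate] using h.length_v j
  length_w := by simpa [VectorData.rotate] using h.length_w

/-- The five conditions are invariant under rotation, so checking them in normal position suffices.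
-/
theorem IsCore.isPolygonPair (hpos : ∀ i, 0 < α i) (hS : S.Nonempty) {z : Cot n}
    (hz : IsCore α S z) : IsPolygonPair α S (poly S z) := by
  obtain ⟨A, e, h, hn⟩ := hz.exists_isNormal hpos hS
  obtain ⟨R, -, hR⟩ := exists_rotation_of_unitary h.1
  have h1 := (hn.isPolygonPair (hz.act h)).rotate R.symm
  rwa [poly_act h hR, VectorData.rotate_rotate_symm] at h1

theorem IsCore.norm_poly_w (hpos : ∀ i, 0 < α i) (hS : S.Nonempty) {z : Cot n}
    (hz : IsCore α S z) :
    ‖(poly S z).w‖ = ∑ i : S, (sqNorm (z.2 i) + sqNorm (z.1 i)) / 2 := by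
  obtain ⟨A, e, h, hn⟩ := hz.exists_isNormal hpos hS
  obtain ⟨R, -, hR⟩ := exists_rotation_of_unitary h.1
  have h1 := hn.norm_poly_w
  rw [poly_act h hR] at h1
  simpa [VectorData.rotate, sqNorm_snd_act h, sqNorm_fst_act h] using h1

end Hyperpolygon

/-! ### Normal forms -/

namespace Hyperpolygon

open scoped Matrix
open Matrix (vecMulVec)
open Complex (normSq)

variable {n : ℕ} {α : Fin n → ℝ} {S : Finset (Fin n)}

/-- The length of `q` when `|q|² - |p|² = 2a` and `|q||p| = g`. -/
noncomputable def sndRadius (a g : ℝ) : ℝ := Real.sqrt (a + Real.sqrt (a ^ 2 + g ^ 2))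

theorem sndRadius_pos {a : ℝ} (ha : 0 < a) (g : ℝ) : 0 < sndRadius a g :=
  Real.sqrt_pos.2 (by positivity)

theorem sndRadius_sq {a : ℝ} (ha : 0 < a) (g : ℝ) :
    sndRadius a g ^ 2 = a + Real.sqrt (a ^ 2 + g ^ 2) := Real.sq_sqrt (by positivity)

theorem div_sndRadius_sq {a : ℝ} (ha : 0 < a) (g : ℝ) :
    (g / sndRadius a g) ^ 2 = Real.sqrt (a ^ 2 + g ^ 2) - a := by
  have h := (pow_pos (sndRadius_pos ha g) 2).ne'
  rw [div_pow, div_eq_iff h, sndRadius_sq ha]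
  have := Real.sq_sqrt (by positivity : 0 ≤ a ^ 2 + g ^ 2)
  linear_combination -this

/-- The normal configuration with planar polygon `γ` and spatial polygon given by `q`. -/
noncomputable def normalForm (α : Fin n → ℝ) (S : Finset (Fin n)) (γ : Fin n → ℂ)
    (q : Fin n → Fin 2 → ℂ) : Cot n :=
  (fun i => if i ∈ S then ![0, γ i / sndRadius (α i) ‖γ i‖] else 0,
   fun i => if i ∈ S then ![(sndRadius (α i) ‖γ i‖ : ℂ), 0] else q i)

/-! ### Polygons of the explicit normal configurations. -/

section normalForm

variable {γ : Fin n → ℂ} {q : Fin n → Fin 2 → ℂ}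

theorem normalForm_fst_of_mem {i : Fin n} (hi : i ∈ S) :
    (normalForm α S γ q).1 i = ![0, γ i / sndRadius (α i) ‖γ i‖] := if_pos hi

theorem normalForm_snd_of_mem {i : Fin n} (hi : i ∈ S) :
    (normalForm α S γ q).2 i = ![(sndRadius (α i) ‖γ i‖ : ℂ), 0] := if_pos hi

theorem normalForm_fst_of_notMem {i : Fin n} (hi : i ∉ S) :
    (normalForm α S γ q).1 i = 0 := if_neg hi

theorem normalForm_snd_of_notMem {i : Fin n} (hi : i ∉ S) :
    (normalForm α S γ q).2 i = q i := if_neg hi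

theorem isNormal_normalForm : IsNormal S (normalForm α S γ q) := fun i hi => by
  simp [normalForm_fst_of_mem hi, normalForm_snd_of_mem hi]

theorem sqNorm_snd_normalForm (hpos : ∀ i, 0 < α i) {i : Fin n} (hi : i ∈ S) :
    sqNorm ((normalForm α S γ q).2 i) = α i + Real.sqrt (α i ^ 2 + ‖γ i‖ ^ 2) := by
  rw [normalForm_snd_of_mem hi, sqNorm_eq, ← sndRadius_sq (hpos i)]
  simp

theorem sqNorm_fst_normalForm (hpos : ∀ i, 0 < α i) {i : Fin n} (hi : i ∈ S) :
    sqNorm ((normalForm α S γ q).1 i) = Real.sqrt (α i ^ 2 + ‖γ i‖ ^ 2) - α i := by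
  rw [normalForm_fst_of_mem hi, sqNorm_eq, ← div_sndRadius_sq (hpos i)]
  simp [abs_of_pos (sndRadius_pos (hpos i) _)]

theorem mul_normalForm (hpos : ∀ i, 0 < α i) {i : Fin n} (hi : i ∈ S) :
    (normalForm α S γ q).2 i 0 * (normalForm α S γ q).1 i 1 = γ i := by
  rw [normalForm_fst_of_mem hi, normalForm_snd_of_mem hi]
  simp only [Matrix.cons_val]
  exact mul_div_cancel₀ _ (by exact_mod_cast (sndRadius_pos (hpos i) _).ne')

theorem poly_u_normalForm (hpos : ∀ i, 0 < α i) (i : S) :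
    (poly S (normalForm α S γ q)).u i = !₂[(γ i).re, (γ i).im, 0] := by
  rw [isNormal_normalForm.poly_u, mul_normalForm hpos i.2]

theorem poly_v_normalForm (j : (Sᶜ : Finset (Fin n))) :
    (poly S (normalForm α S γ q)).v j = hopf (q j) := by
  simp only [poly, normalForm_snd_of_notMem (Finset.mem_compl.1 j.2)]

theorem poly_w_normalForm (hpos : ∀ i, 0 < α i) :
    (poly S (normalForm α S γ q)).w = !₂[0, 0, ∑ i : S, Real.sqrt (α i ^ 2 + ‖γ i‖ ^ 2)] := by
  rw [isNormal_normalForm.poly_w]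
  congr 3
  refine congrArg (fun x => ![x]) (Finset.sum_congr rfl fun i _ => ?_)
  rw [sqNorm_snd_normalForm hpos i.2, sqNorm_fst_normalForm hpos i.2]
  ring

theorem isCore_normalForm (hpos : ∀ i, 0 < α i) (hγ : ∑ i : S, γ i = 0)
    (hq : ∀ j ∈ Sᶜ, sqNorm (q j) = 2 * α j)
    (hw : !₂[0, 0, ∑ i : S, Real.sqrt (α i ^ 2 + ‖γ i‖ ^ 2)]
      + ∑ j : (Sᶜ : Finset (Fin n)), hopf (q j) = 0) :
    IsCore α S (normalForm α S γ q) := by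
  refine isNormal_normalForm.isCore hpos (fun i => ?_)
    (fun j hj => normalForm_fst_of_notMem (Finset.mem_compl.1 hj)) ?_ ?_
  · by_cases hi : i ∈ S
    · rw [sqNorm_snd_normalForm hpos hi, sqNorm_fst_normalForm hpos hi]; ring
    · rw [normalForm_fst_of_notMem hi, normalForm_snd_of_notMem hi, hq i (Finset.mem_compl.2 hi)]
      simp [sqNorm]
  · rw [poly_w_normalForm hpos]
    simp only [poly_v_normalForm]
    exact hw
  · simp only [poly_u_normalForm hpos]
    have h0 := congrArg Complex.re hγ
    have h1 := congrArg Complex.im hγ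
    rw [Complex.re_sum] at h0
    rw [Complex.im_sum] at h1
    apply E3.ext <;> simp at h0 h1 ⊢ <;> assumption

end normalForm

theorem IsPolygonPair.norm_w_pos (hpos : ∀ i, 0 < α i) (hS : S.Nonempty) {d : VectorData S}
    (h : IsPolygonPair α S d) : 0 < ‖d.w‖ := by
  rw [h.length_w]
  have : Nonempty S := hS.to_subtype
  exact Finset.sum_pos (fun i _ => Real.sqrt_pos.2 (by have := hpos i; positivity))
    Finset.univ_nonempty

/-- Every polygon pair comes from a normal configuration, up to rotation. -/
theorem IsPolygonPair.exists_normalForm (hpos : ∀ i, 0 < α i) (hS : S.Nonempty)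
    {d : VectorData S} (h : IsPolygonPair α S d) :
    ∃ (R : E3 ≃ₗᵢ[ℝ] E3) (γ : Fin n → ℂ) (q : Fin n → Fin 2 → ℂ), IsRotation R ∧
      IsCore α S (normalForm α S γ q) ∧ poly S (normalForm α S γ q) = d.rotate R := by
  obtain ⟨R, hR, h0, h1, h2⟩ := exists_rotation_vertical d.w
  have hd := h.rotate R
  have hw0 := hd.norm_w_pos hpos hS
  set d' := d.rotate R with hd'
  have hw : d'.w = !₂[0, 0, ‖d'.w‖] := by
    apply E3.ext
    · exact h0
    · exact h1
    · exact h2.trans (R.norm_map _).symm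
  have hu2 : ∀ i, d'.u i 2 = 0 := fun i => by
    have := hd.perp i
    rw [hw, PiLp.inner_apply, Fin.sum_univ_three] at this
    simp at this
    exact this.resolve_left fun h => by simp [h] at hw0
  choose Q hQ using exists_hopf_eq
  let γ : Fin n → ℂ := fun i => if hi : i ∈ S then ⟨d'.u ⟨i, hi⟩ 0, d'.u ⟨i, hi⟩ 1⟩ else 0
  let q : Fin n → Fin 2 → ℂ := fun j =>
    if hj : j ∈ Sᶜ then Q (d'.v ⟨j, hj⟩) else 0
  have hγ : ∀ i : S, γ i = ⟨d'.u i 0, d'.u i 1⟩ := fun i => dif_pos i.2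
  have hq : ∀ j : (Sᶜ : Finset (Fin n)), q j = Q (d'.v j) := fun j => dif_pos j.2
  have hu : ∀ i : S, d'.u i = !₂[(γ i).re, (γ i).im, 0] := fun i => by
    rw [hγ]
    apply E3.ext
    · rfl
    · rfl
    · exact hu2 i
  have hn : ∀ i : S, ‖γ i‖ ^ 2 = ‖d'.u i‖ ^ 2 := fun i => by
    rw [E3.norm_sq, hu i, Complex.sq_norm, Complex.normSq_apply]; simp; ring
  have hw' : d'.w = !₂[0, 0, ∑ i : S, Real.sqrt (α i ^ 2 + ‖γ i‖ ^ 2)] := by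
    simp only [hn, ← hd.length_w]
    exact hw
  refine ⟨R, γ, q, hR, isCore_normalForm hpos ?_ (fun j hj => ?_) ?_,
    VectorData.ext' (fun i => ?_) (fun j => ?_) ?_⟩
  · have h := hd.closed_planar
    apply Complex.ext
    · have := congrArg (fun x : E3 => x 0) h
      simpa [hu] using this
    · have := congrArg (fun x : E3 => x 1) h
      simpa [hu] using this
  · have h1 := norm_hopf (q j)
    rw [hq ⟨j, hj⟩, hQ, hd.length_v] at h1
    rw [hq ⟨j, hj⟩]
    linarith
  · rw [← hw']
    simp only [hq, hQ]
    exact hd.closed_spatial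
  · rw [poly_u_normalForm hpos, hu]
  · rw [poly_v_normalForm, hq, hQ]
  · rw [poly_w_normalForm hpos, ← hw']

/-- Normal points of the level set with the same polygons differ by phases. -/
theorem exists_phase_of_poly_eq (hpos : ∀ i, 0 < α i) {z z' : Cot n} (hz : IsCore α S z)
    (hz' : IsCore α S z') (hn : IsNormal S z) (hn' : IsNormal S z') (h : poly S z = poly S z') :
    ∃ e : Fin n → ℂˣ, (∀ i, ‖(e i : ℂ)‖ = 1) ∧ z' = act 1 e z := by
  have hα := (isLevel_iff.1 hz.level).1
  have hα' := (isLevel_iff.1 hz'.level).1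
  have key : ∀ i, ∃ e : ℂˣ, ‖(e : ℂ)‖ = 1 ∧ z'.2 i = (e : ℂ) • z.2 i ∧
      z'.1 i = ((e⁻¹ : ℂˣ) : ℂ) • z.1 i := by
    intro i
    by_cases hi : i ∈ S
    · have hu : (poly S z).u ⟨i, hi⟩ = (poly S z').u ⟨i, hi⟩ := by rw [h]
      -- The length of `u_i` gives `|q_i|² + |p_i|²`, and the level equation gives the difference.
      have hs : sqNorm (z.2 i) = sqNorm (z'.2 i) := by
        have h1 := hn.sqrt_eq hα ⟨i, hi⟩
        have h2 := hn'.sqrt_eq hα' ⟨i, hi⟩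
        rw [hu, h2] at h1
        have := hα i
        have := hα' i
        simp only at h1
        linarith
      have hh : hopf (z.2 i) = hopf (z'.2 i) := by
        rw [sqNorm_eq, sqNorm_eq, (hn i hi).1, (hn' i hi).1] at hs
        simp only [norm_zero] at hs
        apply E3.ext
        · rw [hopf_zero', hopf_zero', (hn i hi).1, (hn' i hi).1]; simp
        · rw [hopf_one', hopf_one', (hn i hi).1, (hn' i hi).1]; simp
        · rw [hopf_two', hopf_two', (hn i hi).1, (hn' i hi).1]; simp only [norm_zero]; linarith
      obtain ⟨e, he, hq⟩ := exists_phase_of_hopf_eq hh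
      refine ⟨e, he, hq, ?_⟩
      -- The planar edge records the product `q_i p_i`, so `p_i` changes by the inverse of the phase
      -- of `q_i`.
      have hg : z.2 i 0 * z.1 i 1 = z'.2 i 0 * z'.1 i 1 := by
        rw [hn.poly_u, hn'.poly_u] at hu
        apply Complex.ext
        · exact congrArg (fun x : E3 => x 0) hu
        · exact congrArg (fun x : E3 => x 1) hu
      have h0 : z.2 i 0 ≠ 0 := fun h0 => by
        apply hz.level.snd_ne_zero hpos i
        ext k; fin_cases k
        · exact h0
        · exact (hn i hi).1
      rw [hq] at hg
      ext k; fin_cases k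
      · simp [(hn i hi).2, (hn' i hi).2]
      · simp only [Pi.smul_apply, smul_eq_mul] at hg ⊢
        have : z.1 i 1 = e * z'.1 i 1 := mul_left_cancel₀ h0 (by linear_combination hg)
        change z'.1 i 1 = ((e⁻¹ : ℂˣ) : ℂ) * z.1 i 1
        rw [this, ← mul_assoc]; simp
    · have hj := Finset.mem_compl.2 hi
      have hv : (poly S z).v ⟨i, hj⟩ = (poly S z').v ⟨i, hj⟩ := by rw [h]
      obtain ⟨e, he, hq⟩ := exists_phase_of_hopf_eq hv
      exact ⟨e, he, hq, by rw [hz.fst_eq_zero i hj, hz'.fst_eq_zero i hj, smul_zero]⟩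
  choose e he h2 h1 using key
  refine ⟨e, he, Prod.ext (funext fun i => ?_) (funext fun i => ?_)⟩
  · rw [h1]; simp [act]
  · rw [h2]; simp [act]

theorem X.mk_eq_of_act {z : Cot n} (hz : IsLevel α z) {A : Matrix.SpecialLinearGroup (Fin 2) ℂ}
    {e : Fin n → ℂˣ} (h : IsCompactElt A e) :
    X.mk (α := α) ⟨act A e z, hz.act h⟩ = X.mk ⟨z, hz⟩ :=
  (Quotient.sound (s := levelSetoid α) ⟨A, e, h, rfl⟩).symm

theorem exists_unitary_of_rotMatrix {s : ℂ} (hs : normSq s = 1) :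
    ∃ A : Matrix.SpecialLinearGroup (Fin 2) ℂ,
      (A : Matrix (Fin 2) (Fin 2) ℂ) ∈ Matrix.unitaryGroup (Fin 2) ℂ ∧
        A.1 = !![s, 0; 0, star s] := by
  have h : s * star s = 1 := by rw [Complex.star_def, Complex.mul_conj, hs, Complex.ofReal_one]
  refine ⟨⟨!![s, 0; 0, star s], ?_⟩, ?_, rfl⟩
  · rw [Matrix.det_fin_two]; simpa using h
  · rw [Matrix.mem_unitaryGroup_iff]
    have h' : star s * s = 1 := by rw [mul_comm]; exact h
    ext i j
    fin_cases i <;> fin_cases j <;>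
      simp only [Matrix.mul_apply, Fin.sum_univ_two, Matrix.star_apply] <;> simp
    · exact h
    · exact h'

/-- Both distinguished edges point straight up and have the same length, so `T` fixes the vertical
axis and lifts to a diagonal element of `SU(2)`. That element preserves normal position, and what
remains is a torus element. -/
theorem IsNormal.mk_eq_of_poly_eq_rotate (hpos : ∀ i, 0 < α i) (hS : S.Nonempty) {z₁ z₁' : Cot n}
    (hn : IsNormal S z₁) (hn' : IsNormal S z₁') (hz1 : IsCore α S z₁) (hz1' : IsCore α S z₁')
    {T : E3 ≃ₗᵢ[ℝ] E3} (hrot : IsRotation T) (h1 : poly S z₁' = (poly S z₁).rotate T) :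
    X.mk (α := α) ⟨z₁, hz1.level⟩ = X.mk ⟨z₁', hz1'.level⟩ := by
  have hw : ∀ {y : Cot n}, IsCore α S y → IsNormal S y →
      0 < ‖(poly S y).w‖ ∧ (poly S y).w = ‖(poly S y).w‖ • EuclideanSpace.single 2 1 := by
    intro y hy hyn
    refine ⟨(hy.isPolygonPair hpos hS).norm_w_pos hpos hS, ?_⟩
    rw [hyn.norm_poly_w, hyn.poly_w]
    apply E3.ext <;> simp
  obtain ⟨hw0, hw1⟩ := hw hz1 hn
  obtain ⟨hw0', hw1'⟩ := hw hz1' hn'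
  have hfix : T (EuclideanSpace.single 2 1) = EuclideanSpace.single 2 1 := by
    have h2 : (poly S z₁').w = T (poly S z₁).w := by rw [h1]; rfl
    have h3 : ‖(poly S z₁').w‖ = ‖(poly S z₁).w‖ := by rw [h2, T.norm_map]
    rw [hw1', hw1, map_smul, h3] at h2
    exact (smul_right_injective _ hw0.ne' h2).symm
  obtain ⟨s, hs, hs'⟩ := exists_eq_rotMatrix_of_fix hrot hfix
  obtain ⟨B, hB, hB'⟩ := exists_unitary_of_rotMatrix hs
  have hTB : ∀ M, T (hermVec M) = hermVec
      (((B⁻¹ : Matrix.SpecialLinearGroup (Fin 2) ℂ) : Matrix (Fin 2) (Fin 2) ℂ) * M * B.1) := by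
    intro M
    have h := hs' (hermVec M)
    rw [SL2_inv_coe, hB']
    apply E3.ext <;> rw [h] <;>
    · simp only [Matrix.mulVec, dotProduct, Fin.sum_univ_three, rotMatrix, Matrix.mul_apply,
        Fin.sum_univ_two, hermVec_zero', hermVec_one', hermVec_two', Matrix.of_apply,
        Matrix.cons_val]
      simp
      ring
  have hc := isCompactElt_const (n := n) hB
  rw [← X.mk_eq_of_act hz1.level hc]
  have hn2 : IsNormal S (act B 1 z₁) := fun i hi => by
    rw [act_snd_one, act_fst_apply, hB', (hn i hi).1, (hn i hi).2]
    simp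
  obtain ⟨f, hf, hf'⟩ := exists_phase_of_poly_eq hpos (hz1.act hc) hz1' hn2 hn'
    (by rw [h1, poly_act hc hTB])
  exact Quotient.sound (s := levelSetoid α) ⟨1, f, ⟨by simp [one_mem], hf⟩, hf'⟩

/-- Points whose polygons differ by a rotation have the same class. -/
theorem mk_eq_of_poly_eq_rotate (hpos : ∀ i, 0 < α i) (hS : S.Nonempty) {z z' : Cot n}
    (hz : IsCore α S z) (hz' : IsCore α S z') {R : E3 ≃ₗᵢ[ℝ] E3} (hR : IsRotation R)
    (h : poly S z' = (poly S z).rotate R) :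
    X.mk (α := α) ⟨z, hz.level⟩ = X.mk ⟨z', hz'.level⟩ := by
  obtain ⟨A, e, hA, hn⟩ := hz.exists_isNormal hpos hS
  obtain ⟨A', e', hA', hn'⟩ := hz'.exists_isNormal hpos hS
  obtain ⟨Q, hQ, hQ'⟩ := exists_rotation_of_unitary hA.1
  obtain ⟨P, hP, hP'⟩ := exists_rotation_of_unitary hA'.1
  rw [← X.mk_eq_of_act hz.level hA, ← X.mk_eq_of_act hz'.level hA']
  have h1 : poly S (act A' e' z') = (poly S (act A e z)).rotate ((Q.symm.trans R).trans P) := by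
    rw [poly_act hA' hP', poly_act hA hQ', h]
    simp [VectorData.rotate]
  have hrot : IsRotation ((Q.symm.trans R).trans P) := by
    have hQs : IsRotation Q.symm := by
      have h1 := LinearEquiv.det_mul_det_symm Q.toLinearEquiv
      unfold IsRotation at hQ ⊢
      rw [hQ, one_mul] at h1
      exact h1
    unfold IsRotation at hQs hP hR ⊢
    have h1 : ((((Q.symm.trans R).trans P).toLinearEquiv : E3 ≃ₗ[ℝ] E3) : E3 →ₗ[ℝ] E3)
        = (P.toLinearEquiv : E3 →ₗ[ℝ] E3).comp ((R.toLinearEquiv : E3 →ₗ[ℝ] E3).comp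
          (Q.symm.toLinearEquiv : E3 →ₗ[ℝ] E3)) := rfl
    rw [h1, LinearMap.det_comp, LinearMap.det_comp, hP, hR, hQs, one_mul, one_mul]
  exact hn.mk_eq_of_poly_eq_rotate hpos hS hn' (hz.act hA) (hz'.act hA') hrot h1

end Hyperpolygon

/-! ### The homeomorphism from the closed stratum -/

namespace Hyperpolygon

open scoped Matrix
open Matrix (vecMulVec)
open Complex (normSq)
open Filter Topology

variable {n : ℕ} {α : Fin n → ℝ} {S : Finset (Fin n)}

/-! ### Topology of the moduli space of polygon pairs. -/

theorem isClosed_setOf_and {β : Type*} [TopologicalSpace β] {p q : β → Prop}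
    (hp : IsClosed {x | p x}) (hq : IsClosed {x | q x}) : IsClosed {x | p x ∧ q x} :=
  hp.inter hq

theorem isClosed_setOf_forall {β ι : Type*} [TopologicalSpace β] {p : ι → β → Prop}
    (h : ∀ i, IsClosed {x | p i x}) : IsClosed {x | ∀ i, p i x} := by
  rw [Set.ofPred_forall]
  exact isClosed_iInter h

theorem VectorData.continuous_u (i : S) : Continuous fun d : VectorData S => d.u i :=
  (continuous_apply i).comp (continuous_fst.comp
    (continuous_induced_dom (f := fun d : VectorData S => (d.u, d.v, d.w))))

theorem VectorData.continuous_v (j : (Sᶜ : Finset (Fin n))) :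
    Continuous fun d : VectorData S => d.v j :=
  (continuous_apply j).comp (continuous_fst.comp (continuous_snd.comp
    (continuous_induced_dom (f := fun d : VectorData S => (d.u, d.v, d.w)))))

theorem VectorData.continuous_w : Continuous fun d : VectorData S => d.w :=
  continuous_snd.comp (continuous_snd.comp
    (continuous_induced_dom (f := fun d : VectorData S => (d.u, d.v, d.w))))

theorem VectorData.tendsto_iff {β : Type*} {l : Filter β} {f : β → VectorData S}
    {d : VectorData S} : Tendsto f l (𝓝 d) ↔ (∀ i, Tendsto (fun b => (f b).u i) l (𝓝 (d.u i))) ∧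
      (∀ j, Tendsto (fun b => (f b).v j) l (𝓝 (d.v j))) ∧
        Tendsto (fun b => (f b).w) l (𝓝 d.w) := by
  rw [nhds_induced (fun d : VectorData S => (d.u, d.v, d.w)), tendsto_comap_iff,
    Prod.tendsto_iff, Prod.tendsto_iff, tendsto_pi_nhds, tendsto_pi_nhds]
  rfl

theorem VectorData.continuous_iff {β : Type*} [TopologicalSpace β] {f : β → VectorData S} :
    Continuous f ↔ (∀ i, Continuous fun b => (f b).u i) ∧ (∀ j, Continuous fun b => (f b).v j) ∧
      Continuous fun b => (f b).w := by
  simp only [continuous_iff_continuousAt, ContinuousAt, VectorData.tendsto_iff]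
  exact ⟨fun h => ⟨fun i b => (h b).1 i, fun j b => (h b).2.1 j, fun b => (h b).2.2⟩,
    fun h b => ⟨fun i => h.1 i b, fun j => h.2.1 j b, h.2.2 b⟩⟩

theorem VectorData.continuous_rotate (R : E3 ≃ₗᵢ[ℝ] E3) :
    Continuous fun d : VectorData S => d.rotate R :=
  VectorData.continuous_iff.2 ⟨fun i => R.continuous.comp (continuous_u i),
    fun j => R.continuous.comp (continuous_v j), R.continuous.comp continuous_w⟩

/-- The class of a polygon pair. -/
def PolygonPairModuli.mk (d : PolygonPair α S) : PolygonPairModuli α S :=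
  Quotient.mk (rotationSetoid α S) d

theorem PolygonPairModuli.continuous_mk :
    Continuous (PolygonPairModuli.mk : PolygonPair α S → PolygonPairModuli α S) :=
  continuous_quotient_mk'

theorem PolygonPairModuli.mk_eq_iff {d d' : PolygonPair α S} :
    PolygonPairModuli.mk d = PolygonPairModuli.mk d' ↔
      ∃ R : E3 ≃ₗᵢ[ℝ] E3, IsRotation R ∧ d'.1 = d.1.rotate R :=
  Quotient.eq (r := rotationSetoid α S)

/-- The saturation of an open set is the union of its preimages under all rotations. -/
theorem PolygonPairModuli.isOpenMap_mk :
    IsOpenMap (PolygonPairModuli.mk : PolygonPair α S → PolygonPairModuli α S) := by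
  intro U hU
  have h : PolygonPairModuli.mk ⁻¹' (PolygonPairModuli.mk '' U)
      = ⋃ R : {R : E3 ≃ₗᵢ[ℝ] E3 // IsRotation R},
        (fun d : PolygonPair α S => (⟨d.1.rotate R.1, d.2.rotate R.1⟩ : PolygonPair α S)) ⁻¹' U := by
    ext d
    simp only [Set.mem_preimage, Set.mem_image, Set.mem_iUnion]
    constructor
    · rintro ⟨d', hd', h⟩
      obtain ⟨R, hR, h⟩ := PolygonPairModuli.mk_eq_iff.1 h.symm
      exact ⟨⟨R, hR⟩, by convert hd'; exact h.symm⟩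
    · rintro ⟨R, hR⟩
      exact ⟨_, hR, (PolygonPairModuli.mk_eq_iff.2 ⟨R.1, R.2, rfl⟩).symm⟩
  refine (isQuotientMap_quotient_mk' (s := rotationSetoid α S)).isOpen_preimage.1 ?_
  change IsOpen (PolygonPairModuli.mk ⁻¹' (PolygonPairModuli.mk '' U))
  rw [h]
  exact isOpen_iUnion fun R => hU.preimage
    (((VectorData.continuous_rotate R.1).comp continuous_subtype_val).subtype_mk _)

theorem isCompact_rotations :
    IsCompact {f : E3 →L[ℝ] E3 | (∀ x, ‖f x‖ = ‖x‖) ∧ f.det = 1} := by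
  have : ProperSpace (E3 →L[ℝ] E3) := FiniteDimensional.proper ℝ _
  refine Metric.isCompact_of_isClosed_isBounded ?_ ?_
  · refine isClosed_setOf_and ?_ (isClosed_eq ContinuousLinearMap.continuous_det continuous_const)
    exact isClosed_setOf_forall fun x => isClosed_eq
      (((ContinuousLinearMap.apply ℝ E3 x).continuous).norm) continuous_const
  · refine isBounded_iff_forall_norm_le.2 ⟨1, fun f hf => ?_⟩
    exact f.opNorm_le_bound zero_le_one fun x => by rw [hf.1, one_mul]

/-- For an open quotient map it suffices that the equivalence relation is closed. It is the image of
the closed set `C` under projection along the compact factor of rotations. -/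
instance : T2Space (PolygonPairModuli α S) := by
  have ho : IsOpenQuotientMap (PolygonPairModuli.mk : PolygonPair α S → PolygonPairModuli α S) :=
    ⟨Quotient.mk_surjective, PolygonPairModuli.continuous_mk, PolygonPairModuli.isOpenMap_mk⟩
  rw [t2Space_iff_of_isOpenQuotientMap ho]
  let K := {f : E3 →L[ℝ] E3 | (∀ x, ‖f x‖ = ‖x‖) ∧ f.det = 1}
  have : CompactSpace K := isCompact_iff_compactSpace.1 isCompact_rotations
  let C : Set (K × (PolygonPair α S × PolygonPair α S)) :=
    {x | (∀ i, x.2.2.1.u i = x.1.1 (x.2.1.1.u i)) ∧ (∀ j, x.2.2.1.v j = x.1.1 (x.2.1.1.v j)) ∧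
      x.2.2.1.w = x.1.1 x.2.1.1.w}
  have hev : ∀ g : PolygonPair α S → E3, Continuous g → IsClosed
      {x : K × (PolygonPair α S × PolygonPair α S) | g x.2.2 = x.1.1 (g x.2.1)} := by
    intro g hg
    refine isClosed_eq (by fun_prop) ?_
    exact (continuous_subtype_val.comp continuous_fst).clm_apply
      (hg.comp (continuous_fst.comp continuous_snd))
  have hC : IsClosed C := by
    refine isClosed_setOf_and ?_ (isClosed_setOf_and ?_ ?_)
    · simp only [Set.ofPred_forall]
      exact isClosed_iInter fun i =>
        hev (fun d => d.1.u i) ((VectorData.continuous_u i).comp continuous_subtype_val)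
    · simp only [Set.ofPred_forall]
      exact isClosed_iInter fun j =>
        hev (fun d => d.1.v j) ((VectorData.continuous_v j).comp continuous_subtype_val)
    · exact hev (fun d => d.1.w) (VectorData.continuous_w.comp continuous_subtype_val)
  convert isClosedMap_snd_of_compactSpace C hC using 1
  ext ⟨d, d'⟩
  simp only [Set.mem_ofPred_eq, PolygonPairModuli.mk_eq_iff, Set.mem_image, Prod.exists]
  constructor
  · rintro ⟨R, hR, h⟩
    refine ⟨⟨(R : E3 →L[ℝ] E3), fun x => R.norm_map x, hR⟩, d, d', ?_, rfl⟩
    refine ⟨fun i => ?_, fun j => ?_, ?_⟩ <;> simp only [h] <;> rfl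
  · rintro ⟨⟨f, hf, hdet⟩, d₁, d₁', ⟨hu, hv, hw⟩, he⟩
    obtain ⟨rfl, rfl⟩ := Prod.mk.inj he
    obtain ⟨R, hR, hRf⟩ := exists_rotation_of_linearMap (f : E3 →ₗ[ℝ] E3) hf hdet
    refine ⟨R, hR, VectorData.ext' (fun i => ?_) (fun j => ?_) ?_⟩
    · exact (hu i).trans (hRf _).symm
    · exact (hv j).trans (hRf _).symm
    · exact hw.trans (hRf _).symm

/-! ### Continuity of the polygon map; closedness and compactness of the core configurations. -/

theorem continuous_hermVec_comp {β : Type*} [TopologicalSpace β] {f : β → Matrix (Fin 2) (Fin 2) ℂ}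
    (hf : Continuous f) : Continuous fun b => hermVec (f b) :=
  hermVec.continuous_of_finiteDimensional.comp hf

theorem continuous_vecMulVec {β : Type*} [TopologicalSpace β] {f g : β → Fin 2 → ℂ}
    (hf : Continuous f) (hg : Continuous g) : Continuous fun b => vecMulVec (f b) (g b) := by
  refine continuous_matrix fun i j => ?_
  simp only [Matrix.vecMulVec_apply]
  fun_prop

theorem continuous_fst_apply (i : Fin n) : Continuous fun z : Cot n => z.1 i := by fun_prop

theorem continuous_snd_apply (i : Fin n) : Continuous fun z : Cot n => z.2 i := by fun_prop

theorem continuous_momentVec (i : Fin n) : Continuous fun z : Cot n => momentVec z i :=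
  continuous_hermVec_comp ((continuous_vecMulVec (continuous_snd_apply i)
    (continuous_snd_apply i).star).sub
      (continuous_vecMulVec (continuous_fst_apply i).star (continuous_fst_apply i)))

theorem continuous_hopf : Continuous hopf :=
  continuous_hermVec_comp (continuous_vecMulVec continuous_id continuous_star)

theorem continuous_poly : Continuous (poly S : Cot n → VectorData S) := by
  have hu (i : S) : Continuous fun z : Cot n => hermVec (vecMulVec (z.2 i) (z.1 i)) :=
    continuous_hermVec_comp (continuous_vecMulVec (continuous_snd_apply _)
      (continuous_fst_apply _))
  have hv (j : (Sᶜ : Finset (Fin n))) : Continuous fun z : Cot n => hopf (z.2 j) :=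
    continuous_hopf.comp (continuous_snd_apply _)
  have hw : Continuous fun z : Cot n => ∑ i : S, momentVec z i :=
    continuous_finsetSum _ fun i _ => continuous_momentVec _
  have hu' (i : S) : Continuous fun z : Cot n => (2 : ℝ) • hermVec (vecMulVec (z.2 i) (z.1 i)) :=
    (hu i).const_smul (2 : ℝ)
  exact VectorData.continuous_iff.2 ⟨hu', hv, hw⟩

theorem continuous_sqNorm : Continuous sqNorm := by
  unfold sqNorm; fun_prop

theorem isClosed_isLevel : IsClosed {z : Cot n | IsLevel α z} := by
  simp only [isLevel_iff]
  refine isClosed_setOf_and ?_ (isClosed_setOf_and ?_ (isClosed_setOf_and ?_ ?_))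
  · simp only [Set.ofPred_forall]
    exact isClosed_iInter fun i => isClosed_eq ((continuous_sqNorm.comp
      (continuous_snd_apply i)).sub (continuous_sqNorm.comp (continuous_fst_apply i)))
        continuous_const
  · exact isClosed_eq (continuous_finsetSum _ fun i _ => continuous_momentVec i) continuous_const
  · simp only [Set.ofPred_forall]
    exact isClosed_iInter fun i => isClosed_eq (by simp only [dotProduct]; fun_prop)
      continuous_const
  · exact isClosed_eq (continuous_finsetSum _ fun i _ => continuous_vecMulVec
      (continuous_snd_apply i) (continuous_fst_apply i)) continuous_const

/-- The determinant of two vectors in `ℂ²`. -/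
def wedge (x y : Fin 2 → ℂ) : ℂ := x 0 * y 1 - x 1 * y 0

theorem exists_smul_of_wedge_eq_zero {x y : Fin 2 → ℂ} (hy : y ≠ 0) (h : wedge x y = 0) :
    ∃ c : ℂ, x = c • y := by
  unfold wedge at h
  by_cases h0 : y 0 = 0
  · have h1 : y 1 ≠ 0 := fun h1 => hy (by ext k; fin_cases k <;> simp [h0, h1])
    refine ⟨x 1 / y 1, ?_⟩
    rw [h0, mul_zero, sub_zero] at h
    ext k; fin_cases k
    · simp [h0, (mul_eq_zero.1 h).resolve_right h1]
    · simp [h1]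
  · refine ⟨x 0 / y 0, ?_⟩
    ext k; fin_cases k
    · simp [h0]
    · simp only [Fin.mk_one, Pi.smul_apply, smul_eq_mul]
      field_simp
      linear_combination -h

/-- Replaces the existential quantifier in straightness by polynomial equations, which are visibly
closed. -/
theorem isStraight_iff_wedge {T : Finset (Fin n)} {z : Cot n} (h : ∀ i, z.2 i ≠ 0) :
    IsStraight T z ↔ ∀ i ∈ T, ∀ j ∈ T, wedge (z.2 i) (z.2 j) = 0 := by
  refine ⟨fun hs i hi j hj => ?_, fun hs i hi j hj =>
    exists_smul_of_wedge_eq_zero (h j) (hs i hi j hj)⟩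
  obtain ⟨c, hc⟩ := hs i hi j hj
  simp [wedge, hc]; ring

theorem isClosed_isCore (hpos : ∀ i, 0 < α i) : IsClosed {z : Cot n | IsCore α S z} := by
  have h : {z : Cot n | IsCore α S z} = {z | IsLevel α z} ∩ (⋂ i ∈ S, ⋂ j ∈ S,
      {z | wedge (z.2 i) (z.2 j) = 0}) ∩ ⋂ j ∈ Sᶜ, {z | z.1 j = 0} := by
    ext z
    simp only [Set.mem_ofPred_eq, Set.mem_inter_iff, Set.mem_iInter]
    constructor
    · intro hz
      exact ⟨⟨hz.level, (isStraight_iff_wedge (hz.level.snd_ne_zero hpos)).1 hz.straight⟩,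
        hz.fst_eq_zero⟩
    · rintro ⟨⟨h1, h2⟩, h3⟩
      exact ⟨h1, (isStraight_iff_wedge (h1.snd_ne_zero hpos)).2 h2, h3⟩
  rw [h]
  refine (isClosed_isLevel.inter ?_).inter ?_
  · exact isClosed_biInter fun i _ => isClosed_biInter fun j _ =>
      isClosed_eq (by simp only [wedge]; fun_prop) continuous_const
  · exact isClosed_biInter fun j _ => isClosed_eq (continuous_fst_apply j) continuous_const

theorem norm_le_of_sqNorm_le {x : Fin 2 → ℂ} {c : ℝ} (h : sqNorm x ≤ c) : ‖x‖ ≤ c + 1 := by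
  have hc : 0 ≤ c := (sqNorm_nonneg x).trans h
  rw [sqNorm_eq] at h
  refine (pi_norm_le_iff_of_nonneg (by linarith)).2 fun k => ?_
  fin_cases k
  · change ‖x 0‖ ≤ _
    nlinarith [sq_nonneg ‖x 1‖, sq_nonneg (‖x 0‖ - 1)]
  · change ‖x 1‖ ≤ _
    nlinarith [sq_nonneg ‖x 0‖, sq_nonneg (‖x 1‖ - 1)]

/-- For boundedness: `‖w‖` is the sum of `(|q_i|² + |p_i|²) / 2` over `S`, and closing the spatial
polygon bounds it by the sum of the `α_j` off `S`. Off `S` the lengths are prescribed. -/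
theorem isCompact_isCore (hpos : ∀ i, 0 < α i) (hS : S.Nonempty) :
    IsCompact {z : Cot n | IsCore α S z} := by
  refine Metric.isCompact_of_isClosed_isBounded (isClosed_isCore hpos) ?_
  set C : ℝ := 2 * ∑ j : (Sᶜ : Finset (Fin n)), α j with hC
  have hC0 : 0 ≤ C := by
    have : 0 ≤ ∑ j : (Sᶜ : Finset (Fin n)), α j := Finset.sum_nonneg fun j _ => (hpos j).le
    positivity
  have key : ∀ z, IsCore α S z → ∀ i, sqNorm (z.2 i) ≤ C ∧ sqNorm (z.1 i) ≤ C := by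
    intro z hz i
    have hp := hz.isPolygonPair hpos hS
    by_cases hi : i ∈ S
    · have h1 : ‖(poly S z).w‖ ≤ ∑ j : (Sᶜ : Finset (Fin n)), α j := by
        rw [eq_neg_of_add_eq_zero_left hp.closed_spatial, norm_neg]
        refine (norm_sum_le _ _).trans (le_of_eq ?_)
        exact Finset.sum_congr rfl fun j _ => hp.length_v j
      rw [hz.norm_poly_w hpos hS] at h1
      have h2 := Finset.single_le_sum
        (f := fun i : S => (sqNorm (z.2 i) + sqNorm (z.1 i)) / 2)
        (fun i _ => by have := sqNorm_nonneg (z.2 i); have := sqNorm_nonneg (z.1 i); positivity)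
        (Finset.mem_univ (⟨i, hi⟩ : S))
      have h3 := sqNorm_nonneg (z.2 i)
      have h4 := sqNorm_nonneg (z.1 i)
      simp only at h2
      constructor <;> linarith
    · have hj := Finset.mem_compl.2 hi
      have h1 := (isLevel_iff.1 hz.level).1 i
      have h0 : sqNorm (z.1 i) = 0 := by rw [hz.fst_eq_zero i hj]; simp [sqNorm]
      have h2 := Finset.single_le_sum (f := fun j : (Sᶜ : Finset (Fin n)) => α j)
        (fun j _ => (hpos j).le) (Finset.mem_univ (⟨i, hj⟩ : (Sᶜ : Finset (Fin n))))
      simp only at h2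
      constructor <;> linarith
  refine isBounded_iff_forall_norm_le.2 ⟨C + 1, fun z hz => ?_⟩
  refine max_le ?_ ?_
  · exact (pi_norm_le_iff_of_nonneg (by linarith)).2 fun i => norm_le_of_sqNorm_le (key z hz i).2
  · exact (pi_norm_le_iff_of_nonneg (by linarith)).2 fun i => norm_le_of_sqNorm_le (key z hz i).1

/-- The classes for which `S` is straight and `p j = 0` for all `j ∉ S`. -/
def coreSet (α : Fin n → ℝ) (S : Finset (Fin n)) : Set (X α) :=
  {x | ∃ z : Level α, X.mk z = x ∧ IsCore α S z.1}

theorem X.mk_eq_iff {z z' : Level α} : X.mk z = X.mk z' ↔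
    ∃ (A : Matrix.SpecialLinearGroup (Fin 2) ℂ) (e : Fin n → ℂˣ),
      IsCompactElt A e ∧ z'.1 = act A e z.1 :=
  Quotient.eq (r := levelSetoid α)

theorem X.mk_mem_coreSet {z : Level α} : X.mk z ∈ coreSet α S ↔ IsCore α S z.1 := by
  refine ⟨?_, fun h => ⟨z, rfl, h⟩⟩
  rintro ⟨z', h, hz'⟩
  obtain ⟨A, e, hA, he⟩ := X.mk_eq_iff.1 h
  rw [he]
  exact hz'.act hA

theorem X.isQuotientMap_mk : IsQuotientMap (X.mk : Level α → X α) := isQuotientMap_quotient_mk'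

theorem isClosed_coreSet (hpos : ∀ i, 0 < α i) : IsClosed (coreSet α S) := by
  refine X.isQuotientMap_mk.isClosed_preimage.1 ?_
  have : X.mk ⁻¹' coreSet α S = Subtype.val ⁻¹' {z : Cot n | IsCore α S z} := by
    ext z; exact X.mk_mem_coreSet
  rw [this]
  exact (isClosed_isCore hpos).preimage continuous_subtype_val

/-- The closed stratum `coreSet` is homeomorphic to the moduli space of polygon pairs. -/
theorem exists_homeomorph_coreSet (hpos : ∀ i, 0 < α i) (hS : S.Nonempty) :
    ∃ Φ : coreSet α S ≃ₜ PolygonPairModuli α S, ∀ (z : Cot n) (hz : IsCore α S z),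
      Φ ⟨X.mk ⟨z, hz.level⟩, X.mk_mem_coreSet.2 hz⟩
        = PolygonPairModuli.mk ⟨poly S z, hz.isPolygonPair hpos hS⟩ := by
  let Z := {z : Cot n // IsCore α S z}
  have : CompactSpace Z := isCompact_iff_compactSpace.1 (isCompact_isCore hpos hS)
  let π : Z → coreSet α S := fun z => ⟨X.mk ⟨z.1, z.2.level⟩, X.mk_mem_coreSet.2 z.2⟩
  let ψ : Z → PolygonPairModuli α S :=
    fun z => PolygonPairModuli.mk ⟨poly S z.1, z.2.isPolygonPair hpos hS⟩
  have hlev : Continuous fun z : Z => (⟨z.1, z.2.level⟩ : Level α) :=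
    continuous_subtype_val.subtype_mk _
  have hπc : Continuous π := (X.isQuotientMap_mk.continuous.comp hlev).subtype_mk _
  have hψc : Continuous ψ := PolygonPairModuli.continuous_mk.comp
    ((continuous_poly.comp continuous_subtype_val).subtype_mk _)
  have hπs : Function.Surjective π := by
    rintro ⟨x, z, rfl, hz⟩
    exact ⟨⟨z.1, hz⟩, rfl⟩
  have hemb : IsClosedEmbedding fun z : Z => (⟨z.1, z.2.level⟩ : Level α) := by
    refine hlev.isClosedEmbedding fun z z' h => ?_
    exact Subtype.ext (congrArg (fun y : Level α => y.1) h)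
  -- `Z` is the full preimage of `coreSet` and is closed in the level set, so the quotient map
  -- restricts to a quotient map.
  have hπ : IsQuotientMap π := by
    refine isQuotientMap_iff_isClosed.2 ⟨hπs, fun F => ⟨fun hF => hF.preimage hπc, fun hF => ?_⟩⟩
    have h1 : IsClosed (Subtype.val '' F : Set (X α)) := by
      refine X.isQuotientMap_mk.isClosed_preimage.1 ?_
      convert hemb.isClosedMap _ hF using 1
      ext z
      simp only [Set.mem_preimage, Set.mem_image]
      constructor
      · rintro ⟨⟨x, hx⟩, hF, rfl⟩
        exact ⟨⟨z.1, X.mk_mem_coreSet.1 hx⟩, hF, rfl⟩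
      · rintro ⟨y, hF, rfl⟩
        exact ⟨π y, hF, rfl⟩
    rw [← Subtype.val_injective.preimage_image F]
    exact h1.preimage continuous_subtype_val
  -- Both maps have the same fibres: `K` acts on polygons by rotations, and polygons that agree up
  -- to rotation come from one `K`-orbit.
  have hker : ∀ z z' : Z, π z = π z' ↔ ψ z = ψ z' := by
    intro z z'
    constructor
    · intro h
      obtain ⟨A, e, hA, he⟩ := X.mk_eq_iff.1 (congrArg Subtype.val h)
      obtain ⟨R, hR, hR'⟩ := exists_rotation_of_unitary hA.1
      refine PolygonPairModuli.mk_eq_iff.2 ⟨R, hR, ?_⟩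
      change poly S z'.1 = _
      rw [show z'.1 = act A e z.1 from he, poly_act hA hR']
    · intro h
      obtain ⟨R, hR, h⟩ := PolygonPairModuli.mk_eq_iff.1 h
      exact Subtype.ext (mk_eq_of_poly_eq_rotate hpos hS z.2 z'.2 hR h)
  have hψs : Function.Surjective ψ := by
    intro x
    obtain ⟨d, rfl⟩ := Quotient.mk_surjective x
    obtain ⟨R, γ, q, hR, hz, h⟩ := d.2.exists_normalForm hpos hS
    exact ⟨⟨_, hz⟩, (PolygonPairModuli.mk_eq_iff.2 ⟨R, hR, h⟩).symm⟩
  let f : C(coreSet α S, PolygonPairModuli α S) :=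
    IsQuotientMap.lift (f := ⟨π, hπc⟩) hπ ⟨ψ, hψc⟩ fun z z' (h : π z = π z') => (hker z z').1 h
  have hf : ∀ z, f (π z) = ψ z := fun z =>
    congrArg (fun g : C(Z, PolygonPairModuli α S) => g z)
      (IsQuotientMap.lift_comp (f := ⟨π, hπc⟩) hπ ⟨ψ, hψc⟩ fun z z' (h : π z = π z') => (hker z z').1 h)
  have : CompactSpace (coreSet α S) := by
    refine isCompact_univ_iff.1 ?_
    rw [← hπs.range_eq]
    exact isCompact_range hπc
  have hbij : Function.Bijective f := by
    constructor
    · intro x y h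
      obtain ⟨z, rfl⟩ := hπs x
      obtain ⟨z', rfl⟩ := hπs y
      rw [hf, hf] at h
      exact (hker z z').2 h
    · intro y
      obtain ⟨z, rfl⟩ := hψs y
      exact ⟨π z, hf z⟩
  refine ⟨Continuous.homeoOfEquivCompactToT2 (f := Equiv.ofBijective f hbij) f.continuous,
    fun z hz => hf ⟨z, hz⟩⟩

end Hyperpolygon

/-! ### Limits of the scaling action -/

namespace Hyperpolygon

open scoped Matrix
open Matrix (vecMulVec)
open Complex (normSq)
open Filter Topology

variable {n : ℕ} {α : Fin n → ℝ} {S : Finset (Fin n)}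

/-! ### Functions on the quotient that detect the limits. -/

theorem wedge_act (A : Matrix.SpecialLinearGroup (Fin 2) ℂ) (e : Fin n → ℂˣ) (z : Cot n)
    (i j : Fin n) : wedge ((act A e z).2 i) ((act A e z).2 j)
      = e i * e j * wedge (z.2 i) (z.2 j) := by
  have hd := SL2_det A
  simp only [wedge, act_snd_zero, act_snd_one]
  linear_combination (e i * e j * (z.2 i 0 * z.2 j 1 - z.2 i 1 * z.2 j 0) : ℂ) * hd

theorem pairing_act (A : Matrix.SpecialLinearGroup (Fin 2) ℂ) (e : Fin n → ℂˣ) (z : Cot n)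
    (i j : Fin n) : (act A e z).1 i ⬝ᵥ (act A e z).2 j
      = ((e i)⁻¹ : ℂˣ) * e j * (z.1 i ⬝ᵥ z.2 j) := by
  have hd := SL2_det A
  simp only [dotProduct, Fin.sum_univ_two, act_fst_apply, act_snd_zero, act_snd_one]
  linear_combination (((e i)⁻¹ : ℂˣ) * e j * (z.1 i 0 * z.2 j 0 + z.1 i 1 * z.2 j 1) : ℂ) * hd

theorem norm_wedge_act {A : Matrix.SpecialLinearGroup (Fin 2) ℂ} {e : Fin n → ℂˣ}
    (h : IsCompactElt A e) (z : Cot n) (i j : Fin n) :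
    ‖wedge ((act A e z).2 i) ((act A e z).2 j)‖ = ‖wedge (z.2 i) (z.2 j)‖ := by
  rw [wedge_act, norm_mul, norm_mul, h.2, h.2, one_mul, one_mul]

theorem norm_pairing_act {A : Matrix.SpecialLinearGroup (Fin 2) ℂ} {e : Fin n → ℂˣ}
    (h : IsCompactElt A e) (z : Cot n) (i j : Fin n) :
    ‖(act A e z).1 i ⬝ᵥ (act A e z).2 j‖ = ‖z.1 i ⬝ᵥ z.2 j‖ := by
  rw [pairing_act, norm_mul, norm_mul, h.2, Units.val_inv_eq_inv_val, norm_inv, h.2, inv_one,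
    one_mul, one_mul]

/-- The function `|q i ∧ q j|` on the quotient. -/
noncomputable def wedgeInv (i j : Fin n) : X α → ℝ :=
  Quotient.lift (fun z : Level α => ‖wedge (z.1.2 i) (z.1.2 j)‖) (by
    rintro z z' ⟨A, e, h, hz⟩
    rw [hz, norm_wedge_act h])

/-- The function `|p i q j|` on the quotient. -/
noncomputable def pairInv (i j : Fin n) : X α → ℝ :=
  Quotient.lift (fun z : Level α => ‖z.1.1 i ⬝ᵥ z.1.2 j‖) (by
    rintro z z' ⟨A, e, h, hz⟩
    rw [hz, norm_pairing_act h])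

theorem wedgeInv_mk (i j : Fin n) (z : Level α) :
    wedgeInv i j (X.mk z) = ‖wedge (z.1.2 i) (z.1.2 j)‖ := rfl

theorem pairInv_mk (i j : Fin n) (z : Level α) :
    pairInv i j (X.mk z) = ‖z.1.1 i ⬝ᵥ z.1.2 j‖ := rfl

theorem continuous_wedgeInv (i j : Fin n) : Continuous (wedgeInv i j : X α → ℝ) := by
  have h : Continuous fun z : Level α => ‖wedge (z.1.2 i) (z.1.2 j)‖ := by
    unfold wedge; fun_prop
  exact h.quotient_lift _

theorem continuous_pairInv (i j : Fin n) : Continuous (pairInv i j : X α → ℝ) := by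
  have h : Continuous fun z : Level α => ‖z.1.1 i ⬝ᵥ z.1.2 j‖ := by
    unfold dotProduct; fun_prop
  exact h.quotient_lift _

/-- Determinant one makes `A` drop out of both functions, so only the moduli of the torus element
remain as weights. -/
theorem IsScaled.exists_weights {t : ℂ} {x y : X α} (h : IsScaled t x y) :
    ∃ r : Fin n → ℝ, (∀ i, 0 < r i) ∧ (∀ i j, wedgeInv i j y = r i * r j * wedgeInv i j x) ∧
      ∀ i j, pairInv i j y = (r i)⁻¹ * r j * ‖t‖ * pairInv i j x := by
  obtain ⟨z, z', rfl, rfl, A, e, he⟩ := h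
  refine ⟨fun i => ‖(e i : ℂ)‖, fun i => by simp, fun i j => ?_, fun i j => ?_⟩
  · rw [wedgeInv_mk, wedgeInv_mk, he, wedge_act, norm_mul, norm_mul]
  · rw [pairInv_mk, pairInv_mk, he, pairing_act]
    simp [mul_assoc]

/-- Hopf images of proportional vectors are nonnegative multiples of a single vector, so nothing
cancels. -/
theorem IsStraight.norm_sum_hopf {T : Finset (Fin n)} {z : Cot n} (h : IsStraight T z) :
    ‖∑ j ∈ T, hopf (z.2 j)‖ = ∑ j ∈ T, ‖hopf (z.2 j)‖ := by
  rcases T.eq_empty_or_nonempty with rfl | ⟨j₀, hj₀⟩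
  · simp
  have key : ∀ j ∈ T, ∃ c : ℝ, 0 ≤ c ∧ hopf (z.2 j) = c • hopf (z.2 j₀) := by
    intro j hj
    obtain ⟨c, hc⟩ := h j hj j₀ hj₀
    refine ⟨normSq c, Complex.normSq_nonneg c, ?_⟩
    rw [hc, hopf, hopf, star_smul, Matrix.vecMulVec_smul, Matrix.smul_vecMulVec, smul_smul,
      ← map_smul]
    congr 1
    rw [show star c * c = (normSq c : ℂ) by
      rw [mul_comm, Complex.star_def, Complex.mul_conj]]
    ext k l; simp
  choose! c hc0 hc using key
  rw [Finset.sum_congr rfl hc, ← Finset.sum_smul, norm_smul,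
    Real.norm_of_nonneg (Finset.sum_nonneg hc0), Finset.sum_mul]
  refine Finset.sum_congr rfl fun j hj => ?_
  rw [hc j hj, norm_smul, Real.norm_of_nonneg (hc0 j hj)]

theorem IsStraight.act {T : Finset (Fin n)} {z : Cot n} (h : IsStraight T z)
    (A : Matrix.SpecialLinearGroup (Fin 2) ℂ) (e : Fin n → ℂˣ) :
    IsStraight T (act A e z) := by
  intro i hi j hj
  obtain ⟨c, hc⟩ := h i hi j hj
  refine ⟨(e i) * c * ((e j)⁻¹ : ℂˣ), ?_⟩
  simp only [Hyperpolygon.act, hc, Matrix.mulVec_smul, smul_smul]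
  congr 1
  simp [mul_assoc]

theorem fixedComponent_exists_isNormal (hpos : ∀ i, 0 < α i) (hS : S.Nonempty) {y : X α}
    (hy : y ∈ fixedComponent α S) : ∃ z : Level α, X.mk z = y ∧ IsCore α S z.1 ∧
      IsNormal S z.1 ∧ IsStraight Sᶜ z.1 := by
  obtain ⟨z, rfl, h1, h2, h3⟩ := hy
  have hz : IsCore α S z.1 := ⟨z.2, h1, h3⟩
  obtain ⟨A, e, h, hn⟩ := hz.exists_isNormal hpos hS
  exact ⟨⟨_, hz.level.act h⟩, X.mk_eq_of_act hz.level h, hz.act h, hn, h2.act A e⟩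

theorem IsNormal.wedge_eq {z : Cot n} (hn : IsNormal S z) {i : Fin n} (hi : i ∈ S) (j : Fin n) :
    wedge (z.2 i) (z.2 j) = z.2 i 0 * z.2 j 1 := by
  rw [wedge, (hn i hi).1, zero_mul, sub_zero]

theorem IsNormal.snd_zero_ne_zero {z : Cot n} (hpos : ∀ i, 0 < α i) (hz : IsLevel α z)
    (hn : IsNormal S z) {i : Fin n} (hi : i ∈ S) : z.2 i 0 ≠ 0 := fun h0 => by
  apply hz.snd_ne_zero hpos i
  ext k; fin_cases k
  · exact h0
  · exact (hn i hi).1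

/-- In normal position, if `q_j` were horizontal, so would be every `q_k` off `S` by straightness.
Every `v_k` would then have nonnegative height and `w` positive height, so the spatial polygon could
not close. -/
theorem wedgeInv_pos_of_mem_fixedComponent (hpos : ∀ i, 0 < α i) (hS : S.Nonempty) {y : X α}
    (hy : y ∈ fixedComponent α S) {i j : Fin n} (hi : i ∈ S) (hj : j ∈ Sᶜ) :
    0 < wedgeInv i j y := by
  obtain ⟨z, rfl, hz, hn, hs⟩ := fixedComponent_exists_isNormal hpos hS hy
  rw [wedgeInv_mk, norm_pos_iff, hn.wedge_eq hi]
  refine mul_ne_zero (hn.snd_zero_ne_zero hpos hz.level hi) fun h1 => ?_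
  have hp := hz.isPolygonPair hpos hS
  have hw := hp.norm_w_pos hpos hS
  rw [hn.norm_poly_w] at hw
  have h2 := congrArg (fun x : E3 => x 2) hp.closed_spatial
  rw [hn.poly_w] at h2
  simp only [PiLp.add_apply, WithLp.ofLp_sum, Finset.sum_apply, PiLp.zero_apply] at h2
  have h3 : 0 ≤ ∑ k : (Sᶜ : Finset (Fin n)), (poly S z.1).v k 2 :=
    Finset.sum_nonneg fun k _ => by
      obtain ⟨c, hc⟩ := hs k k.2 j hj
      simp only [poly, hopf_two', hc, Pi.smul_apply, h1, smul_zero, norm_zero]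
      rw [zero_pow two_ne_zero, sub_zero]
      positivity
  simp only [Matrix.cons_val] at h2
  linarith

/-- If all `p_i` with `i ∈ S` vanished, `‖w‖` would be the sum of the `α_i` over `S`; straightness
of the complement makes it the sum of the `α_j` off `S`. Genericity excludes this. -/
theorem exists_pairInv_pos_of_mem_fixedComponent (hpos : ∀ i, 0 < α i) (hgen : IsGeneric α)
    (hS : S.Nonempty) {y : X α} (hy : y ∈ fixedComponent α S) :
    ∃ i ∈ S, ∀ j ∈ Sᶜ, 0 < pairInv i j y := by
  obtain ⟨z, hzy, hz, hn, hs⟩ := fixedComponent_exists_isNormal hpos hS hy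
  have hp := hz.isPolygonPair hpos hS
  have hex : ∃ i ∈ S, z.1.1 i 1 ≠ 0 := by
    by_contra! h
    apply hgen S
    have hu : ∀ i : S, (poly S z.1).u i = 0 := fun i => by
      rw [hn.poly_u, h i i.2]; apply E3.ext <;> simp
    have h1 := hp.length_w
    simp only [hu, norm_zero] at h1
    rw [eq_neg_of_add_eq_zero_left hp.closed_spatial, norm_neg] at h1
    have h2 := hs.norm_sum_hopf
    rw [← Finset.sum_coe_sort, ← Finset.sum_coe_sort Sᶜ] at h2
    have h3 : ∑ j : (Sᶜ : Finset (Fin n)), ‖hopf (z.1.2 j)‖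
        = ∑ j : (Sᶜ : Finset (Fin n)), α j :=
      Finset.sum_congr rfl fun j _ => hp.length_v j
    have h4 : ∑ i : S, Real.sqrt (α i ^ 2 + 0 ^ 2) = ∑ i : S, α i :=
      Finset.sum_congr rfl fun i _ => by
        rw [zero_pow two_ne_zero, add_zero, Real.sqrt_sq (hpos i).le]
    rw [h4] at h1
    rw [← Finset.sum_coe_sort S, ← Finset.sum_coe_sort Sᶜ, ← h1, ← h3, ← h2]
    rfl
  obtain ⟨i, hi, hne⟩ := hex
  refine ⟨i, hi, fun j hj => ?_⟩
  have hw := wedgeInv_pos_of_mem_fixedComponent hpos hS hy hi hj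
  rw [← hzy] at hw ⊢
  rw [wedgeInv_mk, norm_pos_iff, hn.wedge_eq hi] at hw
  rw [pairInv_mk, norm_pos_iff]
  simp only [dotProduct, Fin.sum_univ_two, (hn i hi).2, zero_mul, zero_add]
  exact mul_ne_zero hne (right_ne_zero_of_mul hw)

/-- The form in which limits are used: a convergent quantity cannot be a nonzero constant times a
divergent one. -/
theorem eq_zero_of_tendsto_mul {β : Type*} {l : Filter β} [l.NeBot] {a g : β → ℝ} {K a₀ : ℝ}
    (ha : Tendsto a l (𝓝 a₀)) (hg : Tendsto g l atTop) (h : ∀ᶠ t in l, a t = g t * K) :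
    K = 0 := by
  have h1 : Tendsto (fun t => a t * (g t)⁻¹) l (𝓝 (a₀ * 0)) :=
    ha.mul (tendsto_inv_atTop_zero.comp hg)
  have h2 : Tendsto (fun t => a t * (g t)⁻¹) l (𝓝 K) := by
    refine tendsto_const_nhds.congr' ?_
    filter_upwards [h, hg.eventually_gt_atTop 0] with t ht hgt
    rw [ht, mul_comm (g t), mul_assoc, mul_inv_cancel₀ hgt.ne', mul_one]
  rw [tendsto_nhds_unique h2 h1, mul_zero]

/-- Points that flow up to the fixed component lie in the closed stratum. -/
theorem mem_coreSet_of_flowsUpTo (hpos : ∀ i, 0 < α i) (hgen : IsGeneric α) (hS : S.Nonempty)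
    (hSc : Sᶜ.Nonempty) {x y : X α} (hy : y ∈ fixedComponent α S) (hxy : FlowsUpTo x y) :
    x ∈ coreSet α S := by
  obtain ⟨f, hf, hlim⟩ := hxy
  obtain ⟨z, rfl⟩ := Quotient.mk_surjective x
  change X.mk z ∈ _
  change ∀ t : ℂ, t ≠ 0 → IsScaled t (X.mk z) (f t) at hf
  set x := X.mk z with hx
  obtain ⟨i₀, hi₀, hP⟩ := exists_pairInv_pos_of_mem_fixedComponent hpos hgen hS hy
  obtain ⟨j₀, hj₀⟩ := hSc
  have hne : ∀ᶠ t : ℂ in Bornology.cobounded ℂ, t ≠ 0 := by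
    filter_upwards [tendsto_norm_cobounded_atTop.eventually_gt_atTop (0 : ℝ)] with t ht
    exact norm_pos_iff.1 ht
  have hWl (i j) : Tendsto (fun t => wedgeInv i j (f t)) (Bornology.cobounded ℂ)
      (𝓝 (wedgeInv i j y)) := ((continuous_wedgeInv i j).tendsto y).comp hlim
  have hPl (i j) : Tendsto (fun t => pairInv i j (f t)) (Bornology.cobounded ℂ)
      (𝓝 (pairInv i j y)) := ((continuous_pairInv i j).tendsto y).comp hlim
  -- Scaling preserves zeros, so a function that is positive at the limit is nonzero at `x`.
  have hW0 : ∀ i ∈ S, ∀ j ∈ Sᶜ, wedgeInv i j x ≠ 0 := by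
    intro i hi j hj h0
    obtain ⟨t, ht, ht0⟩ := (((hWl i j).eventually_const_lt
      (wedgeInv_pos_of_mem_fixedComponent hpos hS hy hi hj)).and hne).exists
    obtain ⟨r, -, hr, -⟩ := (hf t ht0).exists_weights
    rw [hr, h0, mul_zero] at ht
    exact lt_irrefl _ ht
  have hP0 : ∀ j ∈ Sᶜ, pairInv i₀ j x ≠ 0 := by
    intro j hj h0
    obtain ⟨t, ht, ht0⟩ := (((hPl i₀ j).eventually_const_lt (hP j hj)).and hne).exists
    obtain ⟨r, -, -, hr⟩ := (hf t ht0).exists_weights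
    rw [hr, h0, mul_zero] at ht
    exact lt_irrefl _ ht
  have hnorm : Tendsto (fun t : ℂ => ‖t‖) (Bornology.cobounded ℂ) atTop :=
    tendsto_norm_cobounded_atTop
  rw [hx, X.mk_mem_coreSet]
  refine ⟨z.2, ?_, ?_⟩
  · rw [isStraight_iff_wedge (IsLevel.snd_ne_zero hpos z.2)]
    intro i hi i' hi'
    -- The product `|q_i ∧ q_i'| |q_i₀ ∧ q_j₀| |p_i₀ q_j₀|` has weight `r_i r_i' r_j₀² |t|`. Up to
    -- `|t|` this is the weight of `|q_i ∧ q_j₀| |q_i' ∧ q_j₀|`, whose limit is positive; comparing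
    -- the two eliminates the unknown weights.
    have hK : wedgeInv i i' x * (wedgeInv i₀ j₀ x * pairInv i₀ j₀ x) = 0 := by
      have hb : Tendsto (fun t => wedgeInv i j₀ (f t) * wedgeInv i' j₀ (f t))
          (Bornology.cobounded ℂ) (𝓝 (wedgeInv i j₀ y * wedgeInv i' j₀ y)) :=
        (hWl i j₀).mul (hWl i' j₀)
      refine eq_zero_of_tendsto_mul
        (a := fun t => wedgeInv i i' (f t) * (wedgeInv i₀ j₀ (f t) * pairInv i₀ j₀ (f t))
          * (wedgeInv i j₀ x * wedgeInv i' j₀ x))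
        (g := fun t => ‖t‖ * (wedgeInv i j₀ (f t) * wedgeInv i' j₀ (f t)))
        (((hWl i i').mul ((hWl i₀ j₀).mul (hPl i₀ j₀))).mul_const _)
        (hnorm.atTop_mul_pos (mul_pos
          (wedgeInv_pos_of_mem_fixedComponent hpos hS hy hi hj₀)
          (wedgeInv_pos_of_mem_fixedComponent hpos hS hy hi' hj₀)) hb) ?_
      filter_upwards [hne] with t ht
      obtain ⟨r, hr0, hr1, hr2⟩ := (hf t ht).exists_weights
      have := (hr0 i₀).ne'
      rw [hr1, hr1, hr1, hr1, hr2]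
      field_simp
    have h := (mul_eq_zero.1 hK).resolve_right (mul_ne_zero (hW0 i₀ hi₀ j₀ hj₀) (hP0 j₀ hj₀))
    exact norm_eq_zero.1 h
  · intro j hj
    -- In this product the weights cancel and exactly `|t|²` is left.
    have hK : pairInv j i₀ x * pairInv i₀ j x = 0 := by
      refine eq_zero_of_tendsto_mul (a := fun t => pairInv j i₀ (f t) * pairInv i₀ j (f t))
        (g := fun t : ℂ => ‖t‖ * ‖t‖) ((hPl j i₀).mul (hPl i₀ j)) (hnorm.atTop_mul_atTop₀ hnorm) ?_
      filter_upwards [hne] with t ht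
      obtain ⟨r, hr0, -, hr2⟩ := (hf t ht).exists_weights
      have := (hr0 i₀).ne'
      have := (hr0 j).ne'
      rw [hr2, hr2]
      field_simp
    have h1 : z.1.1 j ⬝ᵥ z.1.2 i₀ = 0 :=
      norm_eq_zero.1 ((mul_eq_zero.1 hK).resolve_right (hP0 j hj))
    have h2 : z.1.1 j ⬝ᵥ z.1.2 j = 0 := (isLevel_iff.1 z.2).2.2.1 j
    -- `p_j` annihilates two linearly independent vectors, so it vanishes.
    have h3 : wedge (z.1.2 i₀) (z.1.2 j) ≠ 0 := norm_ne_zero_iff.1 (hW0 i₀ hi₀ j hj)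
    simp only [dotProduct, Fin.sum_univ_two] at h1 h2
    unfold wedge at h3
    ext k; fin_cases k
    · exact (mul_eq_zero.1 (by linear_combination (z.1.2 j 1) * h1 - (z.1.2 i₀ 1) * h2 :
        z.1.1 j 0 * (z.1.2 i₀ 0 * z.1.2 j 1 - z.1.2 i₀ 1 * z.1.2 j 0) = 0)).resolve_right h3
    · exact (mul_eq_zero.1 (by linear_combination (z.1.2 i₀ 0) * h2 - (z.1.2 j 0) * h1 :
        z.1.1 j 1 * (z.1.2 i₀ 0 * z.1.2 j 1 - z.1.2 i₀ 1 * z.1.2 j 0) = 0)).resolve_right h3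

theorem coreComponent_subset (hpos : ∀ i, 0 < α i) (hgen : IsGeneric α) (hS : S.Nonempty)
    (hSc : Sᶜ.Nonempty) : coreComponent α S ⊆ coreSet α S :=
  closure_minimal (fun _ ⟨_, hy, hxy⟩ => mem_coreSet_of_flowsUpTo hpos hgen hS hSc hy hxy)
    (isClosed_coreSet hpos)

end Hyperpolygon

/-! ### Balancing a spatial polygon -/

namespace Hyperpolygon

open Filter Topology

section Balance

variable {ι κ : Type*} [Fintype ι] [Fintype κ]

/-- The length of the distinguished edge as a function of the scale of the planar polygon. -/
noncomputable def edgeLength (a g : ι → ℝ) (ρ : ℝ) : ℝ :=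
  ∑ i, Real.sqrt (a i ^ 2 + (ρ * g i) ^ 2)

theorem continuous_edgeLength (a g : ι → ℝ) : Continuous (edgeLength a g) := by
  unfold edgeLength; fun_prop

theorem edgeLength_zero {a g : ι → ℝ} (ha : ∀ i, 0 ≤ a i) : edgeLength a g 0 = ∑ i, a i := by
  unfold edgeLength
  exact Finset.sum_congr rfl fun i _ => by
    rw [zero_mul, zero_pow two_ne_zero, add_zero, Real.sqrt_sq (ha i)]

theorem edgeLength_mono (a g : ι → ℝ) {ρ ρ' : ℝ} (h0 : 0 ≤ ρ) (h : ρ ≤ ρ') :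
    edgeLength a g ρ ≤ edgeLength a g ρ' := by
  refine Finset.sum_le_sum fun i _ => Real.sqrt_le_sqrt ?_
  rw [mul_pow, mul_pow]
  gcongr

theorem edgeLength_strictMono {a g : ι → ℝ} (hg : ∃ i, g i ≠ 0) {ρ ρ' : ℝ} (h0 : 0 ≤ ρ)
    (h : ρ < ρ') : edgeLength a g ρ < edgeLength a g ρ' := by
  obtain ⟨i, hi⟩ := hg
  refine Finset.sum_lt_sum (fun i _ => Real.sqrt_le_sqrt ?_) ⟨i, Finset.mem_univ i,
    Real.sqrt_lt_sqrt (by positivity) ?_⟩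
  · rw [mul_pow, mul_pow]; gcongr
  · rw [mul_pow, mul_pow]
    have : 0 < g i ^ 2 := by positivity
    gcongr

theorem mul_le_edgeLength {a g : ι → ℝ} {ρ : ℝ} (i : ι) : ρ * g i ≤ edgeLength a g ρ := by
  refine le_trans ?_ (Finset.single_le_sum (f := fun i => Real.sqrt (a i ^ 2 + (ρ * g i) ^ 2))
    (fun i _ => Real.sqrt_nonneg _) (Finset.mem_univ i))
  exact Real.le_sqrt_of_sq_le (by nlinarith [sq_nonneg (a i)])

theorem tendsto_edgeLength_atTop {a g : ι → ℝ} (hg0 : ∀ i, 0 ≤ g i) (hg : ∃ i, g i ≠ 0) :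
    Tendsto (edgeLength a g) atTop atTop := by
  obtain ⟨i, hi⟩ := hg
  exact tendsto_atTop_mono (fun ρ => mul_le_edgeLength (a := a) i)
    (tendsto_id.atTop_mul_const ((hg0 i).lt_of_ne' hi))

/-- A function with monotone derivative lies above its tangents. -/
theorem tangent_le {k k' : ℝ → ℝ} (hk : ∀ x, HasDerivAt k (k' x) x) (hmono : Monotone k')
    (x y : ℝ) : k x + k' x * (y - x) ≤ k y := by
  rcases lt_trichotomy x y with h | h | h
  · obtain ⟨c, hc, hc'⟩ := exists_hasDerivAt_eq_slope k k' h
      (fun z _ => (hk z).continuousAt.continuousWithinAt) fun z _ => hk z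
    have h1 := hmono hc.1.le
    rw [hc', le_div_iff₀ (sub_pos.2 h)] at h1
    linarith
  · simp [h]
  · obtain ⟨c, hc, hc'⟩ := exists_hasDerivAt_eq_slope k k' h
      (fun z _ => (hk z).continuousAt.continuousWithinAt) fun z _ => hk z
    have h1 := hmono hc.2.le
    rw [hc', div_le_iff₀ (sub_pos.2 h)] at h1
    linarith

/-- The function whose critical points balance the spatial polygon against the planar one. -/
noncomputable def balanceFun (a g : ι → ℝ) (b : κ → ℝ) (ζ : κ → ℂ) (x : ℝ × ℂ) : ℝ :=
  ∑ j, b j * Real.log (1 + ‖(Real.exp x.1 : ℂ) * ζ j + x.2‖ ^ 2) +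
    ((∫ τ in (0 : ℝ)..x.1, edgeLength a g (Real.exp τ)) - (∑ j, b j) * x.1)

theorem hasDerivAt_integral_edgeLength (a g : ι → ℝ) (B σ : ℝ) :
    HasDerivAt (fun σ => (∫ τ in (0 : ℝ)..σ, edgeLength a g (Real.exp τ)) - B * σ)
      (edgeLength a g (Real.exp σ) - B) σ := by
  have hc : Continuous fun τ => edgeLength a g (Real.exp τ) :=
    (continuous_edgeLength a g).comp Real.continuous_exp
  have h1 := intervalIntegral.integral_hasDerivAt_right (hc.intervalIntegrable 0 σ)
    hc.stronglyMeasurable.stronglyMeasurableAtFilter hc.continuousAt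
  have h2 := h1.sub ((hasDerivAt_id σ).const_mul B)
  rw [mul_one] at h2
  exact h2

theorem continuous_balanceFun (a g : ι → ℝ) (b : κ → ℝ) (ζ : κ → ℂ) :
    Continuous (balanceFun a g b ζ) := by
  unfold balanceFun
  have h1 : Continuous fun σ => (∫ τ in (0 : ℝ)..σ, edgeLength a g (Real.exp τ))
      - (∑ j, b j) * σ :=
    continuous_iff_continuousAt.2 fun σ =>
      (hasDerivAt_integral_edgeLength a g _ σ).continuousAt
  refine Continuous.add ?_ (h1.comp continuous_fst)
  refine continuous_finsetSum _ fun j _ => continuous_const.mul (Continuous.log ?_ fun x => ?_)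
  · fun_prop
  · positivity

/-- Coercivity: the part `k` of the function that depends on `σ` alone is convex. Its slope is
negative far to the left because `∑ a < ∑ b`, and positive far to the right because some `g_i ≠ 0`.
Sublevel sets thus have bounded `σ`, and one logarithmic term then bounds `c`. -/
theorem exists_min_balanceFun {a g : ι → ℝ} {b : κ → ℝ} (ζ : κ → ℂ) (ha : ∀ i, 0 ≤ a i)
    (hg0 : ∀ i, 0 ≤ g i) (hg : ∃ i, g i ≠ 0) (hb : ∀ j, 0 < b j) (hab : ∑ i, a i < ∑ j, b j) :
    ∃ x, ∀ y, balanceFun a g b ζ x ≤ balanceFun a g b ζ y := by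
  set B := ∑ j, b j with hB
  set k : ℝ → ℝ := fun σ => (∫ τ in (0 : ℝ)..σ, edgeLength a g (Real.exp τ)) - B * σ with hkdef
  have hk : ∀ σ, HasDerivAt k (edgeLength a g (Real.exp σ) - B) σ :=
    hasDerivAt_integral_edgeLength a g B
  have hmono : Monotone fun σ => edgeLength a g (Real.exp σ) - B := fun x y h =>
    sub_le_sub_right (edgeLength_mono a g (Real.exp_pos _).le (Real.exp_le_exp.2 h)) B
  have htan := tangent_le hk hmono
  obtain ⟨τ₀, h0⟩ : ∃ τ, edgeLength a g (Real.exp τ) < B := by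
    have h := ((continuous_edgeLength a g).tendsto 0).comp Real.tendsto_exp_atBot
    rw [edgeLength_zero ha] at h
    exact (h.eventually_lt_const hab).exists
  obtain ⟨τ₁, h1⟩ : ∃ τ, B < edgeLength a g (Real.exp τ) :=
    (((tendsto_edgeLength_atTop (a := a) hg0 hg).comp
      Real.tendsto_exp_atTop).eventually_gt_atTop B).exists
  have hκ : Nonempty κ := by
    by_contra h
    rw [not_nonempty_iff] at h
    have := Finset.sum_nonneg fun i (_ : i ∈ Finset.univ) => ha i
    simp [hB] at hab
    linarith
  obtain ⟨j₀⟩ := hκ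
  set C := balanceFun a g b ζ 0
  -- The tangents to `k` at `τ₀` and `τ₁` reach height `C` at `L` and `U`, so `k σ < C` confines `σ`
  -- between them. The first tangent, evaluated at `U`, gives the lower bound `m` for `k`, and `E`
  -- bounds the argument of the logarithmic term of `j₀`.
  set L := τ₀ - (C - k τ₀) / (B - edgeLength a g (Real.exp τ₀)) with hL
  set U := τ₁ + (C - k τ₁) / (edgeLength a g (Real.exp τ₁) - B) with hU
  set m := k τ₀ + (edgeLength a g (Real.exp τ₀) - B) * (U - τ₀) with hm
  set E := Real.exp ((C - m) / b j₀) with hE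
  have hbound : ∀ x : ℝ × ℂ, balanceFun a g b ζ x < C →
      ‖x‖ ≤ max (max |L| |U|) (E + Real.exp U * ‖ζ j₀‖) := by
    rintro ⟨σ, c⟩ hx
    have hterm : ∀ j, 0 ≤ b j * Real.log (1 + ‖(Real.exp σ : ℂ) * ζ j + c‖ ^ 2) := fun j =>
      mul_nonneg (hb j).le (Real.log_nonneg (by nlinarith [sq_nonneg ‖(Real.exp σ : ℂ) * ζ j + c‖]))
    have hx' : ∑ j, b j * Real.log (1 + ‖(Real.exp σ : ℂ) * ζ j + c‖ ^ 2) + k σ < C := hx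
    have hs := Finset.sum_nonneg fun j (_ : j ∈ Finset.univ) => hterm j
    have hσL : L ≤ σ := by
      have := htan τ₀ σ
      rw [hL, sub_le_iff_le_add, ← sub_le_iff_le_add', le_div_iff₀ (by linarith)]
      linarith
    have hσU : σ ≤ U := by
      have := htan τ₁ σ
      rw [hU, ← sub_le_iff_le_add', le_div_iff₀ (by linarith)]
      linarith
    have hσm : m ≤ k σ := by
      refine le_trans ?_ (htan τ₀ σ)
      have := mul_le_mul_of_nonpos_left hσU (by linarith : edgeLength a g (Real.exp τ₀) - B ≤ 0)
      rw [hm]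
      linarith
    refine max_le_max ?_ ?_
    · exact abs_le_max_abs_abs hσL hσU
    · have h2 := Finset.single_le_sum (fun j _ => hterm j) (Finset.mem_univ j₀)
      have h3 : Real.log (1 + ‖(Real.exp σ : ℂ) * ζ j₀ + c‖ ^ 2) ≤ (C - m) / b j₀ := by
        rw [le_div_iff₀ (hb j₀)]; linarith
      rw [Real.log_le_iff_le_exp (by positivity)] at h3
      have h4 : ‖(Real.exp σ : ℂ) * ζ j₀ + c‖ ≤ E := by
        nlinarith [sq_nonneg (‖(Real.exp σ : ℂ) * ζ j₀ + c‖ - 1)]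
      have h5 : ‖(Real.exp σ : ℂ) * ζ j₀‖ ≤ Real.exp U * ‖ζ j₀‖ := by
        rw [norm_mul, Complex.norm_real, Real.norm_of_nonneg (Real.exp_pos _).le]
        gcongr
      have h6 := norm_sub_le ((Real.exp σ : ℂ) * ζ j₀ + c) ((Real.exp σ : ℂ) * ζ j₀)
      rw [add_sub_cancel_left] at h6
      exact h6.trans (add_le_add h4 h5)
  refine (continuous_balanceFun a g b ζ).exists_forall_le' 0 ?_
  filter_upwards [(isCompact_closedBall (0 : ℝ × ℂ)
    (max (max |L| |U|) (E + Real.exp U * ‖ζ j₀‖))).compl_mem_cocompact] with x hx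
  by_contra! h
  exact hx (mem_closedBall_zero_iff.2 (hbound x h))

/-- The spatial polygon with stereographic coordinates `A` closes up with a last edge of the length given by the weights. -/
structure IsBalanced (a g : ι → ℝ) (b : κ → ℝ) (ρ : ℝ) (A : κ → ℂ) : Prop where
  horizontal : ∑ j, (b j / (1 + ‖A j‖ ^ 2)) • A j = 0
  vertical : edgeLength a g ρ = ∑ j, b j * (1 - ‖A j‖ ^ 2) / (1 + ‖A j‖ ^ 2)

/-- At a minimum of `balanceFun`, the derivative in `c` is the horizontal equation. The derivative
in `σ` becomes the vertical equation once the horizontal one removes the terms `⟨A_j, c⟩`. -/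
theorem exists_isBalanced {a g : ι → ℝ} {b : κ → ℝ} (ζ : κ → ℂ) (ha : ∀ i, 0 ≤ a i)
    (hg0 : ∀ i, 0 ≤ g i) (hg : ∃ i, g i ≠ 0) (hb : ∀ j, 0 < b j) (hab : ∑ i, a i < ∑ j, b j) :
    ∃ (r : ℝ) (c : ℂ), 0 < r ∧ IsBalanced a g b r fun j => r * ζ j + c := by
  obtain ⟨⟨σ, c⟩, hmin⟩ := exists_min_balanceFun ζ ha hg0 hg hb hab
  set A : κ → ℂ := fun j => (Real.exp σ : ℂ) * ζ j + c with hA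
  have hpos : ∀ j, 1 + ‖A j‖ ^ 2 ≠ 0 := fun j => by positivity
  have hlog : ∀ (f : κ → ℝ → ℂ) (f' : κ → ℂ) (s : ℝ), (∀ j, HasDerivAt (f j) (f' j) s) →
      (∀ j, f j s = A j) → HasDerivAt (fun s => ∑ j, b j * Real.log (1 + ‖f j s‖ ^ 2))
        (∑ j, b j * (2 * inner ℝ (A j) (f' j) / (1 + ‖A j‖ ^ 2))) s := by
    intro f f' s hf hfA
    refine HasDerivAt.fun_sum fun j _ => HasDerivAt.const_mul _ ?_
    have h := ((hf j).norm_sq.const_add 1).log (by rw [hfA]; exact hpos j)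
    rwa [hfA] at h
  have hhor : ∑ j, (b j / (1 + ‖A j‖ ^ 2)) • A j = 0 := by
    apply ext_inner_right ℝ
    intro v
    have hd := (hlog (fun j s => (Real.exp σ : ℂ) * ζ j + (c + (s : ℝ) • v)) (fun _ => v) 0
      (fun j => by
        have h := (((hasDerivAt_id (0 : ℝ)).smul_const v).const_add c).const_add
          ((Real.exp σ : ℂ) * ζ j)
        simpa using h) (fun j => by simp [hA])).add_const
          ((∫ τ in (0 : ℝ)..σ, edgeLength a g (Real.exp τ)) - (∑ j, b j) * σ)
    have hz := IsLocalMin.hasDerivAt_eq_zero (Filter.Eventually.of_forall fun s => by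
      have h := hmin (σ, c + (s : ℝ) • v)
      simpa [balanceFun] using h) hd
    rw [inner_zero_left, sum_inner]
    have h2 : (2 : ℝ) * ∑ j, inner ℝ ((b j / (1 + ‖A j‖ ^ 2)) • A j) v = 0 := by
      rw [← hz, Finset.mul_sum]
      refine Finset.sum_congr rfl fun j _ => ?_
      rw [real_inner_smul_left]; ring
    linarith
  refine ⟨Real.exp σ, c, Real.exp_pos σ, hhor, ?_⟩
  have hd := (hlog (fun j s => (Real.exp s : ℂ) * ζ j + c)
    (fun j => (Real.exp σ : ℂ) * ζ j) σ (fun j => by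
      have h := ((Real.hasDerivAt_exp σ).ofReal_comp.mul_const (ζ j)).add_const c
      exact h) (fun j => rfl)).add (hasDerivAt_integral_edgeLength a g (∑ j, b j) σ)
  have hz := IsLocalMin.hasDerivAt_eq_zero (Filter.Eventually.of_forall fun s =>
    hmin (s, c)) hd
  have hc : ∑ j, b j / (1 + ‖A j‖ ^ 2) * inner ℝ (A j) c = 0 := by
    have h := congrArg (fun x => inner ℝ x c) hhor
    simp only [sum_inner, inner_zero_left] at h
    rw [← h]
    exact Finset.sum_congr rfl fun j _ => by rw [real_inner_smul_left]
  have h3 : edgeLength a g (Real.exp σ) = ∑ j, b j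
      - ∑ j, b j * (2 * inner ℝ (A j) ((Real.exp σ : ℂ) * ζ j) / (1 + ‖A j‖ ^ 2))
      - 2 * ∑ j, b j / (1 + ‖A j‖ ^ 2) * inner ℝ (A j) c := by
    rw [hc]; linarith
  rw [h3, Finset.mul_sum, ← Finset.sum_sub_distrib, ← Finset.sum_sub_distrib]
  refine Finset.sum_congr rfl fun j _ => ?_
  have h4 : ‖A j‖ ^ 2 = inner ℝ (A j) ((Real.exp σ : ℂ) * ζ j) + inner ℝ (A j) c := by
    rw [← inner_add_right, ← real_inner_self_eq_norm_sq]
  have h5 := hpos j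
  change _ = b j * (1 - ‖A j‖ ^ 2) / (1 + ‖A j‖ ^ 2)
  field_simp
  linear_combination 2 * b j * h4

/-- A balanced configuration is bounded by the spread of its points. -/
theorem IsBalanced.norm_translation_le [Nonempty κ] {a g : ι → ℝ} {b : κ → ℝ} {ρ : ℝ} {r c : ℂ}
    {ζ : κ → ℂ} (hb : ∀ j, 0 < b j) (h : IsBalanced a g b ρ fun j => r * ζ j + c) :
    ‖c‖ ≤ ‖r‖ * ∑ j, ‖ζ j‖ := by
  -- If `c` dominated every `r ζ_j`, all points would lie in an open half plane, and no positive
  -- combination of them could vanish.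
  by_contra! hlt
  have hZ : ∀ j, ‖ζ j‖ ≤ ∑ j, ‖ζ j‖ := fun j =>
    Finset.single_le_sum (fun j _ => norm_nonneg (ζ j)) (Finset.mem_univ j)
  have hc0 : 0 < ‖c‖ := lt_of_le_of_lt (by positivity) hlt
  have h1 := congrArg (fun x => inner ℝ x c) h.horizontal
  simp only [sum_inner, inner_zero_left] at h1
  have h2 : 0 < ∑ j, inner ℝ ((b j / (1 + ‖r * ζ j + c‖ ^ 2)) • (r * ζ j + c)) c := by
    refine Finset.sum_pos (fun j _ => ?_) Finset.univ_nonempty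
    rw [real_inner_smul_left]
    refine mul_pos (div_pos (hb j) (by positivity)) ?_
    rw [inner_add_left, real_inner_self_eq_norm_sq]
    have h3 := abs_le.1 (abs_real_inner_le_norm (r * ζ j) c)
    have h4 : ‖r * ζ j‖ ≤ ‖r‖ * ∑ j, ‖ζ j‖ := by
      rw [norm_mul]; exact mul_le_mul_of_nonneg_left (hZ j) (norm_nonneg _)
    nlinarith [h3.1]
  exact h2.ne' h1

end Balance

end Hyperpolygon

/-! ### Points that flow up to the fixed component -/

namespace Hyperpolygon

open scoped Matrix
open Matrix (vecMulVec)
open Complex (normSq)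
open Filter Topology

variable {n : ℕ} {α : Fin n → ℝ} {S : Finset (Fin n)}

/-- Vectors in `ℂ²` of prescribed length with prescribed affine coordinate. -/
noncomputable def affineVec (α : Fin n → ℝ) (ζ : Fin n → ℂ) (j : Fin n) : Fin 2 → ℂ :=
  ((Real.sqrt (2 * α j / (1 + ‖ζ j‖ ^ 2)) : ℝ) : ℂ) • ![ζ j, 1]

theorem sqrt_affine_sq (hpos : ∀ i, 0 < α i) (ζ : Fin n → ℂ) (j : Fin n) :
    Real.sqrt (2 * α j / (1 + ‖ζ j‖ ^ 2)) ^ 2 = 2 * α j / (1 + ‖ζ j‖ ^ 2) :=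
  Real.sq_sqrt (by have := hpos j; positivity)

theorem sqrt_affine_pos (hpos : ∀ i, 0 < α i) (ζ : Fin n → ℂ) (j : Fin n) :
    0 < Real.sqrt (2 * α j / (1 + ‖ζ j‖ ^ 2)) :=
  Real.sqrt_pos.2 (by have := hpos j; positivity)

theorem sqNorm_affineVec (hpos : ∀ i, 0 < α i) (ζ : Fin n → ℂ) (j : Fin n) :
    sqNorm (affineVec α ζ j) = 2 * α j := by
  have h : (1 + ‖ζ j‖ ^ 2) ≠ 0 := by positivity
  rw [affineVec, sqNorm_smul, Complex.norm_real, Real.norm_eq_abs, sq_abs, sqrt_affine_sq hpos,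
    sqNorm_eq]
  simp
  field_simp
  ring

theorem hopf_affineVec (hpos : ∀ i, 0 < α i) (ζ : Fin n → ℂ) (j : Fin n) :
    hopf (affineVec α ζ j) = !₂[2 * (α j / (1 + ‖ζ j‖ ^ 2) * (ζ j).re),
      2 * (α j / (1 + ‖ζ j‖ ^ 2) * (ζ j).im), -(α j * (1 - ‖ζ j‖ ^ 2) / (1 + ‖ζ j‖ ^ 2))] := by
  have h : (1 + ‖ζ j‖ ^ 2) ≠ 0 := by positivity
  have hs := sqrt_affine_sq hpos ζ j
  have h0 := (sqrt_affine_pos hpos ζ j).le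
  apply E3.ext
  · rw [hopf_zero']
    simp only [affineVec]
    generalize Real.sqrt (2 * α j / (1 + ‖ζ j‖ ^ 2)) = s at *
    simp
    linear_combination (ζ j).re * hs
  · rw [hopf_one']
    simp only [affineVec]
    generalize Real.sqrt (2 * α j / (1 + ‖ζ j‖ ^ 2)) = s at *
    simp
    linear_combination (ζ j).im * hs
  · rw [hopf_two']
    simp only [affineVec]
    generalize Real.sqrt (2 * α j / (1 + ‖ζ j‖ ^ 2)) = s at *
    simp only [Pi.smul_apply, smul_eq_mul, norm_mul, mul_pow, Complex.norm_real, Real.norm_eq_abs,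
      sq_abs, Matrix.cons_val, norm_one, hs]
    field_simp
    ring

/-- The normal configuration with planar polygon `ρ γ` and stereographic coordinates `ζ` is in the
level set when it is balanced. -/
theorem isCore_affine (hpos : ∀ i, 0 < α i) {γ ζ : Fin n → ℂ} {ρ : ℝ}
    (hγ : ∑ i : S, γ i = 0)
    (hb : IsBalanced (fun i : S => α i) (fun i : S => ‖γ i‖)
      (fun j : (Sᶜ : Finset (Fin n)) => α j) ρ fun j => ζ j) :
    IsCore α S (normalForm α S (fun i => ρ * γ i) (affineVec α ζ)) := by
  refine isCore_normalForm hpos ?_ (fun j _ => sqNorm_affineVec hpos ζ j) ?_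
  · rw [← Finset.mul_sum, hγ, mul_zero]
  · have h1 := hb.horizontal
    have h2 := hb.vertical
    have hre := congrArg Complex.re h1
    have him := congrArg Complex.im h1
    rw [Complex.re_sum] at hre
    rw [Complex.im_sum] at him
    simp only [Complex.smul_re, Complex.smul_im, smul_eq_mul, Complex.zero_re,
      Complex.zero_im] at hre him
    have h3 : ∑ i : S, Real.sqrt (α i ^ 2 + ‖(ρ : ℂ) * γ i‖ ^ 2)
        = ∑ j : (Sᶜ : Finset (Fin n)), α j * (1 - ‖ζ j‖ ^ 2) / (1 + ‖ζ j‖ ^ 2) := by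
      rw [← h2, edgeLength]
      refine Finset.sum_congr rfl fun i _ => ?_
      rw [norm_mul, Complex.norm_real, Real.norm_eq_abs, mul_pow, sq_abs, mul_pow]
    simp only [hopf_affineVec hpos]
    apply E3.ext
    · simp only [PiLp.add_apply, WithLp.ofLp_sum, Finset.sum_apply, PiLp.zero_apply,
        Matrix.cons_val]
      rw [← Finset.mul_sum, hre, mul_zero, add_zero]
    · simp only [PiLp.add_apply, WithLp.ofLp_sum, Finset.sum_apply, PiLp.zero_apply,
        Matrix.cons_val]
      rw [← Finset.mul_sum, him, mul_zero, add_zero]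
    · simp only [PiLp.add_apply, WithLp.ofLp_sum, Finset.sum_apply, PiLp.zero_apply,
        Matrix.cons_val]
      rw [h3, Finset.sum_neg_distrib, add_neg_cancel]

/-- Rescaling the planar polygon and moving the stereographic coordinates by an affine map amounts
to the action of an element of `G`. -/
theorem exists_act_eq_affine (hpos : ∀ i, 0 < α i) (γ ζ : Fin n → ℂ) {t r : ℂ} (hr : r ≠ 0)
    (c : ℂ) : ∃ (A : Matrix.SpecialLinearGroup (Fin 2) ℂ) (e : Fin n → ℂˣ),
      normalForm α S (fun i => t * r * γ i) (affineVec α fun j => r * ζ j + c)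
        = act A e (t • (normalForm α S γ (affineVec α ζ)).1,
          (normalForm α S γ (affineVec α ζ)).2) := by
  -- With `s² = r` and the matrix `A` below, `A⁻¹` sends `(ζ, 1)` to `s⁻¹ (r ζ + c, 1)` and `(x, 0)`
  -- to `(s x, 0)`. The torus element `e` corrects the lengths and the remaining factors of `s`.
  obtain ⟨s, hs⟩ := IsAlgClosed.exists_pow_nat_eq r two_pos
  have hs0 : s ≠ 0 := by rintro rfl; exact hr (by rw [← hs]; simp)
  set ζ' : Fin n → ℂ := fun j => r * ζ j + c with hζ'
  have hR : ∀ j, ((Real.sqrt (2 * α j / (1 + ‖ζ j‖ ^ 2)) : ℝ) : ℂ) ≠ 0 := fun j => by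
    exact_mod_cast (sqrt_affine_pos hpos ζ j).ne'
  have hR' : ∀ j, ((Real.sqrt (2 * α j / (1 + ‖ζ' j‖ ^ 2)) : ℝ) : ℂ) ≠ 0 := fun j => by
    exact_mod_cast (sqrt_affine_pos hpos ζ' j).ne'
  have hx : ∀ i, (sndRadius (α i) ‖γ i‖ : ℂ) ≠ 0 := fun i => by
    exact_mod_cast (sndRadius_pos (hpos i) _).ne'
  have hx' : ∀ i, (sndRadius (α i) ‖t * r * γ i‖ : ℂ) ≠ 0 := fun i => by
    exact_mod_cast (sndRadius_pos (hpos i) _).ne'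
  let e : Fin n → ℂˣ := fun i => if i ∈ S then
      Units.mk0 ((sndRadius (α i) ‖t * r * γ i‖ : ℂ) / (s * (sndRadius (α i) ‖γ i‖ : ℂ)))
        (div_ne_zero (hx' i) (mul_ne_zero hs0 (hx i)))
    else Units.mk0 (s * ((Real.sqrt (2 * α i / (1 + ‖ζ' i‖ ^ 2)) : ℝ) : ℂ)
      / ((Real.sqrt (2 * α i / (1 + ‖ζ i‖ ^ 2)) : ℝ) : ℂ))
        (div_ne_zero (mul_ne_zero hs0 (hR' i)) (hR i))
  obtain ⟨A, hA⟩ : ∃ A : Matrix.SpecialLinearGroup (Fin 2) ℂ, A.1 = !![s⁻¹, -(c / s); 0, s] :=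
    ⟨⟨_, by rw [Matrix.det_fin_two]; simp [hs0]⟩, rfl⟩
  refine ⟨A, e, Prod.ext (funext fun i => ?_) (funext fun i => ?_)⟩
  · by_cases hi : i ∈ S
    · have he : ((e i)⁻¹ : ℂˣ) = (s * (sndRadius (α i) ‖γ i‖ : ℂ))
          / (sndRadius (α i) ‖t * r * γ i‖ : ℂ) := by
        simp only [e, if_pos hi, Units.val_inv_eq_inv_val, Units.val_mk0, inv_div]
      have h1 := hx i
      have h2 := hx' i
      ext k
      rw [act_fst_apply, he, hA]
      simp only [Pi.smul_apply, normalForm_fst_of_mem hi]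
      generalize sndRadius (α i) ‖t * r * γ i‖ = x' at *
      fin_cases k
      · simp
      · simp
        field_simp
        linear_combination (-t * γ i) * hs
    · rw [normalForm_fst_of_notMem hi]
      ext k
      rw [act_fst_apply]
      simp [normalForm_fst_of_notMem hi]
  · by_cases hi : i ∈ S
    · have he : (e i : ℂ) = (sndRadius (α i) ‖t * r * γ i‖ : ℂ)
          / (s * (sndRadius (α i) ‖γ i‖ : ℂ)) := by
        simp only [e, if_pos hi, Units.val_mk0]
      have h1 := hx i
      ext k; fin_cases k
      · change _ = (act _ _ _).2 i 0
        rw [act_snd_zero, he, hA]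
        simp only [normalForm_snd_of_mem hi]
        simp
        field_simp
      · change _ = (act _ _ _).2 i 1
        rw [act_snd_one, he, hA]
        simp only [normalForm_snd_of_mem hi]
        simp
    · have he : (e i : ℂ) = s * ((Real.sqrt (2 * α i / (1 + ‖ζ' i‖ ^ 2)) : ℝ) : ℂ)
          / ((Real.sqrt (2 * α i / (1 + ‖ζ i‖ ^ 2)) : ℝ) : ℂ) := by
        simp only [e, if_neg hi, Units.val_mk0]
      have h1 := hR i
      ext k; fin_cases k
      · change _ = (act _ _ _).2 i 0
        rw [act_snd_zero, he, hA]
        simp only [normalForm_snd_of_notMem hi, affineVec]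
        have hζi : ζ' i = r * ζ i + c := rfl
        generalize Real.sqrt (2 * α i / (1 + ‖ζ' i‖ ^ 2)) = R' at *
        generalize Real.sqrt (2 * α i / (1 + ‖ζ i‖ ^ 2)) = R at *
        simp [hζi]
        field_simp
        linear_combination (-R' * ζ i) * hs
      · change _ = (act _ _ _).2 i 1
        rw [act_snd_one, he, hA]
        simp only [normalForm_snd_of_notMem hi, affineVec]
        generalize Real.sqrt (2 * α i / (1 + ‖ζ' i‖ ^ 2)) = R' at *
        generalize Real.sqrt (2 * α i / (1 + ‖ζ i‖ ^ 2)) = R at *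
        simp
        field_simp

theorem tendsto_normalForm_affine (hpos : ∀ i, 0 < α i) {β : Type*} {l : Filter β}
    {γ : β → Fin n → ℂ} {ζ : β → Fin n → ℂ} {γ₀ ζ₀ : Fin n → ℂ}
    (hγ : ∀ i ∈ S, Tendsto (fun b => γ b i) l (𝓝 (γ₀ i)))
    (hζ : ∀ j ∉ S, Tendsto (fun b => ζ b j) l (𝓝 (ζ₀ j))) :
    Tendsto (fun b => normalForm α S (γ b) (affineVec α (ζ b))) l
      (𝓝 (normalForm α S γ₀ (affineVec α ζ₀))) := by
  have hrad (i : Fin n) : Continuous fun g : ℂ => (sndRadius (α i) ‖g‖ : ℂ) := by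
    unfold sndRadius; fun_prop
  have hne (i : Fin n) (g : ℂ) : (sndRadius (α i) ‖g‖ : ℂ) ≠ 0 := by
    exact_mod_cast (sndRadius_pos (hpos i) _).ne'
  refine Prod.tendsto_iff _ _ |>.2 ⟨tendsto_pi_nhds.2 fun i => ?_, tendsto_pi_nhds.2 fun i => ?_⟩
  · by_cases hi : i ∈ S
    · simp only [normalForm_fst_of_mem hi]
      have hc : Continuous fun g : ℂ => ![0, g / (sndRadius (α i) ‖g‖ : ℂ)] := by
        refine continuous_pi fun k => ?_
        fin_cases k
        · exact continuous_const
        · exact continuous_id.div (hrad i) (hne i)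
      exact (hc.tendsto _).comp (hγ i hi)
    · simp only [normalForm_fst_of_notMem hi]
      exact tendsto_const_nhds
  · by_cases hi : i ∈ S
    · simp only [normalForm_snd_of_mem hi]
      have hc : Continuous fun g : ℂ => ![(sndRadius (α i) ‖g‖ : ℂ), 0] := by
        refine continuous_pi fun k => ?_
        fin_cases k
        · exact hrad i
        · exact continuous_const
      exact (hc.tendsto _).comp (hγ i hi)
    · simp only [normalForm_snd_of_notMem hi, affineVec]
      have hc : Continuous fun x : ℂ =>
          ((Real.sqrt (2 * α i / (1 + ‖x‖ ^ 2)) : ℝ) : ℂ) • ![x, 1] := by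
        have h1 : Continuous fun x : ℂ => ((Real.sqrt (2 * α i / (1 + ‖x‖ ^ 2)) : ℝ) : ℂ) := by
          refine Complex.continuous_ofReal.comp (Real.continuous_sqrt.comp ?_)
          exact continuous_const.div (by fun_prop) fun x => by positivity
        refine h1.smul (continuous_pi fun k => ?_)
        fin_cases k
        · exact continuous_id
        · exact continuous_const
      exact (hc.tendsto _).comp (hζ i hi)

/-- The modulus of `t` is absorbed into the planar lengths. Its phase is absorbed by rotating the
stereographic coordinates, which leaves the balance equations unchanged and makes `t r` real and
positive. -/
theorem exists_isBalanced_complex {ι κ : Type*} [Fintype ι] [Fintype κ] {a g : ι → ℝ} {b : κ → ℝ}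
    (ζ : κ → ℂ) (ha : ∀ i, 0 ≤ a i) (hg0 : ∀ i, 0 ≤ g i) (hg : ∃ i, g i ≠ 0) (hb : ∀ j, 0 < b j)
    (hab : ∑ i, a i < ∑ j, b j) {t : ℂ} (ht : t ≠ 0) :
    ∃ (ρ : ℝ) (r c : ℂ), 0 < ρ ∧ t * r = ρ ∧ IsBalanced a g b ρ fun j => r * ζ j + c := by
  have ht0 : 0 < ‖t‖ := norm_pos_iff.2 ht
  obtain ⟨r, c, hr, hbal⟩ := exists_isBalanced (g := fun i => ‖t‖ * g i) ζ ha
    (fun i => mul_nonneg (norm_nonneg _) (hg0 i))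
    (hg.imp fun i hi => mul_ne_zero ht0.ne' hi) hb hab
  set ω : ℂ := ‖t‖ / t with hω
  have hω1 : ‖ω‖ = 1 := by
    rw [hω, norm_div, Complex.norm_real, norm_norm, div_self ht0.ne']
  have hA : ∀ j, ω * r * ζ j + ω * c = ω * (r * ζ j + c) := fun j => by ring
  refine ⟨‖t‖ * r, ω * r, ω * c, by positivity, ?_, ?_, ?_⟩
  · rw [hω]
    push_cast
    field_simp
  · simp only [hA, norm_mul, hω1, one_mul]
    have h := congrArg (fun x => ω * x) hbal.horizontal
    simp only [mul_zero, Finset.mul_sum] at h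
    rw [← h]
    exact Finset.sum_congr rfl fun j _ => by rw [mul_smul_comm]
  · simp only [hA, norm_mul, hω1, one_mul]
    rw [← hbal.vertical, edgeLength, edgeLength]
    exact Finset.sum_congr rfl fun i _ => by congr 3; ring

/-- A normal point of the level set with nonzero planar polygon and finite stereographic
coordinates flows up to the fixed component. -/
theorem exists_flowsUpTo_affine (hpos : ∀ i, 0 < α i) (hshort : IsShort α S) {γ ζ : Fin n → ℂ}
    (hγ0 : ∃ i ∈ S, γ i ≠ 0) (hγ : ∑ i : S, γ i = 0)
    (hz : IsCore α S (normalForm α S γ (affineVec α ζ))) :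
    ∃ y ∈ fixedComponent α S,
      FlowsUpTo (X.mk (α := α) ⟨normalForm α S γ (affineVec α ζ), hz.level⟩) y := by
  set a : S → ℝ := fun i => α i with ha
  set g : S → ℝ := fun i => ‖γ i‖ with hgdef
  set b : (Sᶜ : Finset (Fin n)) → ℝ := fun j => α j with hb
  set B := ∑ j, b j with hB
  have ha0 : ∀ i, 0 ≤ a i := fun i => (hpos i).le
  have hg0 : ∀ i, 0 ≤ g i := fun i => norm_nonneg _
  obtain ⟨i₁, hi₁, hne₁⟩ := hγ0
  have hg : ∃ i, g i ≠ 0 := ⟨⟨i₁, hi₁⟩, norm_ne_zero_iff.2 hne₁⟩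
  have hb0 : ∀ j, 0 < b j := fun j => hpos j
  have hab : ∑ i, a i < ∑ j, b j := by
    have h := hshort
    rw [IsShort, ← Finset.sum_coe_sort S, ← Finset.sum_coe_sort Sᶜ] at h
    exact h
  have hne : Nonempty (Sᶜ : Finset (Fin n)) := by
    by_contra h
    rw [not_nonempty_iff] at h
    have := Finset.sum_nonneg fun i (_ : i ∈ Finset.univ) => ha0 i
    rw [Finset.univ_eq_empty (α := (Sᶜ : Finset (Fin n))), Finset.sum_empty] at hab
    linarith
  -- `ρ₀` is the scale of the planar polygon in the limit, where all `v_j` point straight down and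
  -- `w` attains the length `B`.
  obtain ⟨ρ₀, hρ₀, hρB⟩ : ∃ ρ, 0 ≤ ρ ∧ edgeLength a g ρ = B := by
    obtain ⟨M, hM, hM0⟩ := (((tendsto_edgeLength_atTop (a := a) hg0 hg).eventually_ge_atTop B).and
      (eventually_ge_atTop 0)).exists
    obtain ⟨ρ, hρ, h⟩ := intermediate_value_Icc hM0 (continuous_edgeLength a g).continuousOn
      ⟨by rw [edgeLength_zero ha0]; exact hab.le, hM⟩
    exact ⟨ρ, hρ.1, h⟩
  -- The values at `t = 0` are placeholders that make the choice total.
  have hbal : ∀ t : ℂ, ∃ (ρ : ℝ) (r c : ℂ), t ≠ 0 → (0 < ρ ∧ t * r = ρ ∧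
      IsBalanced a g b ρ fun j => r * ζ j + c) := fun t => by
    by_cases ht : t = 0
    · exact ⟨0, 0, 0, fun h => (h ht).elim⟩
    · obtain ⟨ρ, r, c, h⟩ := exists_isBalanced_complex
        (fun j : (Sᶜ : Finset (Fin n)) => ζ j) ha0 hg0 hg hb0 hab ht
      exact ⟨ρ, r, c, fun _ => h⟩
  choose ρ r c hbal using hbal
  have hcore : ∀ t : ℂ, t ≠ 0 → IsCore α S
      (normalForm α S (fun i => ρ t * γ i) (affineVec α fun j => r t * ζ j + c t)) :=
    fun t ht => isCore_affine hpos hγ (hbal t ht).2.2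
  have hcore0 : IsCore α S (normalForm α S (fun i => ρ₀ * γ i) (affineVec α fun _ => 0)) := by
    refine isCore_affine hpos hγ ⟨by simp, ?_⟩
    rw [hρB]
    simp [hB, hb]
  set y : X α := X.mk ⟨_, hcore0.level⟩ with hy
  have hyfix : y ∈ fixedComponent α S := by
    refine ⟨⟨_, hcore0.level⟩, rfl, hcore0.straight, fun i hi j hj => ?_, hcore0.fst_eq_zero⟩
    rw [normalForm_snd_of_notMem (Finset.mem_compl.1 hi),
      normalForm_snd_of_notMem (Finset.mem_compl.1 hj)]
    refine exists_smul_of_wedge_eq_zero (fun h => ?_) (by simp [wedge, affineVec])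
    have := sqNorm_affineVec hpos (fun _ => 0) j
    rw [h] at this
    simp [sqNorm, (hpos j).ne'] at this
  let F : ℂ → Level α := fun t => if ht : t ≠ 0 then ⟨_, (hcore t ht).level⟩ else
    ⟨_, hcore0.level⟩
  have hF : ∀ t : ℂ, t ≠ 0 → (F t).1
      = normalForm α S (fun i => ρ t * γ i) (affineVec α fun j => r t * ζ j + c t) :=
    fun t ht => by simp only [F, dif_pos ht]
  refine ⟨y, hyfix, fun t => X.mk (F t), fun t ht => ?_, ?_⟩
  · obtain ⟨hρ, hr, -⟩ := hbal t ht
    have hr0 : r t ≠ 0 := by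
      intro h
      rw [h, mul_zero] at hr
      exact hρ.ne (by exact_mod_cast hr)
    obtain ⟨A, e, h⟩ := exists_act_eq_affine (S := S) hpos γ ζ (t := t) hr0 (c t)
    rw [hr] at h
    exact ⟨_, _, rfl, rfl, A, e, (hF t ht).trans h⟩
  · set Z := ∑ j : (Sᶜ : Finset (Fin n)), ‖ζ j‖ with hZ
    have hne0 : ∀ᶠ t : ℂ in Bornology.cobounded ℂ, t ≠ 0 := by
      filter_upwards [tendsto_norm_cobounded_atTop.eventually_gt_atTop (0 : ℝ)] with t ht
      exact norm_pos_iff.1 ht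
    -- Each factor `(1 - x) / (1 + x)` with `x ≥ 0` is at most one. The resulting bound on `ρ t =
    -- ‖t‖ ‖r t‖` drives `r t` to zero.
    have hle : ∀ t : ℂ, t ≠ 0 → edgeLength a g (ρ t) ≤ B := by
      intro t ht
      rw [(hbal t ht).2.2.vertical]
      refine Finset.sum_le_sum fun j _ => ?_
      rw [div_le_iff₀ (by positivity)]
      nlinarith [mul_nonneg (hb0 j).le (sq_nonneg ‖r t * ζ j + c t‖)]
    have hrle : ∀ t : ℂ, t ≠ 0 → ‖r t‖ ≤ B / ‖γ i₁‖ * ‖t‖⁻¹ := by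
      intro t ht
      obtain ⟨hρ, hr, -⟩ := hbal t ht
      have h1 := (mul_le_edgeLength (a := a) (g := g) (ρ := ρ t) ⟨i₁, hi₁⟩).trans (hle t ht)
      have h2 : ‖t‖ * ‖r t‖ = ρ t := by
        rw [← norm_mul, hr, Complex.norm_real, Real.norm_of_nonneg hρ.le]
      have h3 : 0 < ‖t‖ := norm_pos_iff.2 ht
      have h4 : 0 < ‖γ i₁‖ := norm_pos_iff.2 hne₁
      rw [← h2] at h1
      rw [div_mul_eq_mul_div, ← div_eq_mul_inv, le_div_iff₀ h4, le_div_iff₀ h3]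
      simp only [hgdef] at h1
      linarith
    have hrlim : Tendsto (fun t => ‖r t‖) (Bornology.cobounded ℂ) (𝓝 0) := by
      have h1 : Tendsto (fun t : ℂ => B / ‖γ i₁‖ * ‖t‖⁻¹) (Bornology.cobounded ℂ)
          (𝓝 (B / ‖γ i₁‖ * 0)) :=
        (tendsto_inv_atTop_zero.comp tendsto_norm_cobounded_atTop).const_mul _
      rw [mul_zero] at h1
      refine squeeze_zero' (Eventually.of_forall fun t => norm_nonneg _) ?_ h1
      filter_upwards [hne0] with t ht using hrle t ht
    -- The translation is controlled by `r t`, so all stereographic coordinates collapse to zero,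
    -- the direction opposite to `w`.
    have hAlim : ∀ j ∉ S, Tendsto (fun t => r t * ζ j + c t) (Bornology.cobounded ℂ) (𝓝 0) := by
      intro j hj
      have h1 : Tendsto (fun t => ‖r t‖ * (2 * Z)) (Bornology.cobounded ℂ) (𝓝 (0 * (2 * Z))) :=
        hrlim.mul_const _
      rw [zero_mul] at h1
      refine squeeze_zero_norm' ?_ h1
      filter_upwards [hne0] with t ht
      have h2 := (hbal t ht).2.2.norm_translation_le hb0
      have h3 : ‖ζ j‖ ≤ Z := Finset.single_le_sum
        (f := fun j : (Sᶜ : Finset (Fin n)) => ‖ζ j‖) (fun j _ => norm_nonneg _)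
        (Finset.mem_univ (⟨j, Finset.mem_compl.2 hj⟩ : (Sᶜ : Finset (Fin n))))
      have h4 := norm_add_le (r t * ζ j) (c t)
      rw [norm_mul] at h4
      have h5 := mul_le_mul_of_nonneg_left h3 (norm_nonneg (r t))
      linarith
    have hGlim : Tendsto (fun t => edgeLength a g (ρ t)) (Bornology.cobounded ℂ) (𝓝 B) := by
      have h1 : Tendsto (fun t => ∑ j, b j * (1 - ‖r t * ζ j + c t‖ ^ 2)
          / (1 + ‖r t * ζ j + c t‖ ^ 2)) (Bornology.cobounded ℂ) (𝓝 B) := by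
        refine tendsto_finsetSum _ fun j _ => ?_
        have hc : Continuous fun x : ℂ => b j * (1 - ‖x‖ ^ 2) / (1 + ‖x‖ ^ 2) :=
          Continuous.div (by fun_prop) (by fun_prop) fun x => by positivity
        have h2 := (hc.tendsto 0).comp (hAlim j (Finset.mem_compl.1 j.2))
        rw [norm_zero, zero_pow two_ne_zero, sub_zero, add_zero, div_one, mul_one] at h2
        exact h2
      refine h1.congr' ?_
      filter_upwards [hne0] with t ht using (hbal t ht).2.2.vertical.symm
    -- The edge lengths converge, and strict monotonicity of `edgeLength` transfers this to the
    -- scales.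
    have hρlim : Tendsto ρ (Bornology.cobounded ℂ) (𝓝 ρ₀) := by
      refine tendsto_order.2 ⟨fun x hx => ?_, fun x hx => ?_⟩
      · by_cases hx0 : 0 ≤ x
        · have h1 := edgeLength_strictMono (a := a) hg hx0 hx
          rw [hρB] at h1
          filter_upwards [hne0, hGlim.eventually_const_lt h1] with t ht h2
          by_contra! h3
          exact absurd (edgeLength_mono a g (hbal t ht).1.le h3) (not_le.2 h2)
        · filter_upwards [hne0] with t ht
          exact (not_le.1 hx0).trans (hbal t ht).1
      · have h1 := edgeLength_strictMono (a := a) hg hρ₀ hx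
        rw [hρB] at h1
        filter_upwards [hGlim.eventually_lt_const h1] with t h2
        by_contra! h3
        exact absurd (edgeLength_mono a g (hρ₀.trans hx.le) h3) (not_le.2 h2)
    have hlim : Tendsto (fun t => normalForm α S (fun i => ρ t * γ i)
        (affineVec α fun j => r t * ζ j + c t)) (Bornology.cobounded ℂ)
        (𝓝 (normalForm α S (fun i => ρ₀ * γ i) (affineVec α fun _ => 0))) :=
      tendsto_normalForm_affine hpos
        (fun i _ => ((Complex.continuous_ofReal.tendsto _).comp hρlim).mul_const _) hAlim
    have hFlim : Tendsto F (Bornology.cobounded ℂ) (𝓝 ⟨_, hcore0.level⟩) := by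
      rw [tendsto_subtype_rng]
      refine hlim.congr' ?_
      filter_upwards [hne0] with t ht using (hF t ht).symm
    exact (X.isQuotientMap_mk.continuous.tendsto _).comp hFlim

end Hyperpolygon

/-! ### Perturbing spatial polygons -/

namespace Hyperpolygon

open scoped Matrix
open Matrix (vecMulVec)
open Filter Topology

variable {n : ℕ} {α : Fin n → ℝ} {S : Finset (Fin n)}

theorem norm_cos_smul_add_sin_smul {v g : E3} (hg : ‖g‖ = ‖v‖) (h : inner ℝ v g = 0) (θ : ℝ) :
    ‖Real.cos θ • v + Real.sin θ • g‖ = ‖v‖ := by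
  have h1 : ‖Real.cos θ • v + Real.sin θ • g‖ ^ 2 = ‖v‖ ^ 2 := by
    rw [norm_add_sq_real, real_inner_smul_left, real_inner_smul_right, h, norm_smul, norm_smul,
      mul_pow, mul_pow, hg, Real.norm_eq_abs, Real.norm_eq_abs, sq_abs, sq_abs]
    linear_combination ‖v‖ ^ 2 * Real.sin_sq_add_cos_sq θ
  exact (pow_left_inj₀ (norm_nonneg _) (norm_nonneg _) two_ne_zero).1 h1

theorem exists_perp_norm_eq (v : E3) : ∃ g : E3, ‖g‖ = ‖v‖ ∧ inner ℝ v g = 0 := by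
  obtain ⟨f, hf0, hf⟩ : ∃ f : E3, f ≠ 0 ∧ inner ℝ v f = 0 := by
    by_cases h : v 0 = 0 ∧ v 1 = 0
    · refine ⟨!₂[1, 0, 0], fun h0 => ?_, ?_⟩
      · have := congrArg (fun x : E3 => x 0) h0; simp at this
      · rw [PiLp.inner_apply, Fin.sum_univ_three]; simp [h]
    · refine ⟨!₂[-v 1, v 0, 0], fun h0 => h ⟨?_, ?_⟩, ?_⟩
      · simpa using congrArg (fun x : E3 => x 1) h0
      · simpa using congrArg (fun x : E3 => x 0) h0
      · rw [PiLp.inner_apply, Fin.sum_univ_three]; simp; ring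
  refine ⟨(‖v‖ / ‖f‖) • f, ?_, ?_⟩
  · rw [norm_smul, norm_div, norm_norm, norm_norm, div_mul_cancel₀ _ (norm_ne_zero_iff.2 hf0)]
  · rw [real_inner_smul_right, hf, mul_zero]

/-- The witness is a positive multiple of minus the component of `w` orthogonal to `v`; strict
Cauchy–Schwarz gives the sign. -/
theorem exists_perp_inner_neg {v w : E3} (h1 : ‖w‖ • v ≠ ‖v‖ • w) (h2 : ‖w‖ • v ≠ -(‖v‖ • w)) :
    ∃ g : E3, ‖g‖ = ‖v‖ ∧ inner ℝ v g = 0 ∧ inner ℝ g w < 0 := by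
  set f : E3 := inner ℝ v w • v - ‖v‖ ^ 2 • w with hf
  have hvf : inner ℝ v f = 0 := by
    rw [hf, inner_sub_right, real_inner_smul_right, real_inner_smul_right,
      real_inner_self_eq_norm_sq]
    ring
  have hlt : inner ℝ f w < 0 := by
    rw [hf, inner_sub_left, real_inner_smul_left, real_inner_smul_left,
      real_inner_self_eq_norm_sq]
    have ha := abs_real_inner_le_norm v w
    have hne : |inner ℝ v w| ≠ ‖v‖ * ‖w‖ := by
      intro h
      rcases abs_eq_abs.1 (h.trans (abs_of_nonneg (by positivity)).symm) with h | h
      · exact h1 (inner_eq_norm_mul_iff_real.1 h)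
      · have h3 : inner ℝ v (-w) = ‖v‖ * ‖-w‖ := by rw [inner_neg_right, norm_neg, h, neg_neg]
        have h4 := inner_eq_norm_mul_iff_real.1 h3
        rw [norm_neg, smul_neg] at h4
        exact h2 h4
    have hl := lt_of_le_of_ne ha hne
    have := abs_nonneg (inner ℝ v w : ℝ)
    have hsq : |inner ℝ v w| ^ 2 < (‖v‖ * ‖w‖) ^ 2 := by gcongr
    rw [sq_abs] at hsq
    nlinarith
  have hf0 : f ≠ 0 := by
    intro h0
    rw [h0, inner_zero_left] at hlt
    exact lt_irrefl _ hlt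
  have hv0 : v ≠ 0 := by
    rintro rfl
    exact h1 (by simp)
  refine ⟨(‖v‖ / ‖f‖) • f, ?_, ?_, ?_⟩
  · rw [norm_smul, norm_div, norm_norm, norm_norm, div_mul_cancel₀ _ (norm_ne_zero_iff.2 hf0)]
  · rw [real_inner_smul_right, hvf, mul_zero]
  · rw [real_inner_smul_left]
    exact mul_neg_of_pos_of_neg (div_pos (norm_pos_iff.2 hv0) (norm_pos_iff.2 hf0)) hlt

section perturb

variable {κ : Type*} [Fintype κ] {b : κ → ℝ}

/-- No edge of the polygon points in the direction of its closing edge. -/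
def NoParallel (b : κ → ℝ) (v : κ → E3) : Prop :=
  ∀ j, ‖-∑ k, v k‖ • v j ≠ b j • (-∑ k, v k)

theorem isOpen_noParallel (b : κ → ℝ) : IsOpen {v : κ → E3 | NoParallel b v} := by
  have h : {v : κ → E3 | NoParallel b v}
      = ⋂ j, {v | ‖-∑ k, v k‖ • v j ≠ b j • (-∑ k, v k)} := by
    ext v; simp [NoParallel]
  rw [h]
  exact isOpen_iInter_of_finite fun j => isOpen_ne_fun (by fun_prop) (by fun_prop)

theorem eventually_sin_pos : ∀ᶠ θ : ℝ in 𝓝[>] 0, 0 < Real.sin θ := by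
  filter_upwards [Ioo_mem_nhdsGT Real.pi_pos] with θ hθ using Real.sin_pos_of_mem_Ioo hθ

open Classical in
/-- Tilting the edges that point in the direction of the closing edge. -/
theorem mem_closure_noParallel {a : ℝ} {v : κ → E3} (hb : ∀ j, 0 < b j)
    (hv : ∀ j, ‖v j‖ = b j) (ha0 : 0 < a) (ha : a ≤ ‖-∑ k, v k‖) :
    v ∈ closure {v' | (∀ j, ‖v' j‖ = b j) ∧ a ≤ ‖-∑ k, v' k‖ ∧ NoParallel b v'} := by
  set w := -∑ k, v k with hw
  have hw0 : 0 < ‖w‖ := ha0.trans_le ha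
  obtain ⟨e, he, hwe⟩ := exists_perp_norm_eq w
  let bad : κ → Prop := fun j => ‖w‖ • v j = b j • w
  -- All bad edges are tilted towards `e` by one angle. The new closing edge is no shorter and does
  -- not lean towards `e`, so none of the tilted edges points along it.
  let V : ℝ → κ → E3 := fun θ j =>
    if bad j then (b j / ‖w‖) • (Real.cos θ • w + Real.sin θ • e) else v j
  set β : ℝ := ∑ j, if bad j then b j / ‖w‖ else 0 with hβ
  have hβ0 : 0 ≤ β := Finset.sum_nonneg fun j _ => by
    split_ifs
    · exact div_nonneg (hb j).le hw0.le
    · exact le_rfl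
  have hvbad : ∀ j, bad j → v j = (b j / ‖w‖) • w := fun j hj => by
    rw [div_eq_inv_mul, mul_smul, ← show ‖w‖ • v j = b j • w from hj, smul_smul,
      inv_mul_cancel₀ hw0.ne', one_smul]
  have hV0 : V 0 = v := by
    funext j
    by_cases hj : bad j
    · simp only [V, if_pos hj, Real.cos_zero, Real.sin_zero, one_smul, zero_smul, add_zero]
      exact (hvbad j hj).symm
    · simp only [V, if_neg hj]
  have hVc : Continuous V := by
    refine continuous_pi fun j => ?_
    by_cases hj : bad j
    · simp only [V, if_pos hj]; fun_prop
    · simp only [V, if_neg hj]; fun_prop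
  have hlim : Tendsto V (𝓝[>] 0) (𝓝 v) := by
    have := hVc.tendsto 0
    rw [hV0] at this
    exact this.mono_left nhdsWithin_le_nhds
  have hsum : ∀ θ, -∑ k, V θ k
      = (1 + β * (1 - Real.cos θ)) • w + (-(β * Real.sin θ)) • e := by
    intro θ
    have h1 : ∀ k, V θ k = v k + (if bad k then b k / ‖w‖ else 0) •
        ((Real.cos θ - 1) • w + Real.sin θ • e) := by
      intro k
      by_cases hk : bad k
      · simp only [V, if_pos hk]
        rw [hvbad k hk]
        module
      · simp only [V, if_neg hk, zero_smul, add_zero]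
    rw [Finset.sum_congr rfl fun k _ => h1 k, Finset.sum_add_distrib, ← Finset.sum_smul, ← hβ,
      neg_add, ← hw]
    module
  have hew : inner ℝ e w = 0 := by rw [real_inner_comm]; exact hwe
  have hnorm : ∀ θ, ‖w‖ ≤ ‖-∑ k, V θ k‖ := by
    intro θ
    have h1 : inner ℝ (-∑ k, V θ k) w = (1 + β * (1 - Real.cos θ)) * ‖w‖ ^ 2 := by
      rw [hsum, inner_add_left, real_inner_smul_left, real_inner_smul_left,
        real_inner_self_eq_norm_sq, hew]
      ring
    have h2 := real_inner_le_norm (-∑ k, V θ k) w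
    rw [h1] at h2
    have h3 : 0 ≤ β * (1 - Real.cos θ) := mul_nonneg hβ0 (by linarith [Real.cos_le_one θ])
    nlinarith [mul_nonneg h3 (sq_nonneg ‖w‖)]
  refine mem_closure_of_tendsto hlim ?_
  -- Edges that were not parallel stay so for small angles, since this is an open condition.
  have hgood : ∀ᶠ θ in 𝓝[>] (0 : ℝ), ∀ j, ¬ bad j →
      ‖-∑ k, V θ k‖ • V θ j ≠ b j • (-∑ k, V θ k) := by
    rw [eventually_all]
    intro j
    by_cases hj : bad j
    · exact Eventually.of_forall fun θ h => (h hj).elim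
    · have h1 : IsOpen {v' : κ → E3 | ‖-∑ k, v' k‖ • v' j ≠ b j • (-∑ k, v' k)} :=
        isOpen_ne_fun (by fun_prop) (by fun_prop)
      filter_upwards [hlim.eventually (h1.mem_nhds hj)] with θ hθ _ using hθ
  filter_upwards [eventually_sin_pos, hgood] with θ hθ hgood
  refine ⟨fun j => ?_, ha.trans (hnorm θ), fun j => ?_⟩
  · by_cases hj : bad j
    · simp only [V, if_pos hj]
      rw [norm_smul, norm_cos_smul_add_sin_smul he hwe, norm_div, norm_norm,
        div_mul_cancel₀ _ hw0.ne', Real.norm_of_nonneg (hb j).le]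
    · simp only [V, if_neg hj, hv]
  · by_cases hj : bad j
    · intro h
      have h1 := congrArg (fun x => inner ℝ x e) h
      simp only [V, if_pos hj] at h1
      change inner ℝ (‖-∑ k, V θ k‖ • (b j / ‖w‖) • (Real.cos θ • w + Real.sin θ • e)) e
        = inner ℝ (b j • -∑ k, V θ k) e at h1
      rw [real_inner_smul_left, real_inner_smul_left, real_inner_smul_left, inner_add_left,
        real_inner_smul_left, real_inner_smul_left, real_inner_self_eq_norm_sq, hwe, he] at h1
      have h2 : inner ℝ (-∑ k, V θ k) e = -(β * Real.sin θ) * ‖w‖ ^ 2 := by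
        rw [hsum, inner_add_left, real_inner_smul_left, real_inner_smul_left,
          real_inner_self_eq_norm_sq, hwe, he]
        ring
      rw [h2] at h1
      have h3 : 0 < ‖-∑ k, V θ k‖ := hw0.trans_le (hnorm θ)
      have h4 : 0 < ‖-∑ k, V θ k‖ * (b j / ‖w‖ * (Real.cos θ * 0 + Real.sin θ * ‖w‖ ^ 2)) := by
        have := hb j
        rw [mul_zero, zero_add]
        positivity
      have h5 : b j * (-(β * Real.sin θ) * ‖w‖ ^ 2) ≤ 0 := by
        have h6 : 0 ≤ b j * (β * Real.sin θ * ‖w‖ ^ 2) := by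
          have := (hb j).le
          positivity
        linarith
      linarith
    · exact hgood j hj

open Classical in
/-- Lengthening the closing edge. -/
theorem mem_closure_norm_gt {a : ℝ} {v : κ → E3} (hv : ∀ j, ‖v j‖ = b j) (ha0 : 0 < a) (ha : a ≤ ‖-∑ k, v k‖) (hab : a < ∑ j, b j)
    (hnp : NoParallel b v) :
    v ∈ closure {v' | (∀ j, ‖v' j‖ = b j) ∧ a < ‖-∑ k, v' k‖ ∧ NoParallel b v'} := by
  rcases ha.lt_or_eq with h | haw
  · exact subset_closure ⟨hv, h, hnp⟩
  set w := -∑ k, v k with hw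
  have hw0 : 0 < ‖w‖ := ha0.trans_le ha
  -- If every edge were opposite to `w`, the closing edge would have length `∑ b_j > a`, whereas
  -- here `‖w‖ = a`.
  obtain ⟨j, hj⟩ : ∃ j, ‖w‖ • v j ≠ -(b j • w) := by
    by_contra! h
    have h1 : ‖w‖ • w = (∑ j, b j) • w := by
      conv_lhs => rw [hw]
      rw [smul_neg, Finset.smul_sum, Finset.sum_congr rfl fun j _ => h j, Finset.sum_neg_distrib,
        neg_neg, Finset.sum_smul]
    have h2 := smul_left_injective ℝ (norm_pos_iff.1 hw0) h1
    rw [← haw] at h2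
    exact hab.ne h2
  obtain ⟨g, hg, hvg, hgw⟩ := exists_perp_inner_neg (v := v j) (w := w)
    (by rw [hv]; exact hnp j) (by rw [hv]; exact hj)
  let V : ℝ → κ → E3 := fun θ => Function.update v j (Real.cos θ • v j + Real.sin θ • g)
  have hVc : Continuous V := continuous_const.update j (by fun_prop)
  have hV0 : V 0 = v := by simp [V]
  have hlim : Tendsto V (𝓝[>] 0) (𝓝 v) := by
    have := hVc.tendsto 0
    rw [hV0] at this
    exact this.mono_left nhdsWithin_le_nhds
  have hsum : ∀ θ, -∑ k, V θ k = w - ((Real.cos θ - 1) • v j + Real.sin θ • g) := by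
    intro θ
    have h1 : ∑ k, V θ k = ∑ k, v k + ((Real.cos θ - 1) • v j + Real.sin θ • g) := by
      rw [Finset.sum_update_of_mem (Finset.mem_univ j),
        ← Finset.add_sum_erase Finset.univ v (Finset.mem_univ j), Finset.sdiff_singleton_eq_erase]
      module
    rw [h1, hw]
    abel
  -- The first-order term `-sin θ ⟨g, w⟩` is positive and dominates; the half-angle formulas extract
  -- the common factor `2 sin (θ / 2)`.
  have hpos : ∀ᶠ θ in 𝓝[>] (0 : ℝ), 0 < (1 - Real.cos θ) * inner ℝ (v j) w
      - Real.sin θ * inner ℝ g w := by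
    have h1 : Tendsto (fun θ : ℝ => Real.sin (θ / 2) * inner ℝ (v j) w
        - Real.cos (θ / 2) * inner ℝ g w) (𝓝[>] 0) (𝓝 (Real.sin (0 / 2) * inner ℝ (v j) w
        - Real.cos (0 / 2) * inner ℝ g w)) :=
      ((by fun_prop : Continuous fun θ : ℝ => Real.sin (θ / 2) * inner ℝ (v j) w
        - Real.cos (θ / 2) * inner ℝ g w).tendsto 0).mono_left nhdsWithin_le_nhds
    have h2 : 0 < Real.sin (0 / 2) * inner ℝ (v j) w - Real.cos (0 / 2) * inner ℝ g w := by
      simp; exact hgw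
    filter_upwards [h1.eventually_const_lt h2, Ioo_mem_nhdsGT Real.pi_pos] with θ hθ hθ'
    have h3 : 0 < Real.sin (θ / 2) :=
      Real.sin_pos_of_pos_of_lt_pi (by linarith [hθ'.1]) (by linarith [hθ'.1, hθ'.2])
    have h4 : Real.cos θ = 1 - 2 * Real.sin (θ / 2) ^ 2 := by
      have := Real.cos_two_mul (θ / 2)
      rw [mul_div_cancel₀ θ two_ne_zero] at this
      rw [this, Real.cos_sq']
      ring
    have h5 : Real.sin θ = 2 * Real.sin (θ / 2) * Real.cos (θ / 2) := by
      have := Real.sin_two_mul (θ / 2)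
      rwa [mul_div_cancel₀ θ two_ne_zero] at this
    rw [h4, h5]
    have h6 := mul_pos h3 hθ
    nlinarith
  refine mem_closure_of_tendsto hlim ?_
  filter_upwards [hpos, hlim.eventually ((isOpen_noParallel b).mem_nhds hnp)] with θ hθ hnp'
  refine ⟨fun k => ?_, ?_, hnp'⟩
  · by_cases hk : k = j
    · subst hk
      simp only [V, Function.update_self]
      rw [norm_cos_smul_add_sin_smul hg hvg, hv]
    · simp only [V, Function.update_of_ne hk, hv]
  · have h1 : inner ℝ (-∑ k, V θ k) w = ‖w‖ ^ 2 + ((1 - Real.cos θ) * inner ℝ (v j) w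
      - Real.sin θ * inner ℝ g w) := by
      rw [hsum, inner_sub_left, inner_add_left, real_inner_smul_left, real_inner_smul_left,
        real_inner_self_eq_norm_sq]
      ring
    have h2 := real_inner_le_norm (-∑ k, V θ k) w
    rw [haw]
    nlinarith

theorem mem_closure_generic {a : ℝ} {v : κ → E3} (hb : ∀ j, 0 < b j)
    (hv : ∀ j, ‖v j‖ = b j) (ha0 : 0 < a) (ha : a ≤ ‖-∑ k, v k‖) (hab : a < ∑ j, b j) :
    v ∈ closure {v' | (∀ j, ‖v' j‖ = b j) ∧ a < ‖-∑ k, v' k‖ ∧ NoParallel b v'} :=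
  closure_minimal (fun _ h => mem_closure_norm_gt h.1 ha0 h.2.1 hab h.2.2) isClosed_closure
    (mem_closure_noParallel hb hv ha0 ha)

end perturb

end Hyperpolygon

/-! ### The core component -/

namespace Hyperpolygon

open scoped Matrix
open Matrix (vecMulVec)
open Filter Topology

variable {n : ℕ} {α : Fin n → ℝ} {S : Finset (Fin n)}

/-- The planar polygon is not collapsed, and no spatial edge points in the direction of the
distinguished edge. -/
def IsNondegenerate (α : Fin n → ℝ) (S : Finset (Fin n)) (d : VectorData S) : Prop :=
  (∃ i, d.u i ≠ 0) ∧ ∀ j, ‖d.w‖ • d.v j ≠ α j • d.w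

theorem IsPolygonPair.w_eq {d : VectorData S} (h : IsPolygonPair α S d) : d.w = -∑ j, d.v j :=
  eq_neg_of_add_eq_zero_left h.closed_spatial

/-- The planar polygon of a polygon pair is a multiple of a polygon that is not collapsed. -/
theorem IsPolygonPair.exists_scale (hpos : ∀ i, 0 < α i) (hcard : 2 ≤ S.card) {d : VectorData S}
    (h : IsPolygonPair α S d) : ∃ (ρ : ℝ) (u : S → E3), 0 ≤ ρ ∧ (∀ i, d.u i = ρ • u i) ∧
      (∃ i, u i ≠ 0) ∧ ∑ i, u i = 0 ∧ ∀ i, inner ℝ (u i) d.w = 0 := by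
  by_cases hu : ∃ i, d.u i ≠ 0
  · exact ⟨1, d.u, zero_le_one, fun i => (one_smul _ _).symm, hu, h.closed_planar, h.perp⟩
  · push Not at hu
    have hS : S.Nonempty := Finset.card_pos.1 (by omega)
    obtain ⟨e, he, hwe⟩ := exists_perp_norm_eq d.w
    obtain ⟨i, hi, i', hi', hne⟩ := Finset.one_lt_card.1 (by omega : 1 < S.card)
    have he0 : e ≠ 0 := norm_pos_iff.1 (by rw [he]; exact h.norm_w_pos hpos hS)
    have hne' : (⟨i, hi⟩ : S) ≠ ⟨i', hi'⟩ := fun h => hne (congrArg Subtype.val h)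
    -- A collapsed planar polygon is zero times the two-sided polygon `e, -e`, which needs two
    -- distinct indices in `S`.
    refine ⟨0, Pi.single ⟨i, hi⟩ e - Pi.single ⟨i', hi'⟩ e, le_rfl, fun k => by rw [hu, zero_smul],
      ⟨⟨i, hi⟩, ?_⟩, ?_, fun k => ?_⟩
    · simp [Pi.single_eq_of_ne hne', he0]
    · simp only [Pi.sub_apply, Finset.sum_sub_distrib, Finset.sum_pi_single', Finset.mem_univ,
        if_true]
      simp
    · have hew : inner ℝ e d.w = 0 := by rw [real_inner_comm]; exact hwe
      rw [Pi.sub_apply, inner_sub_left]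
      have hs : ∀ m : S, inner ℝ ((Pi.single m e : S → E3) k) d.w = 0 := fun m => by
        by_cases hk : k = m
        · subst hk; rw [Pi.single_eq_same, hew]
        · rw [Pi.single_eq_of_ne hk, inner_zero_left]
      rw [hs, hs, sub_zero]

/-- The component of `u` perpendicular to `w`. -/
noncomputable def perpPart (u w : E3) : E3 := u - (inner ℝ u w / ‖w‖ ^ 2) • w

theorem inner_perpPart (u : E3) {w : E3} (hw : w ≠ 0) : inner ℝ (perpPart u w) w = 0 := by
  have : ‖w‖ ^ 2 ≠ 0 := by simpa using hw
  rw [perpPart, inner_sub_left, real_inner_smul_left, real_inner_self_eq_norm_sq,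
    div_mul_cancel₀ _ this, sub_self]

theorem perpPart_eq_self {u w : E3} (h : inner ℝ u w = 0) : perpPart u w = u := by
  rw [perpPart, h, zero_div, zero_smul, sub_zero]

theorem sum_perpPart {ι : Type*} [Fintype ι] {u : ι → E3} (hu : ∑ i, u i = 0) (w : E3) :
    ∑ i, perpPart (u i) w = 0 := by
  simp only [perpPart, Finset.sum_sub_distrib, ← Finset.sum_smul, ← Finset.sum_div, ← sum_inner,
    hu, inner_zero_left, zero_div, zero_smul, sub_zero]

theorem continuousAt_perpPart (u : E3) {w : E3} (hw : w ≠ 0) : ContinuousAt (perpPart u) w := by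
  unfold perpPart
  have : ‖w‖ ^ 2 ≠ 0 := by simpa using hw
  exact continuousAt_const.sub (((by fun_prop : Continuous fun x => inner ℝ u x).continuousAt.div
    (by fun_prop) this).smul continuousAt_id)

theorem exists_edgeLength_eq {ι : Type*} [Fintype ι] {a g : ι → ℝ} (ha : ∀ i, 0 ≤ a i)
    (hg0 : ∀ i, 0 ≤ g i) (hg : ∃ i, g i ≠ 0) {W : ℝ} (hW : ∑ i, a i < W) :
    ∃ ρ, 0 < ρ ∧ edgeLength a g ρ = W := by
  obtain ⟨M, hM, hM0⟩ := (((tendsto_edgeLength_atTop (a := a) hg0 hg).eventually_ge_atTop W).and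
    (eventually_ge_atTop 0)).exists
  obtain ⟨ρ, hρ, h⟩ := intermediate_value_Icc hM0 (continuous_edgeLength a g).continuousOn
    ⟨by rw [edgeLength_zero ha]; exact hW.le, hM⟩
  refine ⟨ρ, hρ.1.lt_of_ne fun h0 => ?_, h⟩
  rw [← h0, edgeLength_zero ha] at h
  exact hW.ne h

theorem IsShort.sum_lt (hshort : IsShort α S) :
    ∑ i : S, α i < ∑ j : (Sᶜ : Finset (Fin n)), α j := by
  rwa [IsShort, ← Finset.sum_coe_sort S, ← Finset.sum_coe_sort Sᶜ] at hshort

/-- Nondegenerate polygon pairs are dense. -/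
theorem IsPolygonPair.mem_closure_isNondegenerate (hpos : ∀ i, 0 < α i) (hshort : IsShort α S)
    (hcard : 2 ≤ S.card) {d : VectorData S} (h : IsPolygonPair α S d) :
    d ∈ closure {d' | IsPolygonPair α S d' ∧ IsNondegenerate α S d'} := by
  have hS : S.Nonempty := Finset.card_pos.1 (by omega)
  set b : (Sᶜ : Finset (Fin n)) → ℝ := fun j => α j with hbdef
  set a : S → ℝ := fun i => α i with hadef
  have ha0 : ∀ i, 0 ≤ a i := fun i => (hpos i).le
  obtain ⟨ρ₀, u, hρ₀, hu, ⟨i₀, hi₀⟩, husum, huw⟩ := h.exists_scale hpos hcard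
  have hw0 : d.w ≠ 0 := norm_pos_iff.1 (h.norm_w_pos hpos hS)
  have hlen : edgeLength a (fun i => ‖u i‖) ρ₀ = ‖d.w‖ := by
    rw [h.length_w, edgeLength]
    refine Finset.sum_congr rfl fun i _ => ?_
    rw [hu, norm_smul, Real.norm_of_nonneg hρ₀]
  have hasum : 0 < ∑ i, a i := by
    have : Nonempty S := hS.to_subtype
    exact Finset.sum_pos (fun i _ => hpos i) Finset.univ_nonempty
  have hge : ∑ i, a i ≤ ‖d.w‖ := by
    rw [← hlen, ← edgeLength_zero (g := fun i => ‖u i‖) ha0]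
    exact edgeLength_mono _ _ le_rfl hρ₀
  have hcl := mem_closure_generic (b := b) (v := d.v) (a := ∑ i, a i) (fun j => hpos j)
    h.length_v hasum (by rw [← h.w_eq]; exact hge) hshort.sum_lt
  set G := {v' : (Sᶜ : Finset (Fin n)) → E3 | (∀ j, ‖v' j‖ = b j) ∧ ∑ i, a i < ‖-∑ k, v' k‖ ∧
    NoParallel b v'} with hG
  have hne : (𝓝[G] d.v).NeBot := mem_closure_iff_nhdsWithin_neBot.1 hcl
  -- For a nearby spatial polygon, the planar one is projected orthogonally to the new closing edge
  -- and rescaled until the length condition holds. Strict excess of `‖w‖` over `∑ a` makes the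
  -- scale positive.
  have hex : ∀ v' : (Sᶜ : Finset (Fin n)) → E3, ∃ ρ : ℝ, ∑ i, a i < ‖-∑ k, v' k‖ →
      (∃ i, perpPart (u i) (-∑ k, v' k) ≠ 0) → (0 < ρ ∧
        edgeLength a (fun i => ‖perpPart (u i) (-∑ k, v' k)‖) ρ = ‖-∑ k, v' k‖) := by
    intro v'
    by_cases h1 : ∑ i, a i < ‖-∑ k, v' k‖ ∧ ∃ i, perpPart (u i) (-∑ k, v' k) ≠ 0
    · obtain ⟨ρ, hρ⟩ := exists_edgeLength_eq ha0
        (g := fun i => ‖perpPart (u i) (-∑ k, v' k)‖) (fun i => norm_nonneg _)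
        (h1.2.imp fun i hi => norm_ne_zero_iff.2 hi) h1.1
      exact ⟨ρ, fun _ _ => hρ⟩
    · exact ⟨0, fun h2 h3 => (h1 ⟨h2, h3⟩).elim⟩
  choose ρ hρ using hex
  have hwlim : Tendsto (fun v' : (Sᶜ : Finset (Fin n)) → E3 => -∑ k, v' k) (𝓝[G] d.v)
      (𝓝 d.w) := by
    rw [h.w_eq]
    exact ((by fun_prop : Continuous fun v' : (Sᶜ : Finset (Fin n)) → E3 =>
      -∑ k, v' k).tendsto d.v).mono_left nhdsWithin_le_nhds
  have hvlim : Tendsto (fun v' : (Sᶜ : Finset (Fin n)) → E3 => v') (𝓝[G] d.v) (𝓝 d.v) :=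
    tendsto_id.mono_left nhdsWithin_le_nhds
  have hplim : ∀ i, Tendsto (fun v' : (Sᶜ : Finset (Fin n)) → E3 =>
      perpPart (u i) (-∑ k, v' k)) (𝓝[G] d.v) (𝓝 (u i)) := fun i => by
    have h1 := (continuousAt_perpPart (u i) hw0).tendsto.comp hwlim
    rwa [perpPart_eq_self (huw i)] at h1
  have hmem : ∀ᶠ v' in 𝓝[G] d.v, v' ∈ G := self_mem_nhdsWithin
  have hρ' : ∀ᶠ v' in 𝓝[G] d.v, (∃ i, perpPart (u i) (-∑ k, v' k) ≠ 0) ∧ 0 < ρ v' ∧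
      edgeLength a (fun i => ‖perpPart (u i) (-∑ k, v' k)‖) (ρ v') = ‖-∑ k, v' k‖ := by
    filter_upwards [hmem, (hplim i₀).eventually_ne hi₀] with v' h1 h2
    exact ⟨⟨i₀, h2⟩, hρ v' h1.2.1 ⟨i₀, h2⟩⟩
  have hEdge : ∀ x, Tendsto (fun v' : (Sᶜ : Finset (Fin n)) → E3 => ‖-∑ k, v' k‖
      - edgeLength a (fun i => ‖perpPart (u i) (-∑ k, v' k)‖) x) (𝓝[G] d.v)
      (𝓝 (‖d.w‖ - edgeLength a (fun i => ‖u i‖) x)) := by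
    intro x
    refine hwlim.norm.sub (tendsto_finsetSum _ fun i _ => ?_)
    exact (Real.continuous_sqrt.tendsto _).comp
      (((((hplim i).norm).const_mul x).pow 2).const_add (a i ^ 2))
  have hu0 : ∃ i, ‖u i‖ ≠ 0 := ⟨i₀, norm_ne_zero_iff.2 hi₀⟩
  -- The limiting edge length is strictly monotone in the scale, so comparison at fixed scales on
  -- either side of `ρ₀` confines `ρ`.
  have hρlim : Tendsto ρ (𝓝[G] d.v) (𝓝 ρ₀) := by
    refine tendsto_order.2 ⟨fun x hx => ?_, fun x hx => ?_⟩
    · by_cases hx0 : 0 ≤ x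
      · have h1 := edgeLength_strictMono (a := a) hu0 hx0 hx
        rw [hlen, ← sub_pos] at h1
        filter_upwards [hρ', (hEdge x).eventually_const_lt h1] with v' h2 h3
        by_contra! h4
        have h5 := edgeLength_mono a (fun i => ‖perpPart (u i) (-∑ k, v' k)‖) h2.2.1.le h4
        rw [h2.2.2] at h5
        linarith
      · filter_upwards [hρ'] with v' h2 using (not_le.1 hx0).trans h2.2.1
    · have h1 := edgeLength_strictMono (a := a) hu0 hρ₀ hx
      rw [hlen, ← sub_neg] at h1
      filter_upwards [hρ', (hEdge x).eventually_lt_const h1] with v' h2 h3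
      by_contra! h4
      have h5 := edgeLength_mono a (fun i => ‖perpPart (u i) (-∑ k, v' k)‖) (hρ₀.trans hx.le) h4
      rw [h2.2.2] at h5
      linarith
  let D : ((Sᶜ : Finset (Fin n)) → E3) → VectorData S := fun v' =>
    ⟨fun i => ρ v' • perpPart (u i) (-∑ k, v' k), v', -∑ k, v' k⟩
  have hD : Tendsto D (𝓝[G] d.v) (𝓝 d) := by
    refine VectorData.tendsto_iff.2 ⟨fun i => ?_, fun j => ?_, hwlim⟩
    · rw [hu]
      exact hρlim.smul (hplim i)
    · exact ((continuous_apply j).tendsto _).comp hvlim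
  refine mem_closure_of_tendsto hD ?_
  filter_upwards [hmem, hρ'] with v' ⟨hv1, hv2, hv3⟩ ⟨⟨i, hi⟩, hρ0, hρ1⟩
  have hw' : -∑ k, v' k ≠ 0 := norm_pos_iff.1 (hasum.trans hv2)
  refine ⟨⟨?_, ?_, fun i => ?_, hv1, ?_⟩, ⟨i, smul_ne_zero hρ0.ne' hi⟩, hv3⟩
  · exact neg_add_cancel _
  · simp only [D, ← Finset.smul_sum, sum_perpPart husum, smul_zero]
  · simp only [D]
    rw [real_inner_smul_left, inner_perpPart _ hw', mul_zero]
  · simp only [D]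
    rw [← hρ1, edgeLength]
    refine Finset.sum_congr rfl fun i _ => ?_
    rw [norm_smul, Real.norm_of_nonneg hρ0.le]

theorem hopf_smul (c : ℂ) (q : Fin 2 → ℂ) : hopf (c • q) = (‖c‖ ^ 2) • hopf q := by
  rw [hopf, hopf, star_smul, Matrix.vecMulVec_smul, Matrix.smul_vecMulVec, smul_smul, ← map_smul]
  congr 1
  rw [Complex.star_def, Complex.conj_mul']
  ext k l; simp

theorem IsNondegenerate.rotate {d : VectorData S} (h : IsNondegenerate α S d)
    (R : E3 ≃ₗᵢ[ℝ] E3) : IsNondegenerate α S (d.rotate R) := by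
  obtain ⟨⟨i, hi⟩, hv⟩ := h
  refine ⟨⟨i, fun h0 => hi (R.injective (h0.trans (map_zero R).symm))⟩, fun j hj => hv j ?_⟩
  apply R.injective
  rw [map_smul, map_smul]
  simpa [VectorData.rotate] using hj

/-- Nondegenerate polygon pairs come from points that flow up to the fixed component. -/
theorem IsPolygonPair.exists_flowsUpTo (hpos : ∀ i, 0 < α i) (hshort : IsShort α S)
    (hS : S.Nonempty) {d : VectorData S} (h : IsPolygonPair α S d) (hd : IsNondegenerate α S d) :
    ∃ (R : E3 ≃ₗᵢ[ℝ] E3) (z : Cot n) (hz : IsCore α S z), IsRotation R ∧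
      poly S z = d.rotate R ∧ ∃ y ∈ fixedComponent α S, FlowsUpTo (X.mk (α := α) ⟨z, hz.level⟩) y := by
  obtain ⟨R, γ, q, hR, hz, hzR⟩ := h.exists_normalForm hpos hS
  obtain ⟨⟨i, hi⟩, hv⟩ := hd.rotate R
  rw [← hzR] at hi hv
  have hα := (isLevel_iff.1 hz.level).1
  have hp := hz.isPolygonPair hpos hS
  let ζ : Fin n → ℂ := fun j => q j 0 / q j 1
  have hsq : ∀ j : (Sᶜ : Finset (Fin n)), sqNorm (q j) = 2 * α j := fun j => by
    have h1 := hp.length_v j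
    rw [poly_v_normalForm, norm_hopf] at h1
    linarith
  -- If `q_j` were horizontal, `v_j` would point straight up, along `w`; nondegeneracy thus makes
  -- the stereographic coordinate finite.
  have hq1 : ∀ j : (Sᶜ : Finset (Fin n)), q j 1 ≠ 0 := by
    intro j h1
    have h2 : hopf (q j) = α j • EuclideanSpace.single 2 1 := by
      have h3 := hsq j
      rw [sqNorm_eq, h1] at h3
      apply E3.ext
      · rw [hopf_zero', h1]; simp
      · rw [hopf_one', h1]; simp
      · rw [hopf_two', h1]
        simp only [norm_zero] at h3 ⊢
        simp
        linarith
    have h3 : (poly S (normalForm α S γ q)).w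
        = ‖(poly S (normalForm α S γ q)).w‖ • EuclideanSpace.single 2 1 := by
      rw [isNormal_normalForm.norm_poly_w, isNormal_normalForm.poly_w]
      apply E3.ext <;> simp
    apply hv j
    rw [poly_v_normalForm, h2]
    conv_rhs => rw [h3]
    rw [smul_comm]
  -- `affineVec` has the line and the length of `q_j`, so it differs from it by a phase, which the
  -- Hopf map forgets.
  have hhopf : ∀ j : (Sᶜ : Finset (Fin n)), hopf (affineVec α ζ j) = hopf (q j) := by
    intro j
    have h1 : q j = q j 1 • ![ζ j, 1] := by
      ext k; fin_cases k
      · simp [ζ, mul_div_cancel₀ _ (hq1 j)]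
      · simp
    have h2 := sqNorm_affineVec hpos ζ j
    have h3 := hsq j
    rw [h1, sqNorm_smul] at h3
    rw [affineVec, sqNorm_smul] at h2
    rw [h1, affineVec, hopf_smul, hopf_smul]
    have h4 : sqNorm ![ζ j, 1] ≠ 0 := by
      rw [sqNorm_eq]; simp; positivity
    rw [mul_right_cancel₀ h4 (h2.trans h3.symm)]
  have hpoly : poly S (normalForm α S γ (affineVec α ζ)) = poly S (normalForm α S γ q) := by
    refine VectorData.ext' (fun i => ?_) (fun j => ?_) ?_
    · rw [poly_u_normalForm hpos, poly_u_normalForm hpos]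
    · rw [poly_v_normalForm, poly_v_normalForm, hhopf]
    · rw [poly_w_normalForm hpos, poly_w_normalForm hpos]
  have hz' : IsCore α S (normalForm α S γ (affineVec α ζ)) := by
    refine isNormal_normalForm.isCore hpos (fun k => ?_)
      (fun j hj => normalForm_fst_of_notMem (Finset.mem_compl.1 hj)) ?_ ?_
    · by_cases hk : k ∈ S
      · rw [sqNorm_snd_normalForm hpos hk, sqNorm_fst_normalForm hpos hk]; ring
      · rw [normalForm_fst_of_notMem hk, normalForm_snd_of_notMem hk, sqNorm_affineVec hpos]
        simp [sqNorm]
    · rw [hpoly]; exact hp.closed_spatial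
    · rw [hpoly]; exact hp.closed_planar
  refine ⟨R, _, hz', hR, hpoly.trans hzR, exists_flowsUpTo_affine hpos hshort ⟨i, i.2, ?_⟩ ?_ hz'⟩
  · intro h0
    apply hi
    rw [poly_u_normalForm hpos, h0]
    apply E3.ext <;> simp
  · have h1 := hp.closed_planar
    simp only [poly_u_normalForm hpos] at h1
    apply Complex.ext
    · have := congrArg (fun x : E3 => x 0) h1
      simpa using this
    · have := congrArg (fun x : E3 => x 1) h1
      simpa using this

/-- Nondegenerate pairs are dense among polygon pairs, and the inverse of the homeomorphism carries
this density into `X`, where their classes flow up to `X_S`. -/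
theorem coreSet_subset_coreComponent (hpos : ∀ i, 0 < α i) (hshort : IsShort α S)
    (hcard : 2 ≤ S.card) : coreSet α S ⊆ coreComponent α S := by
  have hS : S.Nonempty := Finset.card_pos.1 (by omega)
  obtain ⟨Φ, hΦ⟩ := exists_homeomorph_coreSet (α := α) hpos hS
  rintro _ ⟨z, rfl, hz⟩
  have hd := hz.isPolygonPair hpos hS
  have h1 : (⟨poly S z.1, hd⟩ : PolygonPair α S)
      ∈ closure {d : PolygonPair α S | IsNondegenerate α S d.1} := by
    rw [closure_subtype]
    refine closure_mono ?_ (hd.mem_closure_isNondegenerate hpos hshort hcard)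
    rintro d ⟨h1, h2⟩
    exact ⟨⟨d, h1⟩, h2, rfl⟩
  let g : PolygonPair α S → X α := fun d => (Φ.symm (PolygonPairModuli.mk d)).1
  have hg : Continuous g := continuous_subtype_val.comp
    (Φ.symm.continuous.comp PolygonPairModuli.continuous_mk)
  have hgz : ∀ (y : Cot n) (hy : IsCore α S y),
      g ⟨poly S y, hy.isPolygonPair hpos hS⟩ = X.mk ⟨y, hy.level⟩ := fun y hy => by
    simp only [g, ← hΦ y hy, Homeomorph.symm_apply_apply]
  have h2 : g ⟨poly S z.1, hd⟩ ∈ closure (g '' {d : PolygonPair α S | IsNondegenerate α S d.1}) :=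
    image_closure_subset_closure_image hg ⟨_, h1, rfl⟩
  rw [hgz z.1 hz] at h2
  refine closure_mono ?_ h2
  rintro _ ⟨d, hnd, rfl⟩
  obtain ⟨R, y, hy, hR, hyR, hflow⟩ := d.2.exists_flowsUpTo hpos hshort hS hnd
  have h3 : g d = X.mk ⟨y, hy.level⟩ := by
    have h4 : PolygonPairModuli.mk d
        = PolygonPairModuli.mk ⟨poly S y, hy.isPolygonPair hpos hS⟩ :=
      PolygonPairModuli.mk_eq_iff.2 ⟨R, hR, hyR⟩
    rw [← hgz y hy]
    simp only [g, h4]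
  rw [h3]
  exact hflow

theorem coreComponent_eq_coreSet (hpos : ∀ i, 0 < α i) (hgen : IsGeneric α)
    (hshort : IsShort α S) (hcard : 2 ≤ S.card) : coreComponent α S = coreSet α S := by
  have hS : S.Nonempty := Finset.card_pos.1 (by omega)
  have hSc : Sᶜ.Nonempty := by
    by_contra h
    rw [Finset.not_nonempty_iff_eq_empty] at h
    rw [IsShort, h, Finset.sum_empty] at hshort
    exact absurd (Finset.sum_nonneg fun i (_ : i ∈ S) => (hpos i).le) (not_le.2 hshort)
  exact (coreComponent_subset hpos hgen hS hSc).antisymm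
    (coreSet_subset_coreComponent hpos hshort hcard)

end Hyperpolygon

theorem mainTheorem5 {n : ℕ} (α : Fin n → ℝ) (hpos : ∀ i, 0 < α i)
    (hgen : Hyperpolygon.IsGeneric α) (S : Finset (Fin n))
    (hshort : Hyperpolygon.IsShort α S) (hcard : 2 ≤ S.card) :
    Nonempty (Hyperpolygon.coreComponent α S ≃ₜ Hyperpolygon.PolygonPairModuli α S) := by
  obtain ⟨Φ, -⟩ := Hyperpolygon.exists_homeomorph_coreSet (α := α) hpos
    (Finset.card_pos.1 (by omega : 0 < S.card))
  exact ⟨(Homeomorph.setCongr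
    (Hyperpolygon.coreComponent_eq_coreSet hpos hgen hshort hcard)).trans Φ⟩
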